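/- For integers $n_0>1$, $m\ge 1$ and $N=n_0m$, let $H_0=[\,I\mid \mathbf 1\,]$ be the $(n_0-1)\times n_0$ parity check matrix and $G_0=(1\cdots1)$ the generator matrix of the binary repetition code of length $n_0$. For a binary $r\times m$ matrix $H_2$ let $\mathscr Q(n_0,H_2)$ be the CSS code on $N$ qubits for which $\mathscr H_X=H_2(I_m\otimes G_0)$ checks the $X$-errors and $\mathscr H_Z=I_m\otimes H_0$ checks the $Z$-errors: its stabilizer group is generated by the operators $Z(h)$, $h$ a row of $\mathscr H_X$, and $X(h)$, $h$ a row of $\mathscr H_Z$. The syndrome of a Pauli error $X(a)Z(b)$ is $(\mathscr H_Xa^T,\mathscr H_Zb^T)$, and its weight is the number of qubits on which it acts nontrivially. The minimum distance is the least weight of a Pauli error that commutes with the stabilizer group but does not belong to it up to a phase. There are binary $r_m\times m$ matrices $H_2^{(m)}$ with $r_m\le m$, for all $m$, and two fixed programs $\mathcal D_{\rm seq}$, $\mathcal D_{\rm par}$ for a parallel random access machine with shared memory and words of $O(\log N)$ bits, such that the following holds for all $\alpha,\beta>0$. There are constants $c,C>0$ such that for all integers $n_0>1$ and $N>1$ with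 $n_0\mid N$ and $\alpha\sqrt N\le n_0\le\beta\sqrt N$ (that is, $n_0=\Theta(\sqrt N)$), with $m=N/n_0$, the code $\mathscr Q_1=\mathscr Q(n_0,H_2^{(m)})$ has the following properties. 1. $\mathscr Q_1=[[N,k,d]]$, i.e. it is a subspace of dimension $2^k$ and of minimum distance $d$, with $k\ge c\sqrt N$ and $d\ge c\sqrt N$. 2. Given $n_0$, $m$, $r_m$, $H_2^{(m)}$ and a syndrome as input, $\mathcal D_{\rm seq}$ outputs a Pauli recovery operator in at most $CN$ steps on one processor. If the syndrome is that of a Pauli error of weight less than $\tfrac12c\sqrt N$, the recovery operator corrects this error, i.e. it restores every code state up to a global phase. 3. The same holds for $\mathcal D_{\rm par}$ with at most $C\sqrt N$ parallel steps on at most $C\sqrt N$ processors. 4. There is a circuit of Hadamard and CNOT gates with at most $CN$ gates and depth at most $C\sqrt N$ that encodes $\mathscr Q_1$: it maps the states $|\psi\rangle\otimes|0\cdots0\rangle$, with $|\psi\rangle$ an arbitrary state of a fixed set of qubits, onto $\mathscr Q_1$. Moreover, for fixed $0\le p_z<1/4$, if every qubit independently suffers a $Z$-error with probability $p_z$, then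 for each of the two decoders the probability $\mathcal P_Z$ that the resulting error is not corrected satisfies $N^{e}\mathcal P_Z\to0$ for every $e\ge 0$ as $N\to\infty$, uniformly over all $n_0$ as above. -/

import Mathlib

open scoped Matrix Kronecker

namespace PCCSS

/-! ### Qubits, Pauli operators, stabilizer codes -/

section Quantum

variable {ι : Type} [Fintype ι] [DecidableEq ι]

/-- Bit vectors indexed by the set `ι` of qubits. -/
abbrev Bits (ι : Type) : Type := ι → ZMod 2

/-- The state space `ℂ^(2^|ι|)`; `φ x` is the amplitude of the basis state `|x⟩`. -/
abbrev QState (ι : Type) : Type := Bits ι → ℂ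

/-- `X(u)|x⟩ = |x + u⟩`. -/
def pauliX (u : Bits ι) : QState ι ≃ₗ[ℂ] QState ι :=
  LinearEquiv.funCongrLeft ℂ ℂ (Equiv.subRight u)

/-- `(-1)^b`. -/
def sign (b : ZMod 2) : ℂ := (-1) ^ b.val

theorem sign_mul_sign (b : ZMod 2) : sign b * sign b = 1 := by
  unfold sign
  rw [← mul_pow]
  norm_num

/-- `Z(v)|x⟩ = (-1)^(v·x)|x⟩`. -/
def pauliZ (v : Bits ι) : QState ι ≃ₗ[ℂ] QState ι where
  toFun φ := fun x => sign (v ⬝ᵥ x) * φ x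
  invFun φ := fun x => sign (v ⬝ᵥ x) * φ x
  map_add' φ ψ := by
    funext x
    simp [mul_add]
  map_smul' c φ := by
    funext x
    simp [mul_left_comm]
  left_inv φ := by
    funext x
    simp [← mul_assoc, sign_mul_sign]
  right_inv φ := by
    funext x
    simp [← mul_assoc, sign_mul_sign]

/-- The Pauli error `X(a)Z(b)`; up to a phase these are all Pauli errors. -/
def pauli (a b : Bits ι) : QState ι ≃ₗ[ℂ] QState ι := pauliX a * pauliZ b

/-- The number of qubits on which `X(a)Z(b)` acts nontrivially. -/
def pauliWeight (a b : Bits ι) : ℕ :=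
  (Finset.univ.filter fun i => a i ≠ 0 ∨ b i ≠ 0).card

/-- The stabilizer group of the CSS code in which the rows of `HX` check the `X`-errors
(so they are `Z`-type generators) and the rows of `HZ` check the `Z`-errors. -/
def stabilizer {ρ σ : Type} (HX : Matrix ρ ι (ZMod 2)) (HZ : Matrix σ ι (ZMod 2)) :
    Subgroup (QState ι ≃ₗ[ℂ] QState ι) :=
  Subgroup.closure
    (Set.range (fun i => pauliZ (HX i)) ∪ Set.range (fun j => pauliX (HZ j)))

/-- The subspace fixed by a group of operators. -/
def codeSpace (S : Subgroup (QState ι ≃ₗ[ℂ] QState ι)) : Submodule ℂ (QState ι) where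
  carrier := {φ | ∀ s ∈ S, s φ = φ}
  add_mem' hφ hψ s hs := by rw [map_add, hφ s hs, hψ s hs]
  zero_mem' s _ := map_zero s
  smul_mem' c φ hφ s hs := by rw [map_smul, hφ s hs]

/-- The minimum weight of a Pauli error that commutes with the whole stabilizer group and does
not belong to it, even after multiplication by a phase (`0` if there is no such error). -/
noncomputable def minDist (S : Subgroup (QState ι ≃ₗ[ℂ] QState ι)) : ℕ :=
  sInf {w | ∃ a b : Bits ι, pauliWeight a b = w ∧
    (∀ s ∈ S, Commute (pauli a b) s) ∧
    ¬ ∃ s ∈ S, ∃ ω : ℂ, ∀ φ, pauli a b φ = ω • s φ}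

/-- Applying the Pauli operator `X(r.1)Z(r.2)` undoes the error `X(a)Z(b)` on every code state,
up to a global phase. -/
def Corrects (Q : Submodule ℂ (QState ι)) (r : Bits ι × Bits ι) (a b : Bits ι) : Prop :=
  ∃ ω : ℂ, ‖ω‖ = 1 ∧ ∀ φ ∈ Q, pauli r.1 r.2 (pauli a b φ) = ω • φ

/-! ### Quantum circuits -/

/-- Hadamard and controlled-NOT gates. -/
inductive Gate (ι : Type) : Type
  | had (i : ι) : Gate ι
  | cnot (control target : ι) (ne : control ≠ target) : Gate ι

/-- The qubits a gate acts on. -/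
def Gate.support : Gate ι → Finset ι
  | .had i => {i}
  | .cnot c t _ => {c, t}

/-- The unitary operator of a gate. -/
noncomputable def Gate.op : Gate ι → Module.End ℂ (QState ι)
  | .had i =>
    { toFun := fun φ x => ((Real.sqrt 2 : ℝ) : ℂ)⁻¹ *
        ∑ y : ZMod 2, sign (y * x i) * φ (Function.update x i y)
      map_add' := by
        intro φ ψ
        funext x
        simp [mul_add, Finset.sum_add_distrib]
      map_smul' := by
        intro c φ
        funext x
        simp only [Pi.smul_apply, smul_eq_mul, RingHom.id_apply, Finset.mul_sum]
        exact Finset.sum_congr rfl fun y _ => by ring }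
  | .cnot c t _ => LinearMap.funLeft ℂ ℂ fun x => Function.update x t (x t + x c)

/-- A circuit is a list of layers, applied from left to right. -/
abbrev Circuit (ι : Type) : Type := List (List (Gate ι))

/-- Gates in the same layer act on disjoint sets of qubits. -/
def Circuit.WellFormed (c : Circuit ι) : Prop :=
  ∀ layer ∈ c, layer.Pairwise fun g h => Disjoint g.support h.support

/-- The number of gates. -/
def Circuit.size (c : Circuit ι) : ℕ := c.flatten.length

/-- The number of layers. -/
def Circuit.depth (c : Circuit ι) : ℕ := c.length

/-- The unitary operator of a circuit. -/
noncomputable def Circuit.op (c : Circuit ι) : Module.End ℂ (QState ι) :=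
  (c.flatten.map Gate.op).reverse.prod

/-- The states `|ψ⟩ ⊗ |0⋯0⟩` with `|ψ⟩` an arbitrary state of the qubits in `M`. -/
def messageSpace (M : Finset ι) : Submodule ℂ (QState ι) where
  carrier := {φ | ∀ x : Bits ι, (∃ i ∉ M, x i ≠ 0) → φ x = 0}
  add_mem' hφ hψ x hx := by simp [hφ x hx, hψ x hx]
  zero_mem' _ _ := rfl
  smul_mem' c φ hφ x hx := by simp [hφ x hx]

/-- The circuit maps the message states, with all other qubits initialized to `|0⟩`, unitarily
onto the code `Q`. -/
def Circuit.Encodes (c : Circuit ι) (Q : Submodule ℂ (QState ι)) : Prop :=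
  c.WellFormed ∧ ∃ M : Finset ι, (messageSpace M).map c.op = Q

end Quantum

/-! ### The partially concatenated codes -/

/-- The parity check matrix `[I | 1]` of the repetition code of length `n₀`. -/
def repCheck (n₀ : ℕ) : Matrix (Fin (n₀ - 1)) (Fin n₀) (ZMod 2) :=
  fun i j => if j.val = i.val ∨ j.val = n₀ - 1 then 1 else 0

/-- The generator matrix `(1 ⋯ 1)` of the repetition code of length `n₀`. -/
def repGen (n₀ : ℕ) : Matrix (Fin 1) (Fin n₀) (ZMod 2) := fun _ _ => 1

/-- The qubits: `m` blocks of `n₀` qubits. -/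
abbrev Qubit (n₀ m : ℕ) : Type := Fin m × Fin n₀

/-- `H₁ = I ⊗ H₀`, which checks the `Z`-errors. -/
def checkZ (n₀ m : ℕ) : Matrix (Fin m × Fin (n₀ - 1)) (Qubit n₀ m) (ZMod 2) :=
  (1 : Matrix (Fin m) (Fin m) (ZMod 2)) ⊗ₖ repCheck n₀

/-- `G₁ = I ⊗ G₀`. -/
def innerGen (n₀ m : ℕ) : Matrix (Fin m) (Qubit n₀ m) (ZMod 2) :=
  ((1 : Matrix (Fin m) (Fin m) (ZMod 2)) ⊗ₖ repGen n₀).submatrix (fun i => (i, 0)) id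

/-- `H₂ G₁`, which checks the `X`-errors. -/
def checkX (n₀ : ℕ) {m r : ℕ} (H₂ : Matrix (Fin r) (Fin m) (ZMod 2)) :
    Matrix (Fin r) (Qubit n₀ m) (ZMod 2) :=
  H₂ * innerGen n₀ m

/-- The stabilizer group of the code built from `H₂` and the repetition code of length `n₀`. -/
def stab (n₀ : ℕ) {m r : ℕ} (H₂ : Matrix (Fin r) (Fin m) (ZMod 2)) :
    Subgroup (QState (Qubit n₀ m) ≃ₗ[ℂ] QState (Qubit n₀ m)) :=
  stabilizer (checkX n₀ H₂) (checkZ n₀ m)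

/-- The code built from `H₂` and the repetition code of length `n₀`. -/
def code (n₀ : ℕ) {m r : ℕ} (H₂ : Matrix (Fin r) (Fin m) (ZMod 2)) :
    Submodule ℂ (QState (Qubit n₀ m)) :=
  codeSpace (stab n₀ H₂)

/-! ### Parallel random access machine -/

/-- Programs of a synchronous parallel random access machine with word arithmetic. Each processor
has its own registers, numbered by `ℕ`, and all processors share one memory. Register numbers and
constants are part of the program. -/
inductive Prog : Type
  /-- `R_d := c` -/
  | const (d c : ℕ) : Prog
  /-- `R_d :=` number of the processor -/
  | procId (d : ℕ) : Prog
  /-- `R_d := R_a + R_b` -/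
  | add (d a b : ℕ) : Prog
  /-- `R_d := max(R_a - R_b, 0)` -/
  | sub (d a b : ℕ) : Prog
  /-- `R_d := R_a * R_b` -/
  | mul (d a b : ℕ) : Prog
  /-- `R_d := memory[R_a]` -/
  | load (d a : ℕ) : Prog
  /-- `memory[R_a] := R_b` -/
  | store (a b : ℕ) : Prog
  /-- first `s`, then `t` -/
  | seq (s t : Prog) : Prog
  /-- repeat `body`; the number of repetitions is the content, on entry, of `R_a` of
  processor `0`, which controls all processors -/
  | loop (a : ℕ) (body : Prog) : Prog

/-- The configuration: `reg p d` is register `d` of processor `p`. -/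
structure Config : Type where
  reg : ℕ → ℕ → ℕ
  mem : ℕ → ℕ

/-- Every processor `p < P` sets its register `d` to `f p`, reduced to a word. -/
def Config.setReg (W P : ℕ) (s : Config) (d : ℕ) (f : ℕ → ℕ) : Config :=
  { s with reg := fun p => if p < P then Function.update (s.reg p) d (f p % W) else s.reg p }

/-- Every processor `p < P` writes `R_b` to address `R_a`. If several processors write to the
same address, the one with the smallest number succeeds. -/
def Config.storeAll (P : ℕ) (s : Config) (a b : ℕ) : Config :=
  { s with mem := fun x =>
      match (List.range P).find? (fun p => s.reg p a = x) with
      | some p => s.reg p b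
      | none => s.mem x }

/-- The configuration after running a program on `P` processors with words in `{0, …, W - 1}`,
and the number of steps. An elementary instruction, executed by all processors simultaneously,
takes one step; entering a loop and each of its repetitions cost one additional step. -/
def Prog.run (W P : ℕ) : Prog → Config → Config × ℕ
  | .const d c, s => (s.setReg W P d fun _ => c, 1)
  | .procId d, s => (s.setReg W P d fun p => p, 1)
  | .add d a b, s => (s.setReg W P d fun p => s.reg p a + s.reg p b, 1)
  | .sub d a b, s => (s.setReg W P d fun p => s.reg p a - s.reg p b, 1)
  | .mul d a b, s => (s.setReg W P d fun p => s.reg p a * s.reg p b, 1)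
  | .load d a, s => (s.setReg W P d fun p => s.mem (s.reg p a), 1)
  | .store a b, s => (s.storeAll P a b, 1)
  | .seq t u, s => ((u.run W P (t.run W P s).1).1, (t.run W P s).2 + (u.run W P (t.run W P s).1).2)
  | .loop a body, s =>
      (fun q : Config × ℕ => ((body.run W P q.1).1, q.2 + (body.run W P q.1).2 + 1))^[s.reg 0 a]
        (s, 1)

/-- The number of different words when a word has `κ * (⌊log₂ N⌋ + 1)` bits. -/
def wordCount (κ N : ℕ) : ℕ := 2 ^ (κ * (Nat.log 2 N + 1))

/-! ### Syndrome decoders -/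

/-- The input of a syndrome decoder: the numbers `n₀`, `m`, `r`, the entries of `H₂` row by row,
and the two parts of the syndrome. -/
def decoderInput (n₀ : ℕ) {m r : ℕ} (H₂ : Matrix (Fin r) (Fin m) (ZMod 2))
    (sX : Fin r → ZMod 2) (sZ : Fin m × Fin (n₀ - 1) → ZMod 2) : List ℕ :=
  [n₀, m, r]
    ++ List.ofFn (fun i : Fin (r * m) =>
        (H₂ (finProdFinEquiv.symm i).1 (finProdFinEquiv.symm i).2).val)
    ++ List.ofFn (fun i : Fin r => (sX i).val)
    ++ List.ofFn (fun i : Fin (m * (n₀ - 1)) => (sZ (finProdFinEquiv.symm i)).val)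

/-- The initial configuration: the input stands at the beginning of the memory, and all other
cells and all registers are `0`. -/
def initConfig (inp : List ℕ) : Config where
  reg := fun _ _ => 0
  mem := fun x => inp.getD x 0

/-- The run of a decoder program on `P` processors with words of `O(log N)` bits. -/
def decoderRun (prog : Prog) (κ P n₀ : ℕ) {m r : ℕ} (H₂ : Matrix (Fin r) (Fin m) (ZMod 2))
    (sX : Fin r → ZMod 2) (sZ : Fin m × Fin (n₀ - 1) → ZMod 2) : Config × ℕ :=
  prog.run (wordCount κ (n₀ * m)) P (initConfig (decoderInput n₀ H₂ sX sZ))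

/-- The number of steps of the decoder. -/
def decoderTime (prog : Prog) (κ P n₀ : ℕ) {m r : ℕ} (H₂ : Matrix (Fin r) (Fin m) (ZMod 2))
    (sX : Fin r → ZMod 2) (sZ : Fin m × Fin (n₀ - 1) → ZMod 2) : ℕ :=
  (decoderRun prog κ P n₀ H₂ sX sZ).2

/-- The output of the decoder, read from the memory directly behind the input: first the bits of
the `X`-part, then those of the `Z`-part of the recovery operator, block by block. -/
def decoderOutput (prog : Prog) (κ P n₀ : ℕ) {m r : ℕ} (H₂ : Matrix (Fin r) (Fin m) (ZMod 2))
    (sX : Fin r → ZMod 2) (sZ : Fin m × Fin (n₀ - 1) → ZMod 2) :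
    Bits (Qubit n₀ m) × Bits (Qubit n₀ m) :=
  let out : ℕ → ZMod 2 := fun x => ((decoderRun prog κ P n₀ H₂ sX sZ).1.mem
    ((decoderInput n₀ H₂ sX sZ).length + x) : ZMod 2)
  (fun i => out (finProdFinEquiv i).val, fun i => out (m * n₀ + (finProdFinEquiv i).val))

/-- The decoder, given only the syndrome of the error `X(a)Z(b)`, corrects this error. -/
def DecoderCorrects (prog : Prog) (κ P n₀ : ℕ) {m r : ℕ} (H₂ : Matrix (Fin r) (Fin m) (ZMod 2))
    (a b : Bits (Qubit n₀ m)) : Prop :=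
  Corrects (code n₀ H₂)
    (decoderOutput prog κ P n₀ H₂ (checkX n₀ H₂ *ᵥ a) (checkZ n₀ m *ᵥ b)) a b

/-- The probability that the decoder does not correct a random `Z`-error, in which every qubit
suffers a `Z` independently with probability `p`. -/
noncomputable def failProb (prog : Prog) (κ P n₀ : ℕ) {m r : ℕ}
    (H₂ : Matrix (Fin r) (Fin m) (ZMod 2)) (p : ℝ) : ℝ :=
  ∑ b : Bits (Qubit n₀ m),
    {b | ¬ DecoderCorrects prog κ P n₀ H₂ 0 b}.indicator
      (fun b => ∏ i, if b i = 1 then p else 1 - p) b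

end PCCSS

/-!
The inner checks `I ⊗ H₀` generate all `X`-operators of even weight on each block of `n₀` qubits.
Hence an `X`-error matters only through its block parities, of which `H₂` computes the syndrome,
while the `Z`-errors of each block are decoded on their own by a majority vote. The matrix `H₂` is
the parity check matrix of an expander code: a random bipartite graph with `m` variables of
degree `8` and `8 * (m / 16)` checks is, by a union bound, a lossless expander on sets of at most
`m / 2 ^ 23` variables, so bit flipping corrects a linear fraction of errors after `O(m)` flips.
A logical operator is therefore supported on more than `m / 2 ^ 23` blocks or on a full block, both
of order `√N`.

A round of bit flipping takes `O(m)` steps on one processor and `O(1)` steps on `m` processors, as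
concurrent writes to one memory cell select the variable to be flipped. An encoder applies, to the
first qubits of the blocks, the CNOT gates of a systematic form of the kernel of `H₂`; those from
the `f`-th to the `p`-th block with the same `f + p` modulo `m` form one layer, which makes `m`
layers. It then applies a Hadamard gate to every other qubit, followed by a CNOT gate from it to the
first qubit of its block. For random `Z`-errors of probability `p < 1 / 2`, a Chernoff bound shows
that the majority vote of a block fails with probability exponentially small in `n₀`, of order
`√N`, which beats all powers of `N`.
-/

namespace PCCSS

/-! ### Pauli operators and CSS codes -/

section CSS

variable {ι : Type}

theorem zmod_two_eq_zero_or_one : ∀ a : ZMod 2, a = 0 ∨ a = 1 := by decide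

theorem sum_zmod_two {M : Type*} [AddCommMonoid M] (F : ZMod 2 → M) : ∑ x, F x = F 0 + F 1 :=
  Fin.sum_univ_two F

theorem sign_zero : sign 0 = 1 := by simp [sign]

theorem sign_one : sign 1 = -1 := by simp [sign, ZMod.val_one]

theorem sign_add (a b : ZMod 2) : sign (a + b) = sign a * sign b := by
  have one_add_one : (1 + 1 : ZMod 2) = 0 := by decide
  rcases zmod_two_eq_zero_or_one a with rfl | rfl <;>
    rcases zmod_two_eq_zero_or_one b with rfl | rfl <;>
    simp [sign_zero, sign_one, one_add_one]

theorem sign_eq_one_iff {a : ZMod 2} : sign a = 1 ↔ a = 0 := by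
  rcases zmod_two_eq_zero_or_one a with rfl | rfl
  · simp [sign_zero]
  · norm_num [sign_one]

theorem norm_sign (a : ZMod 2) : ‖sign a‖ = 1 := by
  simp [sign]

theorem sign_ne_zero (a : ZMod 2) : sign a ≠ 0 :=
  norm_ne_zero_iff.1 (by simp [norm_sign])

theorem pauliX_apply (u : Bits ι) (φ : QState ι) (x : Bits ι) : pauliX u φ x = φ (x + u) := by
  rw [← ZModModule.sub_eq_add]
  rfl

theorem pauliX_zero : pauliX (0 : Bits ι) = 1 := by
  ext φ x
  rw [pauliX_apply, add_zero]
  rfl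

theorem pauliX_add (u v : Bits ι) : pauliX (u + v) = pauliX u * pauliX v := by
  ext φ x
  rw [LinearEquiv.mul_apply, pauliX_apply, pauliX_apply, pauliX_apply, add_assoc]

variable [Fintype ι]

theorem pauliZ_apply (v : Bits ι) (φ : QState ι) (x : Bits ι) :
    pauliZ v φ x = sign (v ⬝ᵥ x) * φ x := rfl

theorem pauliZ_zero : pauliZ (0 : Bits ι) = 1 := by
  ext φ x
  rw [pauliZ_apply, zero_dotProduct, sign_zero, one_mul]
  rfl

theorem pauliZ_add (u v : Bits ι) : pauliZ (u + v) = pauliZ u * pauliZ v := by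
  ext φ x
  rw [LinearEquiv.mul_apply, pauliZ_apply, pauliZ_apply, pauliZ_apply, add_dotProduct, sign_add,
    mul_assoc]

theorem pauli_apply (a b : Bits ι) (φ : QState ι) (x : Bits ι) :
    pauli a b φ x = sign (b ⬝ᵥ (x + a)) * φ (x + a) := by
  rw [pauli, LinearEquiv.mul_apply, pauliX_apply, pauliZ_apply]

theorem pauli_pauli (a b c d : Bits ι) (φ : QState ι) :
    pauli c d (pauli a b φ) = sign (d ⬝ᵥ a) • pauli (c + a) (d + b) φ := by
  funext x
  simp only [pauli_apply, Pi.smul_apply, smul_eq_mul, ← mul_assoc, ← sign_add, ← add_assoc]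
  congr 2
  rw [add_dotProduct, dotProduct_add d (x + c) a, ← add_assoc, add_left_comm, add_comm (d ⬝ᵥ a),
    ZModModule.add_self, add_zero]

theorem commute_pauli_pauliZ_iff {a b h : Bits ι} :
    Commute (pauli a b) (pauliZ h) ↔ h ⬝ᵥ a = 0 := by
  constructor
  · intro hc
    have h_at_zero := congrFun (LinearEquiv.congr_fun hc.eq fun _ => 1) 0
    simp only [LinearEquiv.mul_apply, pauli_apply, pauliZ_apply, zero_add, dotProduct_zero,
      sign_zero, mul_one, one_mul] at h_at_zero
    exact sign_eq_one_iff.1 (mul_left_cancel₀ (sign_ne_zero _) (h_at_zero.trans (mul_one _).symm))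
  · intro ha
    ext φ x
    simp only [LinearEquiv.mul_apply, pauli_apply, pauliZ_apply, dotProduct_add h, ha, add_zero]
    ring

theorem commute_pauli_pauliX_iff {a b h : Bits ι} :
    Commute (pauli a b) (pauliX h) ↔ h ⬝ᵥ b = 0 := by
  constructor
  · intro hc
    have h_at_a := congrFun (LinearEquiv.congr_fun hc.eq fun _ => 1) a
    simp only [LinearEquiv.mul_apply, pauli_apply, pauliX_apply, mul_one] at h_at_a
    rwa [add_right_comm, ZModModule.add_self, zero_add, dotProduct_zero, sign_zero, eq_comm,
      sign_eq_one_iff, dotProduct_comm] at h_at_a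
  · intro hb
    ext φ x
    simp only [LinearEquiv.mul_apply, pauli_apply, pauliX_apply, add_right_comm x h a,
      dotProduct_add b _ h, dotProduct_comm b h, hb, add_zero]

theorem map_mem_of_mem_span {M G : Type*} [AddCommGroup M] [Module (ZMod 2) M] [Group G]
    {S : Subgroup G} {f : M → G} (f_zero : f 0 = 1) (f_add : ∀ u v, f (u + v) = f u * f v)
    {s : Set M} (hs : ∀ u ∈ s, f u ∈ S) {u : M} (hu : u ∈ Submodule.span (ZMod 2) s) :
    f u ∈ S := by
  induction hu using Submodule.span_induction with
  | mem u hu => exact hs u hu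
  | zero => exact f_zero ▸ one_mem S
  | add u v _ _ hu hv => exact f_add u v ▸ mul_mem hu hv
  | smul c u _ hu =>
    rcases zmod_two_eq_zero_or_one c with rfl | rfl
    · exact (zero_smul (ZMod 2) u).symm ▸ f_zero ▸ one_mem S
    · rwa [one_smul]

variable {ρ σ : Type} (HX : Matrix ρ ι (ZMod 2)) (HZ : Matrix σ ι (ZMod 2))

theorem pauliZ_row_mem_stabilizer (i : ρ) : pauliZ (HX i) ∈ stabilizer HX HZ :=
  Subgroup.subset_closure (Or.inl ⟨i, rfl⟩)

theorem pauliX_row_mem_stabilizer (j : σ) : pauliX (HZ j) ∈ stabilizer HX HZ :=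
  Subgroup.subset_closure (Or.inr ⟨j, rfl⟩)

theorem pauliX_mem_stabilizer {u : Bits ι} (hu : u ∈ Submodule.span (ZMod 2) (Set.range HZ)) :
    pauliX u ∈ stabilizer HX HZ :=
  map_mem_of_mem_span pauliX_zero pauliX_add
    (Set.forall_mem_range.2 (pauliX_row_mem_stabilizer HX HZ)) hu

theorem pauliZ_mem_stabilizer {v : Bits ι} (hv : v ∈ Submodule.span (ZMod 2) (Set.range HX)) :
    pauliZ v ∈ stabilizer HX HZ :=
  map_mem_of_mem_span pauliZ_zero pauliZ_add
    (Set.forall_mem_range.2 (pauliZ_row_mem_stabilizer HX HZ)) hv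

theorem pauli_mem_stabilizer {a b : Bits ι} (ha : a ∈ Submodule.span (ZMod 2) (Set.range HZ))
    (hb : b ∈ Submodule.span (ZMod 2) (Set.range HX)) : pauli a b ∈ stabilizer HX HZ :=
  mul_mem (pauliX_mem_stabilizer HX HZ ha) (pauliZ_mem_stabilizer HX HZ hb)

theorem mem_codeSpace_stabilizer_iff_forall_row {φ : QState ι} :
    φ ∈ codeSpace (stabilizer HX HZ) ↔
      (∀ i, pauliZ (HX i) φ = φ) ∧ ∀ j, pauliX (HZ j) φ = φ := by
  refine ⟨fun h => ⟨fun i => h _ (pauliZ_row_mem_stabilizer HX HZ i),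
    fun j => h _ (pauliX_row_mem_stabilizer HX HZ j)⟩, ?_⟩
  rintro ⟨hX, hZ⟩ s hs
  induction hs using Subgroup.closure_induction with
  | mem s hs =>
    rcases hs with ⟨i, rfl⟩ | ⟨j, rfl⟩
    exacts [hX i, hZ j]
  | one => rfl
  | mul s t _ _ ihs iht => rw [LinearEquiv.mul_apply, iht, ihs]
  | inv s _ ih =>
    conv_lhs => rw [← ih]
    exact s.symm_apply_apply φ

theorem pauliZ_eq_self_iff {v : Bits ι} {φ : QState ι} :
    pauliZ v φ = φ ↔ ∀ x, φ x ≠ 0 → v ⬝ᵥ x = 0 := by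
  rw [funext_iff]
  refine forall_congr' fun x => ?_
  rw [pauliZ_apply, ← sign_eq_one_iff, ← or_iff_not_imp_left, or_comm]
  exact mul_left_eq_self₀

theorem mem_codeSpace_stabilizer {φ : QState ι} :
    φ ∈ codeSpace (stabilizer HX HZ) ↔ (∀ x, φ x ≠ 0 → HX *ᵥ x = 0) ∧
      ∀ u ∈ Submodule.span (ZMod 2) (Set.range HZ), ∀ x, φ (x + u) = φ x := by
  constructor
  · refine fun h => ⟨fun x hx => funext fun i => ?_, fun u hu x => ?_⟩
    · exact pauliZ_eq_self_iff.1 (h _ (pauliZ_row_mem_stabilizer HX HZ i)) x hx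
    · rw [← pauliX_apply u φ, h _ (pauliX_mem_stabilizer HX HZ hu)]
  · rintro ⟨hX, hZ⟩
    refine (mem_codeSpace_stabilizer_iff_forall_row HX HZ).2 ⟨fun i => ?_, fun j => ?_⟩
    · exact pauliZ_eq_self_iff.2 fun x hx => congrFun (hX x hx) i
    · funext x
      rw [pauliX_apply, hZ _ (Submodule.subset_span ⟨j, rfl⟩)]

theorem corrects_of_mem_span {r : Bits ι × Bits ι} {a b : Bits ι}
    (hX : r.1 + a ∈ Submodule.span (ZMod 2) (Set.range HZ))
    (hZ : r.2 + b ∈ Submodule.span (ZMod 2) (Set.range HX)) :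
    Corrects (codeSpace (stabilizer HX HZ)) r a b := by
  refine ⟨sign (r.2 ⬝ᵥ a), norm_sign _, fun φ hφ => ?_⟩
  rw [pauli_pauli, hφ _ (pauli_mem_stabilizer HX HZ hX hZ)]

theorem forall_mem_stabilizer_commute_iff {a b : Bits ι} :
    (∀ s ∈ stabilizer HX HZ, Commute (pauli a b) s) ↔ HX *ᵥ a = 0 ∧ HZ *ᵥ b = 0 := by
  constructor
  · intro h
    exact ⟨funext fun i => commute_pauli_pauliZ_iff.1 (h _ (pauliZ_row_mem_stabilizer HX HZ i)),
      funext fun j => commute_pauli_pauliX_iff.1 (h _ (pauliX_row_mem_stabilizer HX HZ j))⟩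
  · rintro ⟨ha, hb⟩ s hs
    induction hs using Subgroup.closure_induction with
    | mem s hs =>
      rcases hs with ⟨i, rfl⟩ | ⟨j, rfl⟩
      · exact commute_pauli_pauliZ_iff.2 (congrFun ha i)
      · exact commute_pauli_pauliX_iff.2 (congrFun hb j)
    | one => exact Commute.one_right _
    | mul s t _ _ hs ht => exact hs.mul_right ht
    | inv s _ hs => exact hs.inv_right

/-- The indicator function of the row space of `HZ` is a code state, which `X(a)` moves to a state
with disjoint support. -/
theorem not_exists_mem_stabilizer_pauli_zero_eq_smul (horth : ∀ j, HX *ᵥ HZ j = 0) {a : Bits ι}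
    (ha : a ∉ Submodule.span (ZMod 2) (Set.range HZ)) :
    ¬ ∃ s ∈ stabilizer HX HZ, ∃ ω : ℂ, ∀ φ, pauli a 0 φ = ω • s φ := by
  classical
  rintro ⟨s, hs, ω, hω⟩
  let U := Submodule.span (ZMod 2) (Set.range HZ)
  let φ : QState ι := fun x => if x ∈ U then 1 else 0
  have hU : U ≤ LinearMap.ker HX.mulVecLin :=
    Submodule.span_le.2 (Set.range_subset_iff.2 horth)
  have hφ : φ ∈ codeSpace (stabilizer HX HZ) := by
    refine (mem_codeSpace_stabilizer HX HZ).2 ⟨fun x hx => ?_, fun u hu x => ?_⟩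
    · exact hU (of_not_not fun hxU => hx (if_neg hxU))
    · simp only [φ, U.add_mem_iff_left hu]
  have h_at_a := congrFun (hω φ) a
  rw [hφ s hs] at h_at_a
  simp [pauli_apply, sign_zero, φ, U, ha, ZModModule.add_self] at h_at_a

theorem hammingNorm_le_pauliWeight_left (a b : Bits ι) : hammingNorm a ≤ pauliWeight a b :=
  Finset.card_le_card (Finset.monotone_filter_right _ fun _ _ => Or.inl)

theorem hammingNorm_le_pauliWeight_right (a b : Bits ι) : hammingNorm b ≤ pauliWeight a b :=
  Finset.card_le_card (Finset.monotone_filter_right _ fun _ _ => Or.inr)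

theorem le_minDist_stabilizer {d : ℕ} (horth : ∀ j, HX *ᵥ HZ j = 0)
    (hX : ∀ a, HX *ᵥ a = 0 → a ∉ Submodule.span (ZMod 2) (Set.range HZ) → d ≤ hammingNorm a)
    (hZ : ∀ b, HZ *ᵥ b = 0 → b ∉ Submodule.span (ZMod 2) (Set.range HX) → d ≤ hammingNorm b)
    (hex : ∃ a, HX *ᵥ a = 0 ∧ a ∉ Submodule.span (ZMod 2) (Set.range HZ)) :
    d ≤ minDist (stabilizer HX HZ) := by
  refine le_csInf ?_ ?_
  · obtain ⟨a, ha, ha_span⟩ := hex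
    exact ⟨_, a, 0, rfl, (forall_mem_stabilizer_commute_iff HX HZ).2 ⟨ha, Matrix.mulVec_zero _⟩,
      not_exists_mem_stabilizer_pauli_zero_eq_smul HX HZ horth ha_span⟩
  · rintro _ ⟨a, b, rfl, hcomm, hnot⟩
    obtain ⟨ha, hb⟩ := (forall_mem_stabilizer_commute_iff HX HZ).1 hcomm
    by_cases ha_span : a ∈ Submodule.span (ZMod 2) (Set.range HZ)
    · have hb_span : b ∉ Submodule.span (ZMod 2) (Set.range HX) := fun hb_span =>
        hnot ⟨_, pauli_mem_stabilizer HX HZ ha_span hb_span, 1, fun φ => (one_smul _ _).symm⟩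
      exact (hZ b hb hb_span).trans (hammingNorm_le_pauliWeight_right a b)
    · exact (hX a ha ha_span).trans (hammingNorm_le_pauliWeight_left a b)

end CSS

/-! ### The checks of the partially concatenated code -/

/-- The parities of the blocks `{v} × B`. The checks on `X`-errors only see these parities, and two
`X`-errors with the same block parities differ by a stabilizer. -/
def blockParity {V B : Type} [Fintype B] : Bits (V × B) →ₗ[ZMod 2] Bits V where
  toFun a v := ∑ i, a (v, i)
  map_add' a b := by
    funext v
    simp [Finset.sum_add_distrib]
  map_smul' c a := by
    funext v
    simp [Finset.mul_sum]

section Blocks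

variable {V B : Type} [Fintype B]

theorem blockParity_apply (a : Bits (V × B)) (v : V) : blockParity a v = ∑ i, a (v, i) := rfl

variable [Fintype V]

theorem hammingNorm_blockParity_le (a : Bits (V × B)) :
    hammingNorm (blockParity a) ≤ hammingNorm a := by
  classical
  refine (Finset.card_le_card (t := (Finset.univ.filter fun i => a i ≠ 0).image Prod.fst)
    fun v hv => ?_).trans Finset.card_image_le
  obtain ⟨i, -, hi⟩ := Finset.exists_ne_zero_of_sum_ne_zero (Finset.mem_filter.1 hv).2
  exact Finset.mem_image.2 ⟨(v, i), Finset.mem_filter.2 ⟨Finset.mem_univ _, hi⟩, rfl⟩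

theorem hammingNorm_block_le (b : Bits (V × B)) (v : V) :
    hammingNorm (fun i => b (v, i)) ≤ hammingNorm b :=
  Finset.card_le_card_of_injOn (fun i => (v, i)) (fun i hi => by simpa using hi)
    fun i _ j _ h => (Prod.ext_iff.1 h).2

end Blocks

section Checks

variable {n₀ m r : ℕ} {H₂ : Matrix (Fin r) (Fin m) (ZMod 2)}

theorem checkX_mulVec (H₂ : Matrix (Fin r) (Fin m) (ZMod 2)) (a : Bits (Qubit n₀ m)) :
    checkX n₀ H₂ *ᵥ a = H₂ *ᵥ blockParity a := by
  have innerGen_mulVec : innerGen n₀ m *ᵥ a = blockParity a := by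
    funext v
    simp only [Matrix.mulVec, dotProduct, innerGen, repGen, Matrix.submatrix_apply, id_eq,
      Matrix.kroneckerMap_apply, Matrix.one_apply, mul_one, Fintype.sum_prod_type]
    rw [Finset.sum_comm]
    simp [blockParity_apply]
  rw [checkX, ← Matrix.mulVec_mulVec, innerGen_mulVec]

theorem checkZ_succ_apply {n : ℕ} (v v' : Fin m) (i : Fin n) (j : Fin (n + 1)) :
    checkZ (n + 1) m (v, i) (v', j) =
      if v = v' ∧ (j = i.castSucc ∨ j = Fin.last n) then 1 else 0 := by
  simp only [checkZ, repCheck, Matrix.kroneckerMap_apply, Matrix.one_apply, Fin.ext_iff,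
    Fin.val_castSucc, Fin.val_last, Nat.add_sub_cancel]
  by_cases h : v.val = v'.val <;> simp [h]

theorem checkZ_succ_mulVec {n : ℕ} (b : Bits (Qubit (n + 1) m)) (v : Fin m) (i : Fin n) :
    (checkZ (n + 1) m *ᵥ b) (v, i) = b (v, i.castSucc) + b (v, Fin.last n) := by
  have h_row : (checkZ (n + 1) m *ᵥ b) (v, i) = ∑ v', ∑ j,
      (if v = v' ∧ (j = i.castSucc ∨ j = Fin.last n) then 1 else 0) * b (v', j) := by
    simp only [Matrix.mulVec, dotProduct, Fintype.sum_prod_type]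
    exact Finset.sum_congr rfl fun v' _ => Finset.sum_congr rfl fun j _ =>
      congrArg (· * b (v', j)) (checkZ_succ_apply v v' i j)
  rw [h_row, Finset.sum_eq_single v (fun v' _ hv => by simp [hv.symm]) (by simp),
    Fin.sum_univ_castSucc]
  simp [(Fin.castSucc_lt_last _).ne, (Fin.castSucc_lt_last _).ne']

theorem blockParity_checkZ (j : Fin m × Fin (n₀ - 1)) : blockParity (checkZ n₀ m j) = 0 := by
  obtain ⟨v, i⟩ := j
  obtain ⟨n, rfl⟩ : ∃ n, n₀ = n + 1 := ⟨n₀ - 1, by have := i.isLt; omega⟩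
  change Fin n at i
  funext v'
  simp only [blockParity_apply, Fin.sum_univ_castSucc, checkZ_succ_apply]
  by_cases hv : v = v' <;> simp [hv, CharTwo.add_self_eq_zero]

theorem checkX_mulVec_checkZ (H₂ : Matrix (Fin r) (Fin m) (ZMod 2)) (j : Fin m × Fin (n₀ - 1)) :
    checkX n₀ H₂ *ᵥ checkZ n₀ m j = 0 := by
  rw [checkX_mulVec, blockParity_checkZ, Matrix.mulVec_zero]

theorem eq_sum_smul_checkZ_of_blockParity_eq_zero {n : ℕ} {u : Bits (Qubit (n + 1) m)}
    (hu : blockParity u = 0) :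
    u = ∑ v : Fin m, ∑ i : Fin n, u (v, i.castSucc) • checkZ (n + 1) m (v, i) := by
  funext ⟨v, j⟩
  have h_block : ∑ i : Fin n, u (v, i.castSucc) + u (v, Fin.last n) = 0 := by
    rw [← Fin.sum_univ_castSucc fun i => u (v, i)]
    exact congrFun hu v
  rw [Finset.sum_apply, Finset.sum_eq_single v, Finset.sum_apply]
  · simp only [Pi.smul_apply, checkZ_succ_apply, smul_eq_mul]
    refine Fin.lastCases ?_ (fun j => ?_) j
    · simp [CharTwo.add_eq_zero.1 h_block]
    · simp
  · intro v' _ hv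
    rw [Finset.sum_apply]
    refine Finset.sum_eq_zero fun i _ => ?_
    rw [Pi.smul_apply, checkZ_succ_apply, if_neg fun h => hv h.1, smul_zero]
  · simp

variable [NeZero n₀]

theorem mem_span_checkZ_iff {u : Bits (Qubit n₀ m)} :
    u ∈ Submodule.span (ZMod 2) (Set.range (checkZ n₀ m)) ↔ blockParity u = 0 := by
  constructor
  · exact fun hu => (Submodule.span_le (p := LinearMap.ker blockParity)).2
      (Set.range_subset_iff.2 blockParity_checkZ) hu
  · intro hu
    obtain ⟨n, rfl⟩ := Nat.exists_eq_succ_of_ne_zero (NeZero.ne n₀)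
    rw [eq_sum_smul_checkZ_of_blockParity_eq_zero hu]
    exact Submodule.sum_mem _ fun v _ => Submodule.sum_mem _ fun i _ =>
      Submodule.smul_mem _ _ (Submodule.subset_span ⟨(v, i), rfl⟩)

theorem mem_code {φ : QState (Qubit n₀ m)} :
    φ ∈ code n₀ H₂ ↔ (∀ x, φ x ≠ 0 → H₂ *ᵥ blockParity x = 0) ∧
      ∀ u, blockParity u = 0 → ∀ x, φ (x + u) = φ x := by
  simp only [code, stab, mem_codeSpace_stabilizer, checkX_mulVec, mem_span_checkZ_iff]

theorem code_corrects {a b : Bits (Qubit n₀ m)} {R : Bits (Qubit n₀ m) × Bits (Qubit n₀ m)}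
    (hX : blockParity R.1 = blockParity a) (hZ : R.2 = b) : Corrects (code n₀ H₂) R a b := by
  refine corrects_of_mem_span _ _ (mem_span_checkZ_iff.2 ?_) ?_
  · rw [map_add, hX, ZModModule.add_self]
  · rw [hZ, ZModModule.add_self]
    exact Submodule.zero_mem _

/-- The error on the first qubits of the blocks with prescribed block parities. -/
def firstQubits (y : Bits (Fin m)) : Bits (Qubit n₀ m) := fun i => if i.2 = 0 then y i.1 else 0

theorem blockParity_firstQubits (y : Bits (Fin m)) :
    blockParity (firstQubits (n₀ := n₀) y) = y := by
  funext v
  simp [blockParity_apply, firstQubits]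

theorem le_hammingNorm_of_checkZ_mulVec_eq_zero {b : Bits (Qubit n₀ m)}
    (hb : checkZ n₀ m *ᵥ b = 0) (hb0 : b ≠ 0) : n₀ ≤ hammingNorm b := by
  obtain ⟨n, rfl⟩ := Nat.exists_eq_succ_of_ne_zero (NeZero.ne n₀)
  have h_const (v : Fin m) (i : Fin (n + 1)) : b (v, i) = b (v, Fin.last n) :=
    Fin.lastCases rfl (fun i => CharTwo.add_eq_zero.1
      ((checkZ_succ_mulVec b v i).symm.trans (congrFun hb (v, i)))) i
  obtain ⟨⟨v, i⟩, hvi⟩ := Function.ne_iff.1 hb0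
  refine le_trans (le_of_eq ?_) (hammingNorm_block_le b v)
  rw [hammingNorm, Finset.filter_true_of_mem, Finset.card_univ, Fintype.card_fin]
  intro j _
  rwa [h_const v j, ← h_const v i]

theorem le_minDist_stab {d : ℕ} (hd : d ≤ n₀)
    (hH : ∀ y, H₂ *ᵥ y = 0 → y ≠ 0 → d ≤ hammingNorm y) (hk : ∃ y, H₂ *ᵥ y = 0 ∧ y ≠ 0) :
    d ≤ minDist (stab n₀ H₂) := by
  refine le_minDist_stabilizer _ _ (checkX_mulVec_checkZ H₂) ?_ ?_ ?_
  · intro a ha ha_span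
    rw [checkX_mulVec] at ha
    exact (hH _ ha (mt mem_span_checkZ_iff.2 ha_span)).trans (hammingNorm_blockParity_le a)
  · intro b hb hb_span
    exact hd.trans (le_hammingNorm_of_checkZ_mulVec_eq_zero hb
      fun hb0 => hb_span (hb0 ▸ Submodule.zero_mem _))
  · obtain ⟨y, hy, hy0⟩ := hk
    refine ⟨firstQubits y, ?_, ?_⟩
    · rwa [checkX_mulVec, blockParity_firstQubits]
    · rwa [mem_span_checkZ_iff, blockParity_firstQubits]

end Checks

/-! ### Circuits -/

section Circuits

variable {ι : Type}

theorem mem_messageSpace_iff_exists_extend {M : Finset ι} {φ : QState ι} :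
    φ ∈ messageSpace M ↔
      ∃ ψ : QState M,
        Function.extend (fun y => Function.extend Subtype.val y (0 : Bits ι)) ψ 0 = φ := by
  have h_inj : Function.Injective fun y : Bits M => Function.extend Subtype.val y (0 : Bits ι) :=
    Function.extend_injective Subtype.val_injective _
  constructor
  · intro hφ
    refine ⟨fun y => φ (Function.extend Subtype.val y 0), funext fun x => ?_⟩
    by_cases hx : ∃ y : Bits M, Function.extend Subtype.val y 0 = x
    · obtain ⟨y, rfl⟩ := hx
      exact h_inj.extend_apply _ _ _
    · rw [Function.extend_apply' _ _ _ hx]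
      refine (hφ x ?_).symm
      by_contra! h_off
      refine hx ⟨fun i => x i, funext fun i => ?_⟩
      by_cases hi : i ∈ M
      · exact Subtype.val_injective.extend_apply _ _ ⟨i, hi⟩
      · rw [Function.extend_apply' _ _ _ (by simpa using hi), h_off i hi, Pi.zero_apply]
  · rintro ⟨ψ, rfl⟩ x ⟨i, hi, hxi⟩
    refine Function.extend_apply' _ _ _ ?_
    rintro ⟨y, rfl⟩
    exact hxi (Function.extend_apply' _ _ _ (by simpa using hi))

theorem finrank_messageSpace (M : Finset ι) :
    Module.finrank ℂ (messageSpace M) = 2 ^ M.card := by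
  classical
  have h_range : messageSpace M = LinearMap.range (Function.ExtendByZero.linearMap ℂ
      fun y : Bits M => Function.extend Subtype.val y (0 : Bits ι)) := by
    ext φ
    exact mem_messageSpace_iff_exists_extend
  rw [h_range, LinearMap.finrank_range_of_inj (Function.extend_injective
    (Function.extend_injective Subtype.val_injective _) _), Module.finrank_fintype_fun_eq_card]
  simp [ZMod.card]

variable [DecidableEq ι]

theorem had_apply (i : ι) (φ : QState ι) (x : Bits ι) :
    (Gate.had i).op φ x = ((Real.sqrt 2 : ℝ) : ℂ)⁻¹ *
      (φ (Function.update x i 0) + sign (x i) * φ (Function.update x i 1)) := by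
  have h_sum : ∑ y : ZMod 2, sign (y * x i) * φ (Function.update x i y) =
      sign (0 * x i) * φ (Function.update x i 0) + sign (1 * x i) * φ (Function.update x i 1) :=
    sum_zmod_two _
  rw [zero_mul, one_mul, sign_zero, one_mul] at h_sum
  exact congrArg (((Real.sqrt 2 : ℝ) : ℂ)⁻¹ * ·) h_sum

theorem cnot_apply (c t : ι) (h : c ≠ t) (φ : QState ι) (x : Bits ι) :
    (Gate.cnot c t h).op φ x = φ (x + Pi.single t (x c)) := by
  change φ (Function.update x t (x t + x c)) = _
  congr 1
  funext i
  by_cases hi : i = t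
  · subst hi
    simp
  · simp [hi]

theorem Gate.op_op (g : Gate ι) (φ : QState ι) : g.op (g.op φ) = φ := by
  funext x
  cases g with
  | had i =>
    have h_sqrt : ((Real.sqrt 2 : ℝ) : ℂ)⁻¹ * ((Real.sqrt 2 : ℝ) : ℂ)⁻¹ = 2⁻¹ := by
      rw [← mul_inv, ← Complex.ofReal_mul, Real.mul_self_sqrt zero_le_two, Complex.ofReal_ofNat]
    have h_self : φ x = φ (Function.update x i (x i)) := by rw [Function.update_eq_self]
    simp only [had_apply, Function.update_self, Function.update_idem, sign_zero, sign_one]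
    rw [h_self]
    rcases zmod_two_eq_zero_or_one (x i) with hx | hx <;> rw [hx] <;>
      simp only [sign_zero, sign_one]
    · linear_combination (2 * φ (Function.update x i 0)) * h_sqrt
    · linear_combination (2 * φ (Function.update x i 1)) * h_sqrt
  | cnot c t h =>
    simp only [cnot_apply, Pi.add_apply, Pi.single_eq_of_ne h, add_zero]
    rw [add_assoc, ZModModule.add_self, add_zero]

/-- The operator of a list of gates, applied from left to right. -/
noncomputable def gatesOp (l : List (Gate ι)) : Module.End ℂ (QState ι) :=
  (l.map Gate.op).reverse.prod

theorem gatesOp_nil : gatesOp ([] : List (Gate ι)) = 1 := rfl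

theorem gatesOp_cons (g : Gate ι) (l : List (Gate ι)) :
    gatesOp (g :: l) = gatesOp l * g.op := by
  simp [gatesOp]

theorem gatesOp_append (l l' : List (Gate ι)) : gatesOp (l ++ l') = gatesOp l' * gatesOp l := by
  simp [gatesOp]

theorem gatesOp_injective (l : List (Gate ι)) : Function.Injective (gatesOp l) := by
  induction l with
  | nil => exact Function.injective_id
  | cons g l ih =>
    rw [gatesOp_cons, Module.End.coe_mul]
    exact ih.comp (Function.LeftInverse.injective g.op_op)

/-! #### Layers of controlled-NOT gates -/

/-- The bits which a gate adds to the basis state `x`, if it is a controlled-NOT gate. -/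
def Gate.toggle : Gate ι → Bits ι → Bits ι
  | .had _, _ => 0
  | .cnot c t _, x => Pi.single t (x c)

/-- The gate is a controlled-NOT gate with control in `S` and target outside of `S`. Gates with
this property for the same `S` do not disturb each other's controls. -/
def Gate.CnotFrom (S : Set ι) : Gate ι → Prop
  | .had _ => False
  | .cnot c t _ => c ∈ S ∧ t ∉ S

theorem Gate.CnotFrom.toggle_apply {S : Set ι} {g : Gate ι} (hg : g.CnotFrom S) (x : Bits ι)
    {i : ι} (hi : i ∈ S) : g.toggle x i = 0 := by
  cases g with
  | had i => exact hg.elim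
  | cnot c t h => exact Pi.single_eq_of_ne (ne_of_mem_of_not_mem hi hg.2) _

theorem sum_toggle_apply {S : Set ι} {l : List (Gate ι)} (hl : ∀ g ∈ l, g.CnotFrom S)
    (x : Bits ι) {i : ι} (hi : i ∈ S) : (l.map fun g => g.toggle x).sum i = 0 := by
  induction l with
  | nil => rfl
  | cons g l ih =>
    rw [List.forall_mem_cons] at hl
    rw [List.map_cons, List.sum_cons, Pi.add_apply, hl.1.toggle_apply x hi, ih hl.2, add_zero]

theorem gatesOp_apply_of_cnotFrom {S : Set ι} {l : List (Gate ι)} (hl : ∀ g ∈ l, g.CnotFrom S)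
    (φ : QState ι) (x : Bits ι) : gatesOp l φ x = φ (x + (l.map fun g => g.toggle x).sum) := by
  induction l generalizing φ with
  | nil => simp [gatesOp_nil]
  | cons g l ih =>
    rw [List.forall_mem_cons] at hl
    rw [gatesOp_cons, Module.End.mul_apply, ih hl.2]
    cases g with
    | had i => exact hl.1.elim
    | cnot c t h =>
      rw [cnot_apply, Pi.add_apply, sum_toggle_apply hl.2 x hl.1.1, add_zero, List.map_cons,
        List.sum_cons, add_assoc, add_comm (List.sum _)]
      rfl

theorem image_gatesOp_of_cnotFrom {S : Set ι} {l : List (Gate ι)} (hl : ∀ g ∈ l, g.CnotFrom S)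
    {A : Bits ι → Bits ι} (hA : ∀ x, x + (l.map fun g => g.toggle x).sum = A x)
    (hA_inv : Function.Involutive A) {U V : Set (QState ι)} (hUV : ∀ φ ∈ U, φ ∘ A ∈ V)
    (hVU : ∀ φ ∈ V, φ ∘ A ∈ U) : gatesOp l '' U = V := by
  have h_op (φ : QState ι) : gatesOp l φ = φ ∘ A :=
    funext fun x => (gatesOp_apply_of_cnotFrom hl φ x).trans (congrArg φ (hA x))
  apply Set.Subset.antisymm
  · rintro _ ⟨φ, hφ, rfl⟩
    exact h_op φ ▸ hUV φ hφ
  · intro φ hφ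
    refine ⟨φ ∘ A, hVU φ hφ, ?_⟩
    rw [h_op, Function.comp_assoc, hA_inv.comp_self, Function.comp_id]

/-! #### Layers of Hadamard gates -/

/-- States supported on basis states with `pred` in which the qubits of `J` outside of `D`
are `0`, and not depending on the qubits in `D`. They arise from states supported on `pred` whose
qubits in `J` are all `0` by applying Hadamard gates to the qubits in `D`. -/
def plusStates (pred : Bits ι → Prop) (J D : Set ι) : Set (QState ι) :=
  {φ | (∀ x, φ x ≠ 0 → pred x ∧ ∀ i ∈ J, i ∉ D → x i = 0) ∧
    ∀ x x', (∀ i ∉ D, x i = x' i) → φ x = φ x'}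

variable {pred : Bits ι → Prop} {J D : Set ι} {i : ι} {φ : QState ι}

theorem had_mem_plusStates_insert
    (hpred : ∀ x, ∀ i ∈ J, ∀ y, pred (Function.update x i y) → pred x) (hJ : i ∈ J) (hD : i ∉ D)
    (hφ : φ ∈ plusStates pred J D) : (Gate.had i).op φ ∈ plusStates pred J (insert i D) := by
  obtain ⟨h_supp, h_indep⟩ := hφ
  have h_had (x : Bits ι) : (Gate.had i).op φ x =
      ((Real.sqrt 2 : ℝ) : ℂ)⁻¹ * φ (Function.update x i 0) := by
    have h_one : φ (Function.update x i 1) = 0 := by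
      by_contra h
      simpa using (h_supp _ h).2 i hJ hD
    rw [had_apply, h_one, mul_zero, add_zero]
  refine ⟨fun x hx => ?_, fun x x' hxx => ?_⟩
  · rw [h_had] at hx
    obtain ⟨h_pred, h_zero⟩ := h_supp _ (right_ne_zero_of_mul hx)
    refine ⟨hpred x i hJ _ h_pred, fun j hj hjD => ?_⟩
    rw [Set.mem_insert_iff, not_or] at hjD
    simpa [hjD.1] using h_zero j hj hjD.2
  · rw [h_had, h_had]
    refine congrArg _ (h_indep _ _ fun j hj => ?_)
    by_cases hji : j = i
    · subst hji
      simp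
    · simpa [hji] using hxx j (by simp [hji, hj])

theorem had_mem_plusStates_of_insert (hD : i ∉ D) (hφ : φ ∈ plusStates pred J (insert i D)) :
    (Gate.had i).op φ ∈ plusStates pred J D := by
  obtain ⟨h_supp, h_indep⟩ := hφ
  have h_had (x : Bits ι) : (Gate.had i).op φ x =
      ((Real.sqrt 2 : ℝ) : ℂ)⁻¹ * (1 + sign (x i)) * φ x := by
    have h_update (y : ZMod 2) : φ (Function.update x i y) = φ x := h_indep _ _ fun j hj =>
      Function.update_of_ne (ne_of_mem_of_not_mem (Set.mem_insert i D) hj).symm _ _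
    rw [had_apply, h_update, h_update]
    ring
  refine ⟨fun x hx => ?_, fun x x' hxx => ?_⟩
  · rw [h_had] at hx
    obtain ⟨h_pred, h_zero⟩ := h_supp _ (right_ne_zero_of_mul hx)
    refine ⟨h_pred, fun j hj hjD => ?_⟩
    by_cases hji : j = i
    · subst hji
      exact (zmod_two_eq_zero_or_one (x j)).resolve_right fun h =>
        hx (by simp [h, sign_one])
    · exact h_zero j hj (by simp [hji, hjD])
  · rw [h_had, h_had, hxx i hD,
      h_indep x x' fun j hj => hxx j (mt (Set.mem_insert_of_mem _) hj)]

theorem image_had (hpred : ∀ x, ∀ i ∈ J, ∀ y, pred (Function.update x i y) → pred x) (hJ : i ∈ J)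
    (hD : i ∉ D) : (Gate.had i).op '' plusStates pred J D = plusStates pred J (insert i D) :=
  Set.Subset.antisymm
    (Set.image_subset_iff.2 fun _ hφ => had_mem_plusStates_insert hpred hJ hD hφ)
    fun φ hφ => ⟨_, had_mem_plusStates_of_insert hD hφ, Gate.op_op _ φ⟩

theorem image_hads (hpred : ∀ x, ∀ i ∈ J, ∀ y, pred (Function.update x i y) → pred x)
    {l : List ι} (hl : l.Nodup) (hJ : ∀ i ∈ l, i ∈ J) (hD : ∀ i ∈ l, i ∉ D) :
    gatesOp (l.map Gate.had) '' plusStates pred J D = plusStates pred J (D ∪ {i | i ∈ l}) := by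
  induction l generalizing D with
  | nil => simp [gatesOp_nil]
  | cons i l ih =>
    rw [List.nodup_cons] at hl
    rw [List.forall_mem_cons] at hJ hD
    rw [List.map_cons, gatesOp_cons, Module.End.coe_mul, Set.image_comp,
      image_had hpred hJ.1 hD.1, ih hl.2 hJ.2]
    · congr 1
      ext j
      simp only [Set.mem_union, Set.mem_insert_iff, Set.mem_ofPred_eq, List.mem_cons]
      tauto
    · intro j hj
      rw [Set.mem_insert_iff, not_or]
      exact ⟨ne_of_mem_of_not_mem hj hl.1, hD.2 j hj⟩

end Circuits

/-! ### Encoding -/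

section Systematic

variable {K ρ κ : Type} [Field K] [Fintype κ] [DecidableEq κ]

/-- The kernel of `H` in systematic form: the entries outside of `T` are free, and the entries in
`T` are the linear combinations of them given by `B`. -/
def IsSystematic (H : Matrix ρ κ K) (T : Finset κ) (B : Matrix κ κ K) : Prop :=
  ∀ y, H *ᵥ y = 0 ↔ ∀ p ∈ T, y p = ∑ f ∈ Tᶜ, B p f * y f

theorem isSystematic_of_linearIndepOn {H : Matrix ρ κ K} {T : Finset κ} {B : Matrix κ κ K}
    (h_indep : LinearIndepOn K H.col (T : Set κ)) (hB : ∀ f, ∑ p ∈ T, B p f • H.col p = -H.col f) :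
    IsSystematic H T B := by
  intro y
  have h_mulVec : H *ᵥ y = ∑ p ∈ T, (y p - ∑ f ∈ Tᶜ, B p f * y f) • H.col p := by
    have h_compl : ∑ f ∈ Tᶜ, y f • H.col f = -∑ f ∈ Tᶜ, ∑ p ∈ T, (B p f * y f) • H.col p := by
      rw [← Finset.sum_neg_distrib]
      refine Finset.sum_congr rfl fun f _ => ?_
      rw [← neg_neg (H.col f), ← hB f, smul_neg, Finset.smul_sum]
      simp only [smul_smul, mul_comm]
    calc H *ᵥ y = ∑ v, y v • H.col v := by
          funext c
          simp [Matrix.mulVec, dotProduct, mul_comm]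
      _ = ∑ p ∈ T, y p • H.col p + ∑ f ∈ Tᶜ, y f • H.col f :=
          (Finset.sum_add_sum_compl T _).symm
      _ = ∑ p ∈ T, (y p - ∑ f ∈ Tᶜ, B p f * y f) • H.col p := by
          simp only [h_compl, sub_smul, Finset.sum_smul, Finset.sum_sub_distrib]
          rw [Finset.sum_comm, sub_eq_add_neg]
  rw [h_mulVec]
  constructor
  · exact fun h p hp => sub_eq_zero.1 (linearIndepOn_finset_iff.1 h_indep _ h p hp)
  · exact fun h => Finset.sum_eq_zero fun p hp => by rw [h p hp, sub_self, zero_smul]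

theorem exists_isSystematic [Fintype ρ] (H : Matrix ρ κ K) :
    ∃ T B, T.card ≤ Fintype.card ρ ∧ IsSystematic H T B := by
  classical
  obtain ⟨b, -, -, h_span, h_indep⟩ := exists_linearIndepOn_extension (K := K) (v := H.col)
    (s := ∅) (t := Set.univ) (linearIndepOn_empty _ _) (Set.subset_univ _)
  obtain ⟨T, rfl⟩ : ∃ T : Finset κ, (T : Set κ) = b := ⟨b.toFinset, by simp⟩
  have h_comb (f : κ) : ∃ c : κ → K, ∑ p ∈ T, c p • H.col p = H.col f :=
    (Submodule.mem_span_image_finset_iff_exists_fun' _).1 (h_span ⟨f, Set.mem_univ _, rfl⟩)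
  choose c hc using h_comb
  refine ⟨T, fun p f => -c f p, ?_, isSystematic_of_linearIndepOn h_indep fun f => ?_⟩
  · simpa using LinearIndependent.fintype_card_le_finrank h_indep
  · simp only [neg_smul, Finset.sum_neg_distrib, hc]

end Systematic

section GateLists

theorem sum_map_flatten_flatMap {α M : Type} [AddCommMonoid M] {k l : ℕ}
    (g : Fin k → Fin l → List α) (f : α → M) :
    ((((List.finRange k).map fun t => (List.finRange l).flatMap fun p => g t p).flatten).map
      f).sum = ∑ t, ∑ p, ((g t p).map f).sum := by
  rw [List.map_flatten, List.sum_flatten, List.map_map, List.map_map, ← Fin.sum_univ_def]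
  refine Finset.sum_congr rfl fun t _ => ?_
  simp only [Function.comp_apply, List.flatMap, List.map_flatten, List.sum_flatten, List.map_map]
  rw [← Fin.sum_univ_def]
  rfl

theorem pairwise_disjoint_support_flatMap {ι : Type} [DecidableEq ι] {k : ℕ}
    {g : Fin k → List (Gate ι)} (h_len : ∀ p, (g p).length ≤ 1)
    (h_disj : ∀ p p', p ≠ p' → ∀ a ∈ g p, ∀ b ∈ g p', Disjoint a.support b.support) :
    ((List.finRange k).flatMap g).Pairwise fun a b => Disjoint a.support b.support := by
  rw [List.pairwise_flatMap]
  refine ⟨fun p _ => ?_, (List.nodup_finRange k).imp fun hne => h_disj _ _ hne⟩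
  match g p, h_len p with
  | [], _ => exact List.Pairwise.nil
  | [a], _ => exact List.pairwise_singleton _ a

theorem length_flatten_map_flatMap_le {α : Type} {k l : ℕ} {g : Fin k → Fin l → List α}
    (h : ∀ t p, (g t p).length ≤ 1) :
    ((List.finRange k).map fun t => (List.finRange l).flatMap fun p => g t p).flatten.length
      ≤ k * l := by
  have h_sum := sum_map_flatten_flatMap g fun _ => 1
  simp only [List.map_const', List.sum_replicate, smul_eq_mul, mul_one] at h_sum
  rw [h_sum]
  calc ∑ t, ∑ p, (g t p).length ≤ ∑ _t : Fin k, ∑ _p : Fin l, 1 :=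
        Finset.sum_le_sum fun t _ => Finset.sum_le_sum fun p _ => h t p
    _ = k * l := by simp

end GateLists

section Encoding

variable {n₀ m r : ℕ} [NeZero n₀]

theorem firstQubits_apply_zero (y : Bits (Fin m)) (v : Fin m) :
    firstQubits (n₀ := n₀) y (v, 0) = y v := if_pos rfl

theorem firstQubits_apply_of_ne_zero (y : Bits (Fin m)) {i : Qubit n₀ m} (hi : i.2 ≠ 0) :
    firstQubits y i = 0 := if_neg hi

theorem single_eq_firstQubits (v : Fin m) (b : ZMod 2) :
    Pi.single (v, 0) b = firstQubits (n₀ := n₀) (Pi.single v b) := by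
  funext ⟨v', i⟩
  by_cases hi : i = 0 <;> by_cases hv : v' = v <;>
    simp [firstQubits, hi, hv]

theorem firstQubits_zero : firstQubits (n₀ := n₀) (0 : Bits (Fin m)) = 0 := by
  funext i
  simp [firstQubits]

theorem firstQubits_sum {α : Type} (s : Finset α) (y : α → Bits (Fin m)) :
    firstQubits (n₀ := n₀) (∑ t ∈ s, y t) = ∑ t ∈ s, firstQubits (y t) := by
  funext i
  by_cases hi : i.2 = 0 <;> simp [firstQubits, hi, Finset.sum_apply]

/-! #### The circuit -/

/-- The controlled-NOT gate from the first qubit of block `f ∉ T` to that of block `p ∈ T`, if the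
free entry `f` occurs in the systematic equation of `p`. -/
def outerGate (T : Finset (Fin m)) (B : Matrix (Fin m) (Fin m) (ZMod 2)) (p f : Fin m) :
    List (Gate (Qubit n₀ m)) :=
  if h : p ∈ T ∧ f ∉ T ∧ B p f ≠ 0 then
    [Gate.cnot (f, 0) (p, 0) fun e => ne_of_mem_of_not_mem h.1 h.2.1 (Prod.ext_iff.1 e).1.symm]
  else []

/-- The controlled-NOT gate from qubit `i` to the first qubit of the block `v`. -/
def innerGate (i : Fin n₀) (v : Fin m) : List (Gate (Qubit n₀ m)) :=
  if h : i = 0 then [] else [Gate.cnot (v, i) (v, 0) fun e => h (Prod.ext_iff.1 e).2]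

/-- The layers which encode the outer code into the first qubits of the blocks. Layer `t` holds
the gates from `f` to `p` with `f + p = t` modulo `m`, which act on disjoint sets of qubits. -/
def outerLayers [NeZero m] (T : Finset (Fin m)) (B : Matrix (Fin m) (Fin m) (ZMod 2)) :
    Circuit (Qubit n₀ m) :=
  (List.finRange m).map fun t => (List.finRange m).flatMap fun p => outerGate T B p (t - p)

/-- The layers which encode the inner code, starting from superpositions on the other qubits of
the blocks. -/
def innerLayers (n₀ m : ℕ) [NeZero n₀] : Circuit (Qubit n₀ m) :=
  (List.finRange n₀).map fun i => (List.finRange m).flatMap fun v => innerGate i v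

/-- The qubits which are not the first of their block. -/
def restQubits (n₀ m : ℕ) [NeZero n₀] : Finset (Qubit n₀ m) :=
  Finset.univ.filter fun i => i.2 ≠ 0

/-- The message qubits of the encoding circuit: the first qubits of the blocks outside of `T`. -/
def messageQubits (n₀ : ℕ) [NeZero n₀] (T : Finset (Fin m)) : Finset (Qubit n₀ m) :=
  Finset.univ.filter fun i => i.2 = 0 ∧ i.1 ∉ T

/-- The circuit which encodes the code built from a matrix with the systematic form `T`, `B`. -/
noncomputable def encoder [NeZero m] (T : Finset (Fin m)) (B : Matrix (Fin m) (Fin m) (ZMod 2)) :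
    Circuit (Qubit n₀ m) :=
  outerLayers T B ++ [(restQubits n₀ m).toList.map Gate.had] ++ innerLayers n₀ m

theorem mem_restQubits {i : Qubit n₀ m} : i ∈ restQubits n₀ m ↔ i.2 ≠ 0 := by
  simp [restQubits]

theorem mem_messageQubits {T : Finset (Fin m)} {i : Qubit n₀ m} :
    i ∈ messageQubits n₀ T ↔ i.2 = 0 ∧ i.1 ∉ T := by
  simp [messageQubits]

theorem card_compl_le_card_messageQubits (T : Finset (Fin m)) :
    Tᶜ.card ≤ (messageQubits n₀ T).card :=
  Finset.card_le_card_of_injOn (fun v => (v, 0)) (fun v hv => by simpa [messageQubits] using hv)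
    fun v _ w _ h => (Prod.ext_iff.1 h).1

theorem mem_outerGate {T : Finset (Fin m)} {B : Matrix (Fin m) (Fin m) (ZMod 2)} {p f : Fin m}
    {g : Gate (Qubit n₀ m)} (hg : g ∈ outerGate T B p f) :
    p ∈ T ∧ f ∉ T ∧ ∃ h, g = Gate.cnot (f, 0) (p, 0) h := by
  rw [outerGate] at hg
  split_ifs at hg with h
  · exact ⟨h.1, h.2.1, _, List.mem_singleton.1 hg⟩
  · simp at hg

theorem mem_innerGate {i : Fin n₀} {v : Fin m} {g : Gate (Qubit n₀ m)}
    (hg : g ∈ innerGate i v) : i ≠ 0 ∧ ∃ h, g = Gate.cnot (v, i) (v, 0) h := by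
  rw [innerGate] at hg
  split_ifs at hg with h
  · simp at hg
  · exact ⟨h, _, List.mem_singleton.1 hg⟩

theorem length_outerGate_le (T : Finset (Fin m)) (B : Matrix (Fin m) (Fin m) (ZMod 2))
    (p f : Fin m) : (outerGate (n₀ := n₀) T B p f).length ≤ 1 := by
  rw [outerGate]
  split_ifs <;> simp

theorem length_innerGate_le (i : Fin n₀) (v : Fin m) : (innerGate i v).length ≤ 1 := by
  rw [innerGate]
  split_ifs <;> simp

theorem innerLayers_wellFormed : (innerLayers n₀ m).WellFormed := by
  intro layer h_layer
  obtain ⟨i, -, rfl⟩ := List.mem_map.1 h_layer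
  refine pairwise_disjoint_support_flatMap (fun v => length_innerGate_le i v) ?_
  intro v v' hne a ha b hb
  obtain ⟨-, -, rfl⟩ := mem_innerGate ha
  obtain ⟨-, -, rfl⟩ := mem_innerGate hb
  simp [Gate.support, hne.symm]

variable (T : Finset (Fin m)) (B : Matrix (Fin m) (Fin m) (ZMod 2))

theorem outerLayers_wellFormed [NeZero m] : (outerLayers (n₀ := n₀) T B).WellFormed := by
  intro layer h_layer
  obtain ⟨t, -, rfl⟩ := List.mem_map.1 h_layer
  refine pairwise_disjoint_support_flatMap (fun p => length_outerGate_le T B p (t - p)) ?_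
  intro p p' hne a ha b hb
  obtain ⟨hp, hf, -, rfl⟩ := mem_outerGate ha
  obtain ⟨hp', hf', -, rfl⟩ := mem_outerGate hb
  have h_target_control : t - p' ≠ p := (ne_of_mem_of_not_mem hp hf').symm
  have h_control_target : p' ≠ t - p := ne_of_mem_of_not_mem hp' hf
  have h_controls : t - p' ≠ t - p := fun h => hne (sub_right_injective h.symm)
  simp [Gate.support, h_target_control, h_control_target, h_controls, hne.symm]

theorem encoder_wellFormed [NeZero m] : (encoder (n₀ := n₀) T B).WellFormed := by
  intro layer h_layer
  simp only [encoder, List.mem_append, List.mem_singleton, or_assoc] at h_layer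
  rcases h_layer with h_outer | rfl | h_inner
  · exact outerLayers_wellFormed T B layer h_outer
  · rw [List.pairwise_map]
    exact (Finset.nodup_toList _).imp fun hne => by simpa [Gate.support] using hne
  · exact innerLayers_wellFormed layer h_inner

theorem size_encoder_le [NeZero m] : (encoder (n₀ := n₀) T B).size ≤ m * m + 2 * (n₀ * m) := by
  have h_outer : (outerLayers (n₀ := n₀) T B).flatten.length ≤ m * m :=
    length_flatten_map_flatMap_le fun t p => length_outerGate_le T B p (t - p)
  have h_inner : (innerLayers n₀ m).flatten.length ≤ n₀ * m :=
    length_flatten_map_flatMap_le length_innerGate_le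
  have h_rest : (restQubits n₀ m).card ≤ n₀ * m :=
    (Finset.card_le_univ _).trans (by simp [mul_comm])
  simp only [Circuit.size, encoder, List.flatten_append, List.length_append, List.flatten_cons,
    List.flatten_nil, List.append_nil, List.length_map, Finset.length_toList]
  omega

theorem depth_encoder [NeZero m] : (encoder (n₀ := n₀) T B).depth = m + 1 + n₀ := by
  simp only [Circuit.depth, encoder, outerLayers, innerLayers, List.length_append, List.length_map,
    List.length_finRange, List.length_singleton]

/-! #### The outer layers -/

/-- The action of the outer layers on the basis states. -/
def outerMap (x : Bits (Qubit n₀ m)) : Bits (Qubit n₀ m) :=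
  x + firstQubits fun p => if p ∈ T then ∑ f ∈ Tᶜ, B p f * x (f, 0) else 0

theorem sum_toggle_outerGate (p f : Fin m) (x : Bits (Qubit n₀ m)) :
    ((outerGate T B p f).map fun g => g.toggle x).sum =
      firstQubits (Pi.single p (if p ∈ T ∧ f ∉ T then B p f * x (f, 0) else 0)) := by
  rw [outerGate]
  split_ifs with h_gate h_pf h_pf
  · have h_one : B p f = 1 := (zmod_two_eq_zero_or_one _).resolve_left h_gate.2.2
    simp [Gate.toggle, h_one, single_eq_firstQubits]
  · exact absurd ⟨h_gate.1, h_gate.2.1⟩ h_pf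
  · have h_zero : B p f = 0 := not_not.1 fun h => h_gate ⟨h_pf.1, h_pf.2, h⟩
    simp [h_zero, firstQubits_zero]
  · simp [firstQubits_zero]

theorem add_sum_toggle_outerLayers [NeZero m] (x : Bits (Qubit n₀ m)) :
    x + ((outerLayers T B).flatten.map fun g => g.toggle x).sum = outerMap T B x := by
  rw [outerLayers, sum_map_flatten_flatMap fun t p => outerGate T B p (t - p), outerMap]
  simp only [sum_toggle_outerGate, ← firstQubits_sum]
  congr 2
  funext p
  have h_shift := (Equiv.subRight p).sum_comp
    fun f => if p ∈ T ∧ f ∉ T then B p f * x (f, 0) else 0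
  simp only [Equiv.subRight_apply] at h_shift
  simp only [Finset.sum_apply, Pi.single_apply, Finset.sum_ite_eq, Finset.mem_univ, if_true]
  rw [h_shift]
  by_cases hp : p ∈ T
  · simp only [hp, true_and, if_true]
    rw [← Finset.sum_filter]
    exact Finset.sum_congr (by ext; simp) fun _ _ => rfl
  · simp [hp]

variable {T B}

theorem outerMap_apply_of_notMem {f : Fin m} (hf : f ∉ T) (x : Bits (Qubit n₀ m)) :
    outerMap T B x (f, 0) = x (f, 0) := by
  simp [outerMap, firstQubits_apply_zero, hf]

theorem outerMap_apply_of_mem {p : Fin m} (hp : p ∈ T) (x : Bits (Qubit n₀ m)) :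
    outerMap T B x (p, 0) = x (p, 0) + ∑ f ∈ Tᶜ, B p f * x (f, 0) := by
  simp [outerMap, firstQubits_apply_zero, hp]

theorem outerMap_apply_of_ne_zero {i : Qubit n₀ m} (hi : i.2 ≠ 0) (x : Bits (Qubit n₀ m)) :
    outerMap T B x i = x i := by
  simp [outerMap, firstQubits_apply_of_ne_zero _ hi]

theorem sum_mul_outerMap (x : Bits (Qubit n₀ m)) (p : Fin m) :
    ∑ f ∈ Tᶜ, B p f * outerMap T B x (f, 0) = ∑ f ∈ Tᶜ, B p f * x (f, 0) :=
  Finset.sum_congr rfl fun f hf => by rw [outerMap_apply_of_notMem (Finset.mem_compl.1 hf)]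

theorem outerMap_involutive : Function.Involutive (outerMap (n₀ := n₀) T B) := by
  intro x
  funext ⟨v, i⟩
  by_cases hi : i = 0
  · subst hi
    by_cases hv : v ∈ T
    · rw [outerMap_apply_of_mem hv, outerMap_apply_of_mem hv, sum_mul_outerMap, add_assoc,
        CharTwo.add_self_eq_zero, add_zero]
    · rw [outerMap_apply_of_notMem hv, outerMap_apply_of_notMem hv]
  · rw [outerMap_apply_of_ne_zero hi, outerMap_apply_of_ne_zero hi]

/-- The states on the way from the outer layers (`D = ∅`) to the inner layers (`D` all qubits which
are not the first of their block): the first qubits hold words of the kernel of `H`, and the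
qubits in `D` are in superposition. -/
abbrev outerStates (H : Matrix (Fin r) (Fin m) (ZMod 2)) (D : Set (Qubit n₀ m)) :
    Set (QState (Qubit n₀ m)) :=
  plusStates (fun x => H *ᵥ (fun v => x (v, 0)) = 0) (restQubits n₀ m) D

variable {H : Matrix (Fin r) (Fin m) (ZMod 2)}

theorem comp_outerMap_mem_outerStates (hH : IsSystematic H T B) {φ : QState (Qubit n₀ m)}
    (hφ : φ ∈ messageSpace (messageQubits n₀ T)) :
    φ ∘ outerMap T B ∈ outerStates H ∅ := by
  refine ⟨fun x hx => ?_, fun x x' hxx => ?_⟩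
  · have h_zero (i : Qubit n₀ m) (hi : i ∉ messageQubits n₀ T) : outerMap T B x i = 0 := by
      by_contra h
      exact hx (hφ _ ⟨i, hi, h⟩)
    refine ⟨(hH _).2 fun p hp => CharTwo.add_eq_zero.1 ?_, fun i hi _ => ?_⟩
    · rw [← outerMap_apply_of_mem hp]
      exact h_zero _ fun h => (mem_messageQubits.1 h).2 hp
    · have hi : i.2 ≠ 0 := mem_restQubits.1 hi
      rw [← outerMap_apply_of_ne_zero hi x]
      exact h_zero i fun h => hi (mem_messageQubits.1 h).1
  · rw [show x = x' from funext fun i => hxx i (Set.notMem_empty i)]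

theorem comp_outerMap_mem_messageSpace (hH : IsSystematic H T B) {φ : QState (Qubit n₀ m)}
    (hφ : φ ∈ outerStates H ∅) :
    φ ∘ outerMap T B ∈ messageSpace (messageQubits n₀ T) := by
  rintro x ⟨⟨v, i⟩, hi, hxi⟩
  by_contra h_ne
  obtain ⟨h_ker, h_rest⟩ := hφ.1 _ h_ne
  by_cases hi0 : i = 0
  · subst hi0
    have hv : v ∈ T := by simpa [mem_messageQubits] using hi
    have h_eq := (hH _).1 h_ker v hv
    rw [outerMap_apply_of_mem hv, sum_mul_outerMap] at h_eq
    exact hxi (by simpa using h_eq)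
  · rw [← outerMap_apply_of_ne_zero (i := (v, i)) hi0 x] at hxi
    exact hxi (h_rest (v, i) (mem_restQubits.2 hi0) (Set.notMem_empty _))

theorem image_outerLayers [NeZero m] (hH : IsSystematic H T B) :
    gatesOp (outerLayers (n₀ := n₀) T B).flatten ''
        (messageSpace (messageQubits n₀ T) : Set (QState (Qubit n₀ m))) = outerStates H ∅ := by
  refine image_gatesOp_of_cnotFrom (S := {i | i.1 ∉ T}) (fun g hg => ?_)
    (add_sum_toggle_outerLayers T B) outerMap_involutive
    (fun φ hφ => comp_outerMap_mem_outerStates hH hφ)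
    fun φ hφ => comp_outerMap_mem_messageSpace hH hφ
  obtain ⟨layer, h_layer, hg⟩ := List.mem_flatten.1 hg
  obtain ⟨t, -, rfl⟩ := List.mem_map.1 h_layer
  obtain ⟨p, -, hg⟩ := List.mem_flatMap.1 hg
  obtain ⟨hp, hf, -, rfl⟩ := mem_outerGate hg
  exact ⟨hf, fun h => h hp⟩

/-! #### The inner layers -/

/-- The action of the inner layers on the basis states. -/
def innerMap (x : Bits (Qubit n₀ m)) : Bits (Qubit n₀ m) :=
  x + firstQubits (blockParity x + fun v => x (v, 0))

theorem sum_toggle_innerGate (i : Fin n₀) (v : Fin m) (x : Bits (Qubit n₀ m)) :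
    ((innerGate i v).map fun g => g.toggle x).sum =
      firstQubits (Pi.single v (if i = 0 then 0 else x (v, i))) := by
  rw [innerGate]
  split_ifs
  · simp [firstQubits_zero]
  · simp [Gate.toggle, single_eq_firstQubits]

theorem add_sum_toggle_innerLayers (x : Bits (Qubit n₀ m)) :
    x + ((innerLayers n₀ m).flatten.map fun g => g.toggle x).sum = innerMap x := by
  rw [innerLayers, sum_map_flatten_flatMap fun i v => innerGate i v, innerMap]
  simp only [sum_toggle_innerGate, ← firstQubits_sum]
  congr 2
  funext v
  simp only [Finset.sum_apply, Pi.single_apply, Finset.sum_ite_eq, Finset.mem_univ, if_true,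
    Pi.add_apply, blockParity_apply]
  rw [← Finset.add_sum_erase _ _ (Finset.mem_univ (0 : Fin n₀)),
    ← Finset.add_sum_erase _ (fun i => x (v, i)) (Finset.mem_univ (0 : Fin n₀)), if_pos rfl,
    zero_add, add_comm (x _), add_assoc, CharTwo.add_self_eq_zero, add_zero]
  exact Finset.sum_congr rfl fun i hi => if_neg (Finset.ne_of_mem_erase hi)

theorem innerMap_apply_zero (x : Bits (Qubit n₀ m)) (v : Fin m) :
    innerMap x (v, 0) = blockParity x v := by
  rw [innerMap, Pi.add_apply, firstQubits_apply_zero, Pi.add_apply, add_comm, add_assoc,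
    CharTwo.add_self_eq_zero, add_zero]

theorem innerMap_apply_of_ne_zero {i : Qubit n₀ m} (hi : i.2 ≠ 0) (x : Bits (Qubit n₀ m)) :
    innerMap x i = x i := by
  simp [innerMap, firstQubits_apply_of_ne_zero _ hi]

theorem blockParity_innerMap (x : Bits (Qubit n₀ m)) :
    blockParity (innerMap x) = fun v => x (v, 0) := by
  rw [innerMap, map_add, blockParity_firstQubits, ← add_assoc, ZModModule.add_self, zero_add]

theorem innerMap_involutive : Function.Involutive (innerMap (n₀ := n₀) (m := m)) := by
  intro x
  funext ⟨v, i⟩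
  by_cases hi : i = 0
  · subst hi
    rw [innerMap_apply_zero, blockParity_innerMap]
  · rw [innerMap_apply_of_ne_zero hi, innerMap_apply_of_ne_zero hi]

theorem comp_innerMap_mem_code {φ : QState (Qubit n₀ m)}
    (hφ : φ ∈ outerStates H (restQubits n₀ m)) : φ ∘ innerMap ∈ code n₀ H := by
  obtain ⟨h_supp, h_indep⟩ := hφ
  refine mem_code.2 ⟨fun x hx => ?_, fun u hu x => h_indep _ _ fun ⟨v, i⟩ hi => ?_⟩
  · simpa only [innerMap_apply_zero] using (h_supp _ hx).1
  · obtain rfl : i = 0 := by simpa [mem_restQubits] using hi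
    rw [innerMap_apply_zero, innerMap_apply_zero, map_add, hu, add_zero]

theorem comp_innerMap_mem_outerStates {φ : QState (Qubit n₀ m)} (hφ : φ ∈ code n₀ H) :
    φ ∘ innerMap ∈ outerStates H (restQubits n₀ m) := by
  obtain ⟨h_supp, h_inv⟩ := mem_code.1 hφ
  refine ⟨fun x hx => ⟨?_, fun i hi hi' => absurd hi hi'⟩, fun x x' hxx => ?_⟩
  · simpa only [blockParity_innerMap] using h_supp _ hx
  · have h_parity : blockParity (innerMap x + innerMap x') = 0 := by
      rw [map_add, blockParity_innerMap, blockParity_innerMap]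
      funext v
      rw [Pi.add_apply, hxx (v, 0) (by simp [mem_restQubits]), CharTwo.add_self_eq_zero,
        Pi.zero_apply]
    have h_shift := h_inv _ h_parity (innerMap x)
    rw [← add_assoc, ZModModule.add_self, zero_add] at h_shift
    exact h_shift.symm

theorem image_innerLayers (H : Matrix (Fin r) (Fin m) (ZMod 2)) :
    gatesOp (innerLayers n₀ m).flatten '' outerStates H (restQubits n₀ m) = code n₀ H := by
  refine image_gatesOp_of_cnotFrom (S := {i | i.2 ≠ 0}) (fun g hg => ?_)
    add_sum_toggle_innerLayers innerMap_involutive (fun φ hφ => comp_innerMap_mem_code hφ)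
    fun φ hφ => comp_innerMap_mem_outerStates hφ
  obtain ⟨layer, h_layer, hg⟩ := List.mem_flatten.1 hg
  obtain ⟨i, -, rfl⟩ := List.mem_map.1 h_layer
  obtain ⟨v, -, hg⟩ := List.mem_flatMap.1 hg
  obtain ⟨hi, -, rfl⟩ := mem_innerGate hg
  exact ⟨hi, fun h => h rfl⟩

theorem map_encoder [NeZero m] (hH : IsSystematic H T B) :
    (messageSpace (messageQubits n₀ T)).map (encoder T B).op = code n₀ H := by
  have h_op : (encoder (n₀ := n₀) T B).op = gatesOp (innerLayers n₀ m).flatten *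
      (gatesOp ((restQubits n₀ m).toList.map Gate.had) * gatesOp (outerLayers T B).flatten) := by
    change gatesOp (encoder T B).flatten = _
    simp only [encoder, List.flatten_append, List.flatten_cons, List.flatten_nil, List.append_nil,
      gatesOp_append]
  apply SetLike.coe_injective
  rw [Submodule.map_coe, ← image_innerLayers, h_op, Module.End.coe_mul, Module.End.coe_mul,
    Set.image_comp, Set.image_comp, image_outerLayers hH, image_hads]
  · simp only [Set.empty_union, Finset.mem_toList]
    rfl
  · intro x i hi y
    have h_first (v : Fin m) : (v, 0) ≠ i := fun h => mem_restQubits.1 hi (h ▸ rfl)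
    simp [Function.update_of_ne (h_first _)]
  · exact Finset.nodup_toList _
  · exact fun i hi => Finset.mem_toList.1 hi
  · simp

theorem exists_encoder [NeZero m] (H : Matrix (Fin r) (Fin m) (ZMod 2)) :
    (∃ k, Module.finrank ℂ (code n₀ H) = 2 ^ k ∧ m ≤ k + r) ∧
    ∃ circ : Circuit (Qubit n₀ m), circ.Encodes (code n₀ H) ∧
      circ.size ≤ m * m + 2 * (n₀ * m) ∧ circ.depth ≤ m + 1 + n₀ := by
  obtain ⟨T, B, hT, hH⟩ := exists_isSystematic H
  have h_map := map_encoder (n₀ := n₀) hH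
  refine ⟨⟨(messageQubits n₀ T).card, ?_, ?_⟩, encoder T B, ⟨encoder_wellFormed T B, _, h_map⟩,
    size_encoder_le T B, (depth_encoder T B).le⟩
  · rw [← finrank_messageSpace, ← h_map]
    exact (Submodule.equivMapOfInjective _ (gatesOp_injective _) _).finrank_eq.symm
  · have h_card := card_compl_le_card_messageQubits (n₀ := n₀) T
    rw [Finset.card_compl, Fintype.card_fin] at h_card
    rw [Fintype.card_fin] at hT
    omega

end Encoding

/-! ### Lossless expanders -/

section Expander

variable {V J B : Type*} [Fintype J] [DecidableEq J] [DecidableEq B]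

/-- The neighbours of a set of variables in the bipartite graph in which the checks form one block
`B` for each `j : J`, and the variable `v` is joined to the check `f v j` of the block `j`. -/
def nbrs (f : V → J → B) (S : Finset V) : Finset (J × B) :=
  (S ×ˢ Finset.univ).image fun e => (e.2, f e.1 e.2)

theorem mem_nbrs {f : V → J → B} {S : Finset V} {c : J × B} :
    c ∈ nbrs f S ↔ ∃ v ∈ S, f v c.1 = c.2 := by
  simp only [nbrs, Finset.mem_image, Finset.mem_product, Finset.mem_univ, and_true, Prod.exists]
  constructor
  · rintro ⟨v, j, hv, rfl⟩
    exact ⟨v, hv, rfl⟩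
  · rintro ⟨v, hv, h⟩
    exact ⟨v, c.1, hv, by rw [h]⟩

/-- Lossless expansion of the bipartite graph of `f`, which has left degree `|J|`: a nonempty set
of at most `T` variables has more than `3/4` of the maximal number of neighbours. -/
def IsLosslessExpander (f : V → J → B) (T : ℕ) : Prop :=
  ∀ S : Finset V, S.Nonempty → S.card ≤ T → 3 * (Fintype.card J * S.card) < 4 * (nbrs f S).card

theorem choose_le_three_mul_div_pow (n : ℕ) {k : ℕ} (hk : 0 < k) :
    (n.choose k : ℝ) ≤ (3 * n / k) ^ k := by
  have h_exp : (k : ℝ) ^ k / k.factorial ≤ 3 ^ k := by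
    refine (Real.pow_div_factorial_le_exp _ (Nat.cast_nonneg k) k).trans ?_
    rw [← Real.exp_one_pow]
    exact pow_le_pow_left₀ (Real.exp_pos _).le (by linarith [Real.exp_one_lt_d9]) _
  calc (n.choose k : ℝ) ≤ (n : ℝ) ^ k / k.factorial := Nat.choose_le_pow_div k n
    _ = (n / k : ℝ) ^ k * ((k : ℝ) ^ k / k.factorial) := by
        rw [div_pow]
        field_simp
    _ ≤ (n / k : ℝ) ^ k * 3 ^ k := by gcongr
    _ = (3 * n / k) ^ k := by rw [← mul_pow]; ring

theorem prod_le_mean_pow_card {ι : Type*} [Fintype ι] {a : ι → ℝ} (ha : ∀ i, 0 ≤ a i) :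
    ∏ i, a i ≤ ((∑ i, a i) / Fintype.card ι) ^ Fintype.card ι := by
  rcases isEmpty_or_nonempty ι with _ | _
  · simp
  have h_card : (0 : ℝ) < Fintype.card ι := by exact_mod_cast Fintype.card_pos
  have h_amgm := Real.geom_mean_le_arith_mean Finset.univ (fun _ => 1) a (by simp)
    (by simpa using h_card) fun i _ => ha i
  simp only [Real.rpow_one, one_mul, Finset.sum_const, Finset.card_univ, nsmul_eq_mul, mul_one]
    at h_amgm
  calc ∏ i, a i = ((∏ i, a i) ^ (Fintype.card ι : ℝ)⁻¹) ^ Fintype.card ι :=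
        (Real.rpow_inv_natCast_pow (Finset.prod_nonneg fun i _ => ha i) Fintype.card_ne_zero).symm
    _ ≤ _ := by
        have h_nonneg : 0 ≤ ∏ i, a i := Finset.prod_nonneg fun i _ => ha i
        gcongr

/-- The checks of the block `j` that lie in `K`. -/
def blockSlice [Fintype B] (K : Finset (J × B)) (j : J) : Finset B :=
  Finset.univ.filter fun b => (j, b) ∈ K

theorem sum_card_blockSlice [Fintype B] (K : Finset (J × B)) :
    ∑ j, (blockSlice K j).card = K.card := by
  rw [← Finset.card_sigma]
  refine Finset.card_bij (fun a _ => (a.1, a.2)) ?_ ?_ ?_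
  · rintro ⟨j, t⟩ h
    simpa [blockSlice] using h
  · rintro ⟨j, t⟩ _ ⟨j', t'⟩ _ h
    simpa using h
  · rintro ⟨j, t⟩ h
    exact ⟨⟨j, t⟩, by simpa [blockSlice] using h, rfl⟩

section Counting

variable [Fintype V] [DecidableEq V] [Fintype B]

theorem card_nbrs_subset_le_prod (S : Finset V) (K : Finset (J × B)) :
    (Finset.univ.filter fun f : V → J → B => nbrs f S ⊆ K).card ≤
      (∏ j, (blockSlice K j).card) ^ S.card *
        (Fintype.card B ^ Fintype.card J) ^ (Fintype.card V - S.card) := by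
  let choices : V → Finset (J → B) := fun v =>
    if v ∈ S then Fintype.piFinset (blockSlice K) else Finset.univ
  have h_subset : (Finset.univ.filter fun f : V → J → B => nbrs f S ⊆ K) ⊆
      Fintype.piFinset choices := by
    intro f hf
    refine Fintype.mem_piFinset.2 fun v => ?_
    by_cases hv : v ∈ S
    · simp only [choices, if_pos hv, Fintype.mem_piFinset, blockSlice, Finset.mem_filter_univ]
      exact fun j => (Finset.mem_filter.1 hf).2 (mem_nbrs.2 ⟨v, hv, rfl⟩)
    · simp [choices, if_neg hv]
  refine (Finset.card_le_card h_subset).trans_eq ?_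
  rw [Fintype.card_piFinset, ← Finset.prod_mul_prod_compl S]
  congr 1
  · refine (Finset.prod_eq_pow_card fun v hv => ?_)
    simp only [choices, if_pos hv, Fintype.card_piFinset]
  · rw [← Finset.card_compl]
    refine (Finset.prod_eq_pow_card fun v hv => ?_)
    simp only [choices, if_neg (Finset.mem_compl.1 hv), Finset.card_univ, Fintype.card_fun]

theorem card_nbrs_subset_le (S : Finset V) (K : Finset (J × B)) :
    ((Finset.univ.filter fun f : V → J → B => nbrs f S ⊆ K).card : ℝ) ≤
      ((K.card / Fintype.card J : ℝ) ^ Fintype.card J) ^ S.card *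
        ((Fintype.card B : ℝ) ^ Fintype.card J) ^ (Fintype.card V - S.card) := by
  have h_mean := prod_le_mean_pow_card fun j => Nat.cast_nonneg (α := ℝ) (blockSlice K j).card
  rw [← Nat.cast_sum, sum_card_blockSlice] at h_mean
  refine (Nat.cast_le.2 (card_nbrs_subset_le_prod S K)).trans ?_
  push_cast
  gcongr

theorem card_card_nbrs_le_le (S : Finset V) {k : ℕ} (hk : k ≤ Fintype.card (J × B)) :
    ((Finset.univ.filter fun f : V → J → B => (nbrs f S).card ≤ k).card : ℝ) ≤
      (Fintype.card (J × B)).choose k * (((k / Fintype.card J : ℝ) ^ Fintype.card J) ^ S.card *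
        ((Fintype.card B : ℝ) ^ Fintype.card J) ^ (Fintype.card V - S.card)) := by
  have h_cover : (Finset.univ.filter fun f : V → J → B => (nbrs f S).card ≤ k) ⊆
      (Finset.powersetCard k Finset.univ).biUnion fun K =>
        Finset.univ.filter fun f => nbrs f S ⊆ K := by
    intro f hf
    obtain ⟨K, hK, hK_card⟩ := Finset.exists_superset_card_eq (Finset.mem_filter.1 hf).2 hk
    exact Finset.mem_biUnion.2 ⟨K, Finset.mem_powersetCard_univ.2 hK_card,
      Finset.mem_filter.2 ⟨Finset.mem_univ _, hK⟩⟩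
  refine (Nat.cast_le.2 ((Finset.card_le_card h_cover).trans Finset.card_biUnion_le)).trans ?_
  rw [Nat.cast_sum, ← Finset.card_univ (α := J × B), ← Finset.card_powersetCard, ← nsmul_eq_mul]
  refine Finset.sum_le_card_nsmul _ _ _ fun K hK => ?_
  rw [← Finset.mem_powersetCard_univ.1 hK]
  exact card_nbrs_subset_le S K

-- The product of the three bounds is `(96 (q/s) (4 q/s) ^ 6 (6 s/8) ^ 8) ^ s`
-- and `96 * 4 ^ 6 * (3/4) ^ 8 = 39366 < 2 ^ 16`.
theorem expander_union_term_le {m q s : ℕ} (hs : 0 < s) (hsm : s ≤ m) (hm : m ≤ 32 * q)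
    (hsq : s * 2 ^ 18 ≤ q) :
    (m.choose s : ℝ) * ((8 * q).choose (6 * s) *
      (((((6 * s : ℕ) : ℝ) / 8) ^ 8) ^ s * ((q : ℝ) ^ 8) ^ (m - s))) ≤
      (1 / 4) ^ s * ((q : ℝ) ^ 8) ^ m := by
  have hq : (0 : ℝ) < q := Nat.cast_pos.2 (by omega)
  have h_variables : (m.choose s : ℝ) ≤ (96 * q / s) ^ s := by
    refine (choose_le_three_mul_div_pow m hs).trans ?_
    have : (m : ℝ) ≤ 32 * q := by exact_mod_cast hm
    gcongr ?_ ^ s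
    exact div_le_div_of_nonneg_right (by linarith) (Nat.cast_nonneg s)
  have h_checks : ((8 * q).choose (6 * s) : ℝ) ≤ ((4 * q / s) ^ 6) ^ s := by
    refine (choose_le_three_mul_div_pow (8 * q) (by omega)).trans_eq ?_
    rw [← pow_mul]
    congr 1
    push_cast
    field_simp
    ring
  have h_ratio : (s / q : ℝ) ≤ 1 / 2 ^ 18 := by
    rw [div_le_div_iff₀ hq (by positivity), one_mul]
    exact_mod_cast hsq
  rw [← pow_mul_pow_sub ((q : ℝ) ^ 8) hsm]
  calc _ ≤ (96 * q / s : ℝ) ^ s * (((4 * q / s : ℝ) ^ 6) ^ s *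
        (((((6 * s : ℕ) : ℝ) / 8) ^ 8) ^ s * ((q : ℝ) ^ 8) ^ (m - s))) := by gcongr
    _ = (39366 * (s / q) * (q : ℝ) ^ 8) ^ s * ((q : ℝ) ^ 8) ^ (m - s) := by
      rw [← mul_assoc, ← mul_assoc, ← mul_pow, ← mul_pow]
      congr 2
      push_cast
      field_simp
      ring
    _ ≤ (1 / 4 * (q : ℝ) ^ 8) ^ s * ((q : ℝ) ^ 8) ^ (m - s) := by
      gcongr
      linarith
    _ = _ := by rw [mul_pow, mul_assoc]

theorem sum_one_fourth_pow_lt_one (T : ℕ) : ∑ s ∈ Finset.Icc 1 T, (1 / 4 : ℝ) ^ s < 1 := by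
  have h_sum : ∑ s ∈ Finset.Icc 1 T, (1 / 4 : ℝ) ^ s = (1 - (1 / 4) ^ T) / 3 := by
    induction T with
    | zero => simp
    | succ T ih =>
      rw [Finset.sum_Icc_succ_top (by omega), ih]
      ring
  have : (0 : ℝ) < (1 / 4) ^ T := by positivity
  linarith

theorem card_not_expanding_le (hV : Fintype.card V ≤ 32 * Fintype.card B) {s : ℕ} (hs : 0 < s)
    (hsB : s * 2 ^ 18 ≤ Fintype.card B) :
    (((Finset.powersetCard s Finset.univ).biUnion fun S : Finset V =>
      Finset.univ.filter fun f : V → Fin 8 → B => (nbrs f S).card ≤ 6 * s).card : ℝ) ≤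
      (1 / 4) ^ s * ((Fintype.card B : ℝ) ^ 8) ^ Fintype.card V := by
  rcases lt_or_ge (Fintype.card V) s with hVs | hsV
  · rw [Finset.powersetCard_eq_empty.2 (by rwa [Finset.card_univ]), Finset.biUnion_empty,
      Finset.card_empty, Nat.cast_zero]
    positivity
  refine le_trans ?_ (expander_union_term_le hs hsV hV hsB)
  refine (Nat.cast_le.2 Finset.card_biUnion_le).trans ?_
  rw [Nat.cast_sum, ← Finset.card_univ (α := V), ← Finset.card_powersetCard, ← nsmul_eq_mul]
  refine Finset.sum_le_card_nsmul _ _ _ fun S hS => ?_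
  have h_card : Fintype.card (Fin 8 × B) = 8 * Fintype.card B := by simp
  have h_le := card_card_nbrs_le_le (J := Fin 8) (B := B) S (k := 6 * s) (by omega)
  rwa [Finset.mem_powersetCard_univ.1 hS, h_card, Fintype.card_fin] at h_le

end Counting

theorem exists_isLosslessExpander [Fintype V] [Fintype B] [Nonempty B]
    {T : ℕ} (hV : Fintype.card V ≤ 32 * Fintype.card B)
    (hT : T * 2 ^ 18 ≤ Fintype.card B) :
    ∃ f : V → Fin 8 → B, IsLosslessExpander f T := by
  classical
  let bad : ℕ → Finset (V → Fin 8 → B) := fun s =>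
    (Finset.powersetCard s Finset.univ).biUnion fun S =>
      Finset.univ.filter fun f => (nbrs f S).card ≤ 6 * s
  have h_bad : (((Finset.Icc 1 T).biUnion bad).card : ℝ) <
      (Finset.univ : Finset (V → Fin 8 → B)).card := by
    have h_pos : (0 : ℝ) < ((Fintype.card B : ℝ) ^ 8) ^ Fintype.card V := by
      have := Fintype.card_pos (α := B)
      positivity
    calc (((Finset.Icc 1 T).biUnion bad).card : ℝ)
        ≤ ∑ s ∈ Finset.Icc 1 T, ((bad s).card : ℝ) := by exact_mod_cast Finset.card_biUnion_le
      _ ≤ ∑ s ∈ Finset.Icc 1 T, (1 / 4) ^ s * ((Fintype.card B : ℝ) ^ 8) ^ Fintype.card V := by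
          refine Finset.sum_le_sum fun s hs => ?_
          obtain ⟨hs_pos, hsT⟩ := Finset.mem_Icc.1 hs
          exact card_not_expanding_le hV hs_pos ((Nat.mul_le_mul_right _ hsT).trans hT)
      _ < ((Fintype.card B : ℝ) ^ 8) ^ Fintype.card V := by
          rw [← Finset.sum_mul]
          exact mul_lt_of_lt_one_left h_pos (sum_one_fourth_pow_lt_one T)
      _ = _ := by simp
  obtain ⟨f, -, hf⟩ := Finset.exists_mem_notMem_of_card_lt_card (Nat.cast_lt.1 h_bad)
  refine ⟨f, fun S hS hST => ?_⟩
  by_contra! h_small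
  rw [Fintype.card_fin] at h_small
  refine hf (Finset.mem_biUnion.2 ⟨S.card, Finset.mem_Icc.2 ⟨hS.card_pos, hST⟩,
    Finset.mem_biUnion.2 ⟨S, Finset.mem_powersetCard_univ.2 rfl,
      Finset.mem_filter.2 ⟨Finset.mem_univ _, by omega⟩⟩⟩)

end Expander

/-! ### Sequential bit flipping -/

section BitFlip

variable {V J B : Type*}

theorem hammingNorm_add_single_le [Fintype V] [DecidableEq V] (y : V → ZMod 2) (w : V)
    (a : ZMod 2) : hammingNorm (y + Pi.single w a) ≤ hammingNorm y + 1 := by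
  refine (Finset.card_le_card (t := insert w (Finset.univ.filter fun v => y v ≠ 0))
    fun v hv => ?_).trans (Finset.card_insert_le _ _)
  rw [Finset.mem_filter_univ] at hv
  rw [Finset.mem_insert, Finset.mem_filter_univ]
  by_cases h : v = w
  · exact Or.inl h
  · exact Or.inr (by simpa [h] using hv)

variable [DecidableEq B]

/-- The parity check matrix of the bipartite graph of `f`. -/
def tannerMatrix (f : V → J → B) : Matrix (J × B) V (ZMod 2) :=
  Matrix.of fun c v => if f v c.1 = c.2 then 1 else 0

/-- The number of unsatisfied checks of a variable. -/
def unsat [Fintype J] (f : V → J → B) (s : J × B → ZMod 2) (v : V) : ℕ :=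
  (Finset.univ.filter fun j => s (j, f v j) ≠ 0).card

/-- One step of bit flipping, on pairs of a syndrome and an error estimate: flip a variable most of
whose checks are unsatisfied, if there is one. -/
def FlipStep [Fintype J] [DecidableEq V] (f : V → J → B)
    (a b : (J × B → ZMod 2) × (V → ZMod 2)) : Prop :=
  (∃ w, Fintype.card J < 2 * unsat f a.1 w ∧ b = (a.1 + (tannerMatrix f).col w,
    a.2 + Pi.single w 1)) ∨ ((∀ w, ¬ Fintype.card J < 2 * unsat f a.1 w) ∧ b = a)

/-- The number of variables of `S` that are joined to the check `c`. -/
def degIn (f : V → J → B) (S : Finset V) (c : J × B) : ℕ :=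
  (S.filter fun v => f v c.1 = c.2).card

theorem sum_degIn [Fintype J] [Fintype B] (f : V → J → B) (S : Finset V) :
    ∑ c, degIn f S c = Fintype.card J * S.card := by
  have h_block (j : J) : ∑ b, ∑ v ∈ S, (if f v j = b then 1 else 0) = S.card := by
    rw [Finset.sum_comm]
    simp
  simp only [degIn, Finset.card_filter, Fintype.sum_prod_type, h_block]
  simp

theorem hammingNorm_add_col_le [Fintype J] [Fintype B] (f : V → J → B) (s : J × B → ZMod 2)
    (w : V) :
    hammingNorm (s + (tannerMatrix f).col w) + 2 * unsat f s w ≤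
      hammingNorm s + Fintype.card J := by
  have h_supp (j : J) : ∑ b, (if (s + (tannerMatrix f).col w) (j, b) ≠ 0 then 1 else 0) +
      2 * (if s (j, f w j) ≠ 0 then 1 else 0) = ∑ b, (if s (j, b) ≠ 0 then 1 else 0) + 1 := by
    rw [← Finset.add_sum_erase _ _ (Finset.mem_univ (f w j)),
      ← Finset.add_sum_erase _ (fun b => if s (j, b) ≠ 0 then 1 else 0) (Finset.mem_univ (f w j)),
      Finset.sum_congr rfl fun b hb => by
        rw [Pi.add_apply, Matrix.col_apply, tannerMatrix, Matrix.of_apply,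
          if_neg (Finset.ne_of_mem_erase hb).symm, add_zero]]
    rcases zmod_two_eq_zero_or_one (s (j, f w j)) with h | h
    · simp [tannerMatrix, h]
      omega
    · simp [tannerMatrix, h, CharTwo.add_self_eq_zero]
      omega
  simp only [hammingNorm, unsat, Finset.card_filter, Fintype.sum_prod_type]
  rw [Finset.mul_sum, ← Finset.sum_add_distrib, Finset.sum_congr rfl fun j _ => h_supp j,
    Finset.sum_add_distrib]
  simp

variable [Fintype V]

/-- The support of a binary vector. -/
def supp (y : V → ZMod 2) : Finset V := Finset.univ.filter fun v => y v ≠ 0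

theorem mem_supp {y : V → ZMod 2} {v : V} : v ∈ supp y ↔ y v ≠ 0 := Finset.mem_filter_univ _

theorem supp_nonempty {y : V → ZMod 2} (hy : y ≠ 0) : (supp y).Nonempty :=
  let ⟨v, hv⟩ := Function.ne_iff.1 hy
  ⟨v, mem_supp.2 hv⟩

theorem tannerMatrix_mulVec_apply (f : V → J → B) (y : V → ZMod 2) (c : J × B) :
    (tannerMatrix f *ᵥ y) c = (degIn f (supp y) c : ZMod 2) := by
  rw [degIn, Finset.card_filter, supp, Finset.sum_filter, Nat.cast_sum, Matrix.mulVec, dotProduct]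
  refine Finset.sum_congr rfl fun v _ => ?_
  rcases zmod_two_eq_zero_or_one (y v) with h | h <;> simp [tannerMatrix, h]

theorem degIn_pos_of_mulVec_ne_zero {f : V → J → B} {y : V → ZMod 2} {c : J × B}
    (h : (tannerMatrix f *ᵥ y) c ≠ 0) : 0 < degIn f (supp y) c := by
  rw [tannerMatrix_mulVec_apply] at h
  exact Nat.pos_of_ne_zero fun h0 => h (by rw [h0, Nat.cast_zero])

variable [Fintype J] {f : V → J → B} {T : ℕ}

section

variable [Fintype B]

theorem hammingNorm_tannerMatrix_mulVec_le (f : V → J → B) (y : V → ZMod 2) :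
    hammingNorm (tannerMatrix f *ᵥ y) ≤ Fintype.card J * hammingNorm y := by
  change _ ≤ _ * (supp y).card
  rw [← sum_degIn f, hammingNorm, Finset.card_filter]
  refine Finset.sum_le_sum fun c _ => ?_
  split_ifs with h
  · exact degIn_pos_of_mulVec_ne_zero h
  · exact Nat.zero_le _

-- A neighbour that is not joined to a unique variable is counted twice by the edges.
theorem two_mul_card_nbrs_le [DecidableEq J] (f : V → J → B) (y : V → ZMod 2) :
    2 * (nbrs f (supp y)).card ≤
      Fintype.card J * hammingNorm y + hammingNorm (tannerMatrix f *ᵥ y) := by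
  let flag : J × B → ℕ := fun c => if (tannerMatrix f *ᵥ y) c ≠ 0 then 1 else 0
  have h_two {c : J × B} (hc : c ∈ nbrs f (supp y)) : 2 ≤ degIn f (supp y) c + flag c := by
    obtain ⟨v, hv, hvc⟩ := mem_nbrs.1 hc
    have h_pos : 0 < degIn f (supp y) c := Finset.card_pos.2 ⟨v, by simp [hv, hvc]⟩
    by_cases h_deg : degIn f (supp y) c = 1
    · simp [flag, tannerMatrix_mulVec_apply, h_deg]
    · omega
  calc 2 * (nbrs f (supp y)).card = ∑ c ∈ nbrs f (supp y), 2 := by simp [mul_comm]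
    _ ≤ ∑ c ∈ nbrs f (supp y), (degIn f (supp y) c + flag c) :=
      Finset.sum_le_sum fun c hc => h_two hc
    _ ≤ ∑ c, (degIn f (supp y) c + flag c) :=
      Finset.sum_le_sum_of_subset (Finset.subset_univ _)
    _ = _ := by
      rw [Finset.sum_add_distrib, sum_degIn, hammingNorm, hammingNorm, ← Finset.card_filter, supp]

theorem hammingNorm_mulVec_le_sum_unsat (f : V → J → B) (y : V → ZMod 2) :
    hammingNorm (tannerMatrix f *ᵥ y) ≤ ∑ v ∈ supp y, unsat f (tannerMatrix f *ᵥ y) v := by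
  set s := tannerMatrix f *ᵥ y with hs
  have h_unsat (v : V) :
      unsat f s v = ∑ c : J × B, if f v c.1 = c.2 ∧ s c ≠ 0 then 1 else 0 := by
    rw [unsat, Finset.card_filter, Fintype.sum_prod_type]
    refine Finset.sum_congr rfl fun j _ => ?_
    simp only [ite_and, Finset.sum_ite_eq, Finset.mem_univ, if_true]
  simp only [h_unsat]
  rw [Finset.sum_comm, hammingNorm, Finset.card_filter]
  refine Finset.sum_le_sum fun c _ => ?_
  split_ifs with h
  · simpa [h, degIn] using degIn_pos_of_mulVec_ne_zero (hs ▸ h)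
  · exact Nat.zero_le _

theorem IsLosslessExpander.card_mul_hammingNorm_lt [DecidableEq J]
    (hf : IsLosslessExpander f T) {y : V → ZMod 2} (hy : y ≠ 0) (hT : hammingNorm y ≤ T) :
    Fintype.card J * hammingNorm y < 2 * hammingNorm (tannerMatrix f *ᵥ y) := by
  have h_expand : 3 * (Fintype.card J * hammingNorm y) < 4 * (nbrs f (supp y)).card :=
    hf (supp y) (supp_nonempty hy) hT
  have h_nbrs := two_mul_card_nbrs_le f y
  omega

end

theorem IsLosslessExpander.exists_lt_two_mul_unsat [Finite B] [DecidableEq J]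
    (hf : IsLosslessExpander f T) {y : V → ZMod 2} (hy : y ≠ 0) (hT : hammingNorm y ≤ T) :
    ∃ w, Fintype.card J < 2 * unsat f (tannerMatrix f *ᵥ y) w := by
  cases nonempty_fintype B
  by_contra! h_few
  have h_lt := hf.card_mul_hammingNorm_lt hy hT
  have h_le := hammingNorm_mulVec_le_sum_unsat f y
  have h_sum := Finset.sum_le_card_nsmul (supp y) (fun v => 2 * unsat f (tannerMatrix f *ᵥ y) v)
    _ fun v _ => h_few v
  rw [← Finset.mul_sum, smul_eq_mul, mul_comm (supp y).card] at h_sum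
  change _ ≤ Fintype.card J * hammingNorm y at h_sum
  omega

variable [Fintype B]

/-- The invariant of `i` steps of bit flipping started at the syndrome of `e`, in terms of the
remaining error `e + a.2`. -/
structure FlipInvariant (f : V → J → B) (T : ℕ) (e : V → ZMod 2) (i : ℕ)
    (a : (J × B → ZMod 2) × (V → ZMod 2)) : Prop where
  syndrome : a.1 = tannerMatrix f *ᵥ (e + a.2)
  error_le : hammingNorm (e + a.2) ≤ T
  syndrome_le : hammingNorm a.1 ≤ Fintype.card J * hammingNorm e
  progress : e + a.2 = 0 ∨ hammingNorm a.1 + i ≤ hammingNorm (tannerMatrix f *ᵥ e)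

theorem flipInvariant_zero {e : V → ZMod 2} (he : hammingNorm e ≤ T) :
    FlipInvariant f T e 0 (tannerMatrix f *ᵥ e, 0) where
  syndrome := by rw [add_zero]
  error_le := by rwa [add_zero]
  syndrome_le := hammingNorm_tannerMatrix_mulVec_le f e
  progress := Or.inr le_rfl

theorem FlipInvariant.flipStep [DecidableEq V] [DecidableEq J]
    (hf : IsLosslessExpander f T) {e : V → ZMod 2} (he : 2 * hammingNorm e ≤ T) {i : ℕ}
    {a b : (J × B → ZMod 2) × (V → ZMod 2)} (ha : FlipInvariant f T e i a)
    (hab : FlipStep f a b) : FlipInvariant f T e (i + 1) b := by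
  rcases eq_or_ne (e + a.2) 0 with h_zero | h_ne
  · have h_syn : a.1 = 0 := by rw [ha.syndrome, h_zero, Matrix.mulVec_zero]
    rcases hab with ⟨w, hw, -⟩ | ⟨-, rfl⟩
    · simp [h_syn, unsat] at hw
    · exact ⟨ha.syndrome, ha.error_le, ha.syndrome_le, Or.inl h_zero⟩
  · rcases hab with ⟨w, hw, rfl⟩ | ⟨h_none, -⟩
    · have h_lt := hf.card_mul_hammingNorm_lt h_ne ha.error_le
      rw [← ha.syndrome] at h_lt
      have h_drop := hammingNorm_add_col_le f a.1 w
      have h_error : hammingNorm (e + a.2) < T := by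
        refine Nat.lt_of_mul_lt_mul_left (a := Fintype.card J) (h_lt.trans_le ?_)
        calc 2 * hammingNorm a.1 ≤ 2 * (Fintype.card J * hammingNorm e) :=
              Nat.mul_le_mul_left _ ha.syndrome_le
          _ = Fintype.card J * (2 * hammingNorm e) := by ring
          _ ≤ Fintype.card J * T := Nat.mul_le_mul_left _ he
      have h_progress := ha.progress.resolve_left h_ne
      have h_le := ha.syndrome_le
      refine ⟨?_, ?_, by dsimp only; omega, Or.inr (by dsimp only; omega)⟩
      · rw [← add_assoc, Matrix.mulVec_add, ← ha.syndrome, Matrix.mulVec_single_one]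
      · rw [← add_assoc]
        exact (hammingNorm_add_single_le _ _ _).trans h_error
    · obtain ⟨w, hw⟩ := hf.exists_lt_two_mul_unsat h_ne ha.error_le
      exact absurd (ha.syndrome ▸ hw) (h_none w)

theorem FlipInvariant.eq_error [DecidableEq J]
    (hf : IsLosslessExpander f T) {e : V → ZMod 2} {i : ℕ} (hi : Fintype.card (J × B) ≤ i)
    {a : (J × B → ZMod 2) × (V → ZMod 2)} (ha : FlipInvariant f T e i a) : a.2 = e := by
  have h_zero : e + a.2 = 0 := by
    by_contra h_ne
    have h_lt := hf.card_mul_hammingNorm_lt h_ne ha.error_le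
    rw [← ha.syndrome] at h_lt
    have h_progress := ha.progress.resolve_left h_ne
    have h_card : hammingNorm (tannerMatrix f *ᵥ e) ≤ Fintype.card (J × B) :=
      hammingNorm_le_card_fintype
    omega
  rw [← ZModModule.sub_eq_add, sub_eq_zero] at h_zero
  exact h_zero.symm

theorem eq_error_of_flipSteps [DecidableEq V] [DecidableEq J]
    (hf : IsLosslessExpander f T) {e : V → ZMod 2} (he : 2 * hammingNorm e ≤ T)
    {a : ℕ → (J × B → ZMod 2) × (V → ZMod 2)}
    (h_zero : a 0 = (tannerMatrix f *ᵥ e, 0)) {n : ℕ} (hn : Fintype.card (J × B) ≤ n)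
    (h_step : ∀ i < n, FlipStep f (a i) (a (i + 1))) : (a n).2 = e := by
  have h_inv : ∀ i ≤ n, FlipInvariant f T e i (a i) := by
    intro i
    induction i with
    | zero => exact fun _ => h_zero ▸ flipInvariant_zero (by omega)
    | succ i ih => exact fun hi => (ih (by omega)).flipStep hf he (h_step i hi)
  exact (h_inv n le_rfl).eq_error hf hn

end BitFlip

/-! ### Programs built from expressions -/

/-- Arithmetic expressions in the registers and the memory. The decoders are written with these
expressions instead of single instructions. -/
inductive Arith : Type
  | lit (c : ℕ) : Arith
  | pid : Arith
  | var (d : ℕ) : Arith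
  | add (a b : Arith) : Arith
  | sub (a b : Arith) : Arith
  | mul (a b : Arith) : Arith
  | load (a : Arith) : Arith

namespace Arith

/-- The value of an expression for processor `p`, without reduction to a word. -/
def eval (p : ℕ) (R M : ℕ → ℕ) : Arith → ℕ
  | lit c => c
  | pid => p
  | var d => R d
  | add a b => a.eval p R M + b.eval p R M
  | sub a b => a.eval p R M - b.eval p R M
  | mul a b => a.eval p R M * b.eval p R M
  | load a => M (a.eval p R M)

/-- No overflow occurs in the evaluation of an expression. -/
def Fits (W p : ℕ) (R M : ℕ → ℕ) : Arith → Prop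
  | lit c => c < W
  | pid => p < W
  | var d => R d < W
  | add a b => a.Fits W p R M ∧ b.Fits W p R M ∧ a.eval p R M + b.eval p R M < W
  | sub a b => a.Fits W p R M ∧ b.Fits W p R M
  | mul a b => a.Fits W p R M ∧ b.Fits W p R M ∧ a.eval p R M * b.eval p R M < W
  | load a => a.Fits W p R M ∧ M (a.eval p R M) < W

/-- All registers of the expression have a number less than `n`. -/
def Below (n : ℕ) : Arith → Prop
  | lit _ => True
  | pid => True
  | var d => d < n
  | add a b => a.Below n ∧ b.Below n
  | sub a b => a.Below n ∧ b.Below n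
  | mul a b => a.Below n ∧ b.Below n
  | load a => a.Below n

/-- Evaluate an expression into register `k`, using only registers from `k` on. -/
def compile : Arith → ℕ → Prog
  | lit c, k => .const k c
  | pid, k => .procId k
  | var d, k => .seq (.const (k + 1) 0) (.add k d (k + 1))
  | add a b, k => .seq (a.compile k) (.seq (b.compile (k + 1)) (.add k k (k + 1)))
  | sub a b, k => .seq (a.compile k) (.seq (b.compile (k + 1)) (.sub k k (k + 1)))
  | mul a b, k => .seq (a.compile k) (.seq (b.compile (k + 1)) (.mul k k (k + 1)))
  | load a, k => .seq (a.compile k) (.load k k)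

/-- The number of steps of the evaluation. -/
def cost : Arith → ℕ
  | lit _ => 1
  | pid => 1
  | var _ => 2
  | add a b => a.cost + (b.cost + 1)
  | sub a b => a.cost + (b.cost + 1)
  | mul a b => a.cost + (b.cost + 1)
  | load a => a.cost + 1

theorem Fits.eval_lt {W p : ℕ} {R M : ℕ → ℕ} {e : Arith} (h : e.Fits W p R M) :
    e.eval p R M < W := by
  induction e with
  | lit c => exact h
  | pid => exact h
  | var d => exact h
  | add a b _ _ => exact h.2.2
  | sub a b iha _ => exact (Nat.sub_le _ _).trans_lt (iha h.1)
  | mul a b _ _ => exact h.2.2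
  | load a _ => exact h.2

theorem eval_congr {p n : ℕ} {R R' M : ℕ → ℕ} (hR : ∀ d < n, R' d = R d) {e : Arith}
    (he : e.Below n) : e.eval p R' M = e.eval p R M := by
  induction e with
  | lit c => rfl
  | pid => rfl
  | var d => exact hR d he
  | add a b iha ihb => simp only [eval, iha he.1, ihb he.2]
  | sub a b iha ihb => simp only [eval, iha he.1, ihb he.2]
  | mul a b iha ihb => simp only [eval, iha he.1, ihb he.2]
  | load a iha => simp only [eval, iha he]

theorem Fits.congr {W p n : ℕ} {R R' M : ℕ → ℕ} (hR : ∀ d < n, R' d = R d) {e : Arith}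
    (he : e.Below n) (h : e.Fits W p R M) : e.Fits W p R' M := by
  induction e with
  | lit c => exact h
  | pid => exact h
  | var d => simpa only [Fits, hR d he] using h
  | add a b iha ihb =>
    refine ⟨iha he.1 h.1, ihb he.2 h.2.1, ?_⟩
    rw [eval_congr hR he.1, eval_congr hR he.2]
    exact h.2.2
  | sub a b iha ihb => exact ⟨iha he.1 h.1, ihb he.2 h.2⟩
  | mul a b iha ihb =>
    refine ⟨iha he.1 h.1, ihb he.2 h.2.1, ?_⟩
    rw [eval_congr hR he.1, eval_congr hR he.2]
    exact h.2.2
  | load a iha => exact ⟨iha he h.1, by rw [eval_congr (e := a) hR he]; exact h.2⟩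

theorem Below.mono {n n' : ℕ} (hn : n ≤ n') {e : Arith} (he : e.Below n) : e.Below n' := by
  induction e with
  | lit c => trivial
  | pid => trivial
  | var d => exact lt_of_lt_of_le he hn
  | add a b iha ihb => exact ⟨iha he.1, ihb he.2⟩
  | sub a b iha ihb => exact ⟨iha he.1, ihb he.2⟩
  | mul a b iha ihb => exact ⟨iha he.1, ihb he.2⟩
  | load a iha => exact iha he

end Arith

theorem Config.setReg_reg {W P d : ℕ} {s : Config} {f : ℕ → ℕ} {p : ℕ} (hp : p < P) (x : ℕ) :
    (s.setReg W P d f).reg p x = if x = d then f p % W else s.reg p x := by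
  simp only [Config.setReg, hp, if_true, Function.update_apply]

theorem Config.setReg_mem (W P d : ℕ) (s : Config) (f : ℕ → ℕ) :
    (s.setReg W P d f).mem = s.mem := rfl

/-- The program computes `val p` into register `k` of each processor `p` in `t` steps and leaves the
memory and the registers below `k` unchanged. -/
structure Evaluates (W P : ℕ) (prog : Prog) (k : ℕ) (s : Config) (val : ℕ → ℕ) (t : ℕ) : Prop where
  mem : (prog.run W P s).1.mem = s.mem
  val : ∀ p < P, (prog.run W P s).1.reg p k = val p
  frame : ∀ p < P, ∀ d < k, (prog.run W P s).1.reg p d = s.reg p d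
  time : (prog.run W P s).2 = t

theorem Evaluates.binary {W P k : ℕ} {s : Config} {a b o : Prog} {va vb : ℕ → ℕ} {ta tb : ℕ}
    {op : ℕ → ℕ → ℕ} (ho : ∀ s, o.run W P s =
      (s.setReg W P k fun p => op (s.reg p k) (s.reg p (k + 1)), 1))
    (ha : Evaluates W P a k s va ta) (hb : Evaluates W P b (k + 1) (a.run W P s).1 vb tb)
    (hlt : ∀ p < P, op (va p) (vb p) < W) :
    Evaluates W P (.seq a (.seq b o)) k s (fun p => op (va p) (vb p)) (ta + (tb + 1)) := by
  have h_run : (Prog.seq a (.seq b o)).run W P s =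
      ((b.run W P (a.run W P s).1).1.setReg W P k fun p =>
        op ((b.run W P (a.run W P s).1).1.reg p k) ((b.run W P (a.run W P s).1).1.reg p (k + 1)),
        (a.run W P s).2 + ((b.run W P (a.run W P s).1).2 + 1)) := by
    simp only [Prog.run, ho]
  constructor
  · rw [h_run, Config.setReg_mem, hb.mem, ha.mem]
  · intro p hp
    rw [h_run, Config.setReg_reg hp, if_pos rfl, hb.val p hp, hb.frame p hp k (by omega),
      ha.val p hp, Nat.mod_eq_of_lt (hlt p hp)]
  · intro p hp d hd
    rw [h_run, Config.setReg_reg hp, if_neg (by omega), hb.frame p hp d (by omega),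
      ha.frame p hp d hd]
  · rw [h_run, ha.time, hb.time]

theorem Evaluates.congr {W P k : ℕ} {s : Config} {a : Prog} {v v' : ℕ → ℕ} {t : ℕ}
    (h : Evaluates W P a k s v t) (hv : ∀ p < P, v p = v' p) : Evaluates W P a k s v' t :=
  ⟨h.mem, fun p hp => (h.val p hp).trans (hv p hp), h.frame, h.time⟩

theorem evaluates_const {W P k : ℕ} {s : Config} {prog : Prog} {v : ℕ → ℕ}
    (h_run : prog.run W P s = (s.setReg W P k v, 1)) (hlt : ∀ p < P, v p < W) :
    Evaluates W P prog k s v 1 := by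
  refine ⟨by rw [h_run, Config.setReg_mem], fun p hp => ?_, fun p hp d hd => ?_, by rw [h_run]⟩
  · rw [h_run, Config.setReg_reg hp, if_pos rfl, Nat.mod_eq_of_lt (hlt p hp)]
  · rw [h_run, Config.setReg_reg hp, if_neg hd.ne]

theorem evaluates_var {W P k d : ℕ} {s : Config} (hd : d < k) (hlt : ∀ p < P, s.reg p d < W) :
    Evaluates W P (.seq (.const (k + 1) 0) (.add k d (k + 1))) k s (fun p => s.reg p d) 2 := by
  refine ⟨rfl, fun p hp => ?_, fun p hp d' hd' => ?_, rfl⟩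
  · refine (Config.setReg_reg hp _).trans ((if_pos rfl).trans ?_)
    change ((Config.setReg W P s (k + 1) fun _ => 0).reg p d +
      (Config.setReg W P s (k + 1) fun _ => 0).reg p (k + 1)) % W = _
    rw [Config.setReg_reg hp, Config.setReg_reg hp, if_neg (by omega), if_pos rfl,
      Nat.zero_mod, add_zero, Nat.mod_eq_of_lt (hlt p hp)]
  · refine (Config.setReg_reg hp _).trans ((if_neg (by omega)).trans ?_)
    exact (Config.setReg_reg hp _).trans (if_neg (by omega))

theorem Evaluates.load {W P k : ℕ} {s : Config} {a : Prog} {v : ℕ → ℕ} {t : ℕ}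
    (h : Evaluates W P a k s v t) (hlt : ∀ p < P, s.mem (v p) < W) :
    Evaluates W P (.seq a (.load k k)) k s (fun p => s.mem (v p)) (t + 1) := by
  refine ⟨h.mem, fun p hp => ?_, fun p hp d hd => ?_, ?_⟩
  · refine (Config.setReg_reg hp _).trans ((if_pos rfl).trans ?_)
    rw [h.mem, h.val p hp, Nat.mod_eq_of_lt (hlt p hp)]
  · exact (Config.setReg_reg hp _).trans ((if_neg (by omega)).trans (h.frame p hp d hd))
  · change _ + 1 = _
    rw [h.time]

namespace Arith

/-- The compiled expression computes its value from every configuration in which no overflow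
occurs. -/
def CompilesCorrectly (W P : ℕ) (e : Arith) : Prop :=
  ∀ (k : ℕ) (s : Config), e.Below k → (∀ p < P, e.Fits W p (s.reg p) s.mem) →
    Evaluates W P (e.compile k) k s (fun p => e.eval p (s.reg p) s.mem) e.cost

theorem CompilesCorrectly.binary {W P k : ℕ} {a b : Arith} (iha : a.CompilesCorrectly W P)
    (ihb : b.CompilesCorrectly W P) {s : Config} (ha : a.Below k) (hb : b.Below k)
    (hfa : ∀ p < P, a.Fits W p (s.reg p) s.mem) (hfb : ∀ p < P, b.Fits W p (s.reg p) s.mem)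
    {o : Prog} {op : ℕ → ℕ → ℕ} (ho : ∀ s, o.run W P s =
      (s.setReg W P k fun p => op (s.reg p k) (s.reg p (k + 1)), 1))
    (hlt : ∀ p < P, op (a.eval p (s.reg p) s.mem) (b.eval p (s.reg p) s.mem) < W) :
    Evaluates W P (.seq (a.compile k) (.seq (b.compile (k + 1)) o)) k s
      (fun p => op (a.eval p (s.reg p) s.mem) (b.eval p (s.reg p) s.mem))
      (a.cost + (b.cost + 1)) := by
  have h_left := iha k s ha hfa
  have h_right := ihb (k + 1) ((a.compile k).run W P s).1 (hb.mono (by omega)) fun p hp => by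
    rw [h_left.mem]
    exact (hfb p hp).congr (h_left.frame p hp) hb
  rw [h_left.mem] at h_right
  exact h_left.binary ho (h_right.congr fun p hp => eval_congr (h_left.frame p hp) hb) hlt

theorem compilesCorrectly (W P : ℕ) (e : Arith) : e.CompilesCorrectly W P := by
  induction e with
  | lit c => exact fun k s _ hf => evaluates_const rfl hf
  | pid => exact fun k s _ hf => evaluates_const rfl hf
  | var d => exact fun k s hd hf => evaluates_var hd hf
  | add a b iha ihb =>
    exact fun k s he hf => iha.binary ihb he.1 he.2 (fun p hp => (hf p hp).1)
      (fun p hp => (hf p hp).2.1) (op := (· + ·)) (fun _ => rfl) fun p hp => (hf p hp).eval_lt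
  | sub a b iha ihb =>
    exact fun k s he hf => iha.binary ihb he.1 he.2 (fun p hp => (hf p hp).1)
      (fun p hp => (hf p hp).2) (op := (· - ·)) (fun _ => rfl) fun p hp => (hf p hp).eval_lt
  | mul a b iha ihb =>
    exact fun k s he hf => iha.binary ihb he.1 he.2 (fun p hp => (hf p hp).1)
      (fun p hp => (hf p hp).2.1) (op := (· * ·)) (fun _ => rfl) fun p hp => (hf p hp).eval_lt
  | load a iha =>
    exact fun k s he hf => (iha k s he fun p hp => (hf p hp).1).load fun p hp => (hf p hp).2

end Arith

/-- `R_d := e` for a register `d < 16`. The registers from `16` on are reserved for the evaluation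
of expressions. -/
def assign (d : ℕ) (e : Arith) : Prog :=
  .seq (e.compile 16) (.seq (.const 17 0) (.add d 16 17))

/-- `memory[a] := b`. -/
def write (a b : Arith) : Prog :=
  .seq (a.compile 16) (.seq (b.compile 17) (.store 16 17))

/-- Simultaneous writing; the processor with the smallest number succeeds. -/
def parWrite (P : ℕ) (addr val : ℕ → ℕ) (M : ℕ → ℕ) : ℕ → ℕ := fun x =>
  match (List.range P).find? (fun p => addr p = x) with
  | some p => val p
  | none => M x

theorem parWrite_cases (P : ℕ) (addr val M : ℕ → ℕ) (x : ℕ) :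
    (∃ p < P, addr p = x ∧ parWrite P addr val M x = val p) ∨
      ((∀ p < P, addr p ≠ x) ∧ parWrite P addr val M x = M x) := by
  unfold parWrite
  cases h : (List.range P).find? (fun p => addr p = x) with
  | some p =>
    left
    have h1 := List.mem_of_find?_eq_some h
    have h2 := List.find?_some h
    exact ⟨p, List.mem_range.1 h1, by simpa using h2, rfl⟩
  | none =>
    right
    rw [List.find?_eq_none] at h
    exact ⟨fun p hp => by simpa using h p (List.mem_range.2 hp), rfl⟩

theorem parWrite_congr {P : ℕ} {addr addr' val val' : ℕ → ℕ} (M : ℕ → ℕ)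
    (ha : ∀ p < P, addr p = addr' p) (hv : ∀ p < P, val p = val' p) :
    parWrite P addr val M = parWrite P addr' val' M := by
  have h : ∀ x, (List.range P).find? (fun p => decide (addr p = x)) =
      (List.range P).find? (fun p => decide (addr' p = x)) := fun x =>
    List.find?_congr fun p hp => by rw [ha p (List.mem_range.1 hp)]
  funext x
  unfold parWrite
  rw [h x]
  cases h_find : (List.range P).find? (fun p => decide (addr' p = x)) with
  | some p => exact hv p (List.mem_range.1 (List.mem_of_find?_eq_some h_find))
  | none => rfl

theorem parWrite_same {P : ℕ} (hP : 0 < P) {addr val M : ℕ → ℕ} {a b : ℕ}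
    (ha : ∀ p < P, addr p = a) (hv : ∀ p < P, val p = b) :
    parWrite P addr val M = Function.update M a b := by
  funext x
  rw [Function.update_apply]
  rcases parWrite_cases P addr val M x with ⟨p, hp, h1, h2⟩ | ⟨h1, h2⟩
  · rw [h2, hv p hp, if_pos (by rw [← h1, ha p hp])]
  · rw [h2, if_neg fun h => h1 0 hP (by rw [ha 0 hP, h])]

open Classical in
/-- The memory `F` on the addresses in `D`, and `M` elsewhere. -/
noncomputable def overlay (D : ℕ → Prop) (F M : ℕ → ℕ) : ℕ → ℕ := fun x => if D x then F x else M x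

theorem overlay_pos {D : ℕ → Prop} {F M : ℕ → ℕ} {x : ℕ} (h : D x) : overlay D F M x = F x :=
  if_pos h

theorem overlay_neg {D : ℕ → Prop} {F M : ℕ → ℕ} {x : ℕ} (h : ¬ D x) : overlay D F M x = M x :=
  if_neg h

theorem overlay_false (F M : ℕ → ℕ) : overlay (fun _ => False) F M = M := funext fun _ => if_neg id

theorem parWrite_overlay {P : ℕ} {addr val F M : ℕ → ℕ} {D D' : ℕ → Prop}
    (hv : ∀ p < P, val p = F (addr p)) (hD : ∀ x, D' x ↔ D x ∨ ∃ p < P, addr p = x) :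
    parWrite P addr val (overlay D F M) = overlay D' F M := by
  funext x
  rcases parWrite_cases P addr val (overlay D F M) x with ⟨p, hp, h1, h2⟩ | ⟨h1, h2⟩
  · rw [h2, hv p hp, h1, overlay_pos ((hD x).2 (Or.inr ⟨p, hp, h1⟩))]
  · rw [h2]
    by_cases h : D x
    · rw [overlay_pos h, overlay_pos ((hD x).2 (Or.inl h))]
    · rw [overlay_neg h, overlay_neg]
      rw [hD]
      rintro (h3 | ⟨p, hp, h3⟩)
      · exact h h3
      · exact h1 p hp h3

/-- The two configurations agree on the memory and on the registers below `16`. -/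
def Sim (P : ℕ) (s σ : Config) : Prop :=
  s.mem = σ.mem ∧ ∀ p < P, ∀ d < 16, s.reg p d = σ.reg p d

/-- Started in the configuration `σ`, the program ends in a configuration and after a number of
steps with the property `Q`, up to the contents of registers from `16` on. -/
def wp (W P : ℕ) (prog : Prog) (σ : Config) (Q : Config → ℕ → Prop) : Prop :=
  ∀ s, Sim P s σ → ∃ σ', Sim P (prog.run W P s).1 σ' ∧ Q σ' (prog.run W P s).2

/-- The configuration after an assignment. -/
def Config.assign (σ : Config) (d : ℕ) (e : Arith) : Config where
  reg := fun p => Function.update (σ.reg p) d (e.eval p (σ.reg p) σ.mem)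
  mem := σ.mem

/-- The configuration after writing to the memory. -/
def Config.write (P : ℕ) (σ : Config) (a b : Arith) : Config where
  reg := σ.reg
  mem := parWrite P (fun p => a.eval p (σ.reg p) σ.mem) (fun p => b.eval p (σ.reg p) σ.mem) σ.mem

theorem Config.write_reg (P : ℕ) (σ : Config) (a b : Arith) : (σ.write P a b).reg = σ.reg := rfl

theorem Config.assign_reg (σ : Config) (d : ℕ) (e : Arith) (p x : ℕ) :
    (σ.assign d e).reg p x = if x = d then e.eval p (σ.reg p) σ.mem else σ.reg p x :=
  Function.update_apply _ _ _ _

theorem Config.assign_mem (σ : Config) (d : ℕ) (e : Arith) : (σ.assign d e).mem = σ.mem := rfl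

section WeakestPreconditions

variable {W P : ℕ}

theorem wp_mono {prog : Prog} {σ : Config} {Q Q' : Config → ℕ → Prop}
    (h : wp W P prog σ Q) (hQ : ∀ σ' t, Q σ' t → Q' σ' t) : wp W P prog σ Q' := fun s hs =>
  let ⟨σ', h1, h2⟩ := h s hs
  ⟨σ', h1, hQ _ _ h2⟩

theorem wp_seq {a b : Prog} {σ : Config} {Q : Config → ℕ → Prop}
    (h : wp W P a σ fun σ' t => wp W P b σ' fun σ'' t' => Q σ'' (t + t')) :
    wp W P (.seq a b) σ Q := fun s hs =>
  let ⟨_, h1, h2⟩ := h s hs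
  h2 _ h1

theorem wp_assign {d : ℕ} {e : Arith} {σ : Config} {Q : Config → ℕ → Prop} (he : e.Below 16)
    (hf : ∀ p < P, e.Fits W p (σ.reg p) σ.mem)
    (hQ : Q (σ.assign d e) (e.cost + 2)) : wp W P (assign d e) σ Q := by
  intro s hs
  have h_e := e.compilesCorrectly W P 16 s he fun p hp => by
    rw [hs.1]
    exact (hf p hp).congr (hs.2 p hp) he
  refine ⟨σ.assign d e, ⟨h_e.mem.trans hs.1, fun p hp x hx => ?_⟩, ?_⟩
  · refine (Config.setReg_reg hp x).trans ?_
    rw [Config.assign_reg]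
    by_cases hxd : x = d
    · rw [if_pos hxd, if_pos hxd]
      change ((Config.setReg W P ((e.compile 16).run W P s).1 17 fun _ => 0).reg p 16 +
        (Config.setReg W P ((e.compile 16).run W P s).1 17 fun _ => 0).reg p 17) % W = _
      rw [Config.setReg_reg hp, Config.setReg_reg hp, if_neg (by omega), if_pos rfl,
        Nat.zero_mod, add_zero, h_e.val p hp, hs.1, Arith.eval_congr (hs.2 p hp) he]
      exact Nat.mod_eq_of_lt (hf p hp).eval_lt
    · rw [if_neg hxd, if_neg hxd]
      refine (Config.setReg_reg hp x).trans ?_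
      rw [if_neg (by omega), h_e.frame p hp x hx, hs.2 p hp x hx]
  · change Q _ (_ + 2)
    rw [h_e.time]
    exact hQ

theorem wp_write {a b : Arith} {σ : Config} {Q : Config → ℕ → Prop} (ha : a.Below 16)
    (hb : b.Below 16) (hfa : ∀ p < P, a.Fits W p (σ.reg p) σ.mem)
    (hfb : ∀ p < P, b.Fits W p (σ.reg p) σ.mem)
    (hQ : Q (σ.write P a b) (a.cost + (b.cost + 1))) : wp W P (write a b) σ Q := by
  intro s hs
  have h_a := a.compilesCorrectly W P 16 s ha fun p hp => by
    rw [hs.1]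
    exact (hfa p hp).congr (hs.2 p hp) ha
  have h_reg : ∀ p < P, ∀ d < 16, ((a.compile 16).run W P s).1.reg p d = σ.reg p d :=
    fun p hp d hd => (h_a.frame p hp d hd).trans (hs.2 p hp d hd)
  have h_b := b.compilesCorrectly W P 17 ((a.compile 16).run W P s).1
    (hb.mono (by omega)) fun p hp => by
      rw [h_a.mem, hs.1]
      exact (hfb p hp).congr (h_reg p hp) hb
  refine ⟨σ.write P a b, ⟨?_, fun p hp x hx => ?_⟩, ?_⟩
  · change parWrite P _ _ _ = parWrite P _ _ _
    rw [h_b.mem, h_a.mem, hs.1]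
    refine parWrite_congr _ (fun p hp => ?_) fun p hp => ?_
    · rw [h_b.frame p hp 16 (by omega), h_a.val p hp, hs.1, Arith.eval_congr (hs.2 p hp) ha]
    · rw [h_b.val p hp, h_a.mem, hs.1, Arith.eval_congr (h_reg p hp) hb]
  · exact (h_b.frame p hp x (by omega)).trans (h_reg p hp x hx)
  · change Q _ (_ + (_ + 1))
    rw [h_a.time, h_b.time]
    exact hQ

theorem exists_sim_iterate {body : Prog} {σ s : Config} {n T : ℕ} {I : ℕ → Config → Prop}
    (hs : Sim P s σ) (h0 : I 0 σ)
    (hI : ∀ i < n, ∀ σ', I i σ' → wp W P body σ' fun σ'' t => I (i + 1) σ'' ∧ t ≤ T) {i : ℕ}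
    (hi : i ≤ n) :
    ∃ σ', Sim P ((fun q : Config × ℕ => ((body.run W P q.1).1,
        q.2 + (body.run W P q.1).2 + 1))^[i] (s, 1)).1 σ' ∧ I i σ' ∧
      ((fun q : Config × ℕ => ((body.run W P q.1).1,
        q.2 + (body.run W P q.1).2 + 1))^[i] (s, 1)).2 ≤ 1 + i * (T + 1) := by
  induction i with
  | zero => exact ⟨σ, hs, h0, by simp⟩
  | succ i ih =>
    obtain ⟨σ', h_sim, h_inv, h_time⟩ := ih (by omega)
    obtain ⟨σ'', h_sim', h_inv', h_time'⟩ := hI i (by omega) σ' h_inv _ h_sim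
    rw [Function.iterate_succ_apply']
    refine ⟨σ'', h_sim', h_inv', ?_⟩
    rw [add_one_mul]
    change _ + _ + 1 ≤ _
    omega

theorem wp_loop {a : ℕ} {body : Prog} {σ : Config} {Q : Config → ℕ → Prop} (n T : ℕ)
    (I : ℕ → Config → Prop) (hP : 0 < P) (ha : a < 16) (hn : σ.reg 0 a = n) (h0 : I 0 σ)
    (hI : ∀ i < n, ∀ σ', I i σ' → wp W P body σ' fun σ'' t => I (i + 1) σ'' ∧ t ≤ T)
    (hQ : ∀ σ' t, I n σ' → t ≤ 1 + n * (T + 1) → Q σ' t) : wp W P (.loop a body) σ Q := by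
  intro s hs
  obtain ⟨σ', h_sim, h_inv, h_time⟩ := exists_sim_iterate hs h0 hI le_rfl
  obtain rfl : s.reg 0 a = n := (hs.2 0 hP a ha).trans hn
  exact ⟨σ', h_sim, hQ _ _ h_inv h_time⟩

end WeakestPreconditions

/-! ### The decoder programs -/

instance : Add Arith := ⟨Arith.add⟩
instance : Sub Arith := ⟨Arith.sub⟩
instance : Mul Arith := ⟨Arith.mul⟩

namespace Arith

variable {W p n : ℕ} {R M : ℕ → ℕ} (a b : Arith)

theorem eval_add : (a + b).eval p R M = a.eval p R M + b.eval p R M := rfl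
theorem eval_sub : (a - b).eval p R M = a.eval p R M - b.eval p R M := rfl
theorem eval_mul : (a * b).eval p R M = a.eval p R M * b.eval p R M := rfl
theorem fits_add : (a + b).Fits W p R M ↔
    a.Fits W p R M ∧ b.Fits W p R M ∧ a.eval p R M + b.eval p R M < W := Iff.rfl
theorem fits_sub : (a - b).Fits W p R M ↔ a.Fits W p R M ∧ b.Fits W p R M := Iff.rfl
theorem fits_mul : (a * b).Fits W p R M ↔
    a.Fits W p R M ∧ b.Fits W p R M ∧ a.eval p R M * b.eval p R M < W := Iff.rfl
theorem below_add : (a + b).Below n ↔ a.Below n ∧ b.Below n := Iff.rfl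
theorem below_sub : (a - b).Below n ↔ a.Below n ∧ b.Below n := Iff.rfl
theorem below_mul : (a * b).Below n ↔ a.Below n ∧ b.Below n := Iff.rfl
theorem cost_add : (a + b).cost = a.cost + (b.cost + 1) := rfl
theorem cost_sub : (a - b).cost = a.cost + (b.cost + 1) := rfl
theorem cost_mul : (a * b).cost = a.cost + (b.cost + 1) := rfl

end Arith

attribute [simp] Arith.eval Arith.Fits Arith.Below Arith.cost Arith.eval_add Arith.eval_sub
  Arith.eval_mul Arith.fits_add Arith.fits_sub Arith.fits_mul Arith.below_add Arith.below_sub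
  Arith.below_mul Arith.cost_add Arith.cost_sub Arith.cost_mul Config.assign_reg Config.assign_mem
  Config.write_reg

open PCCSS.Arith (lit var pid)

/-- The address of the `X`-part of the syndrome. -/
def addrSX (m q : ℕ) : ℕ := 3 + 8 * q * m

/-- The address of the `Z`-part of the syndrome. -/
def addrSZ (m q : ℕ) : ℕ := addrSX m q + 8 * q

/-- The address of the `X`-part of the output. -/
def addrX (n₀ m q : ℕ) : ℕ := addrSZ m q + m * (n₀ - 1)

/-- The address of the `Z`-part of the output. -/
def addrZ (n₀ m q : ℕ) : ℕ := addrX n₀ m q + m * n₀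

/-- The address of the table of the checks of each variable. -/
def addrT (n₀ m q : ℕ) : ℕ := addrZ n₀ m q + m * n₀

theorem three_le_addrSX (m q : ℕ) : 3 ≤ addrSX m q := Nat.le_add_right _ _

theorem addrSX_le_addrSZ (m q : ℕ) : addrSX m q ≤ addrSZ m q := Nat.le_add_right _ _

theorem addrSZ_le_addrX (n₀ m q : ℕ) : addrSZ m q ≤ addrX n₀ m q := Nat.le_add_right _ _

theorem addrX_le_addrT (n₀ m q : ℕ) : addrX n₀ m q ≤ addrT n₀ m q :=
  (Nat.le_add_right _ _).trans (Nat.le_add_right _ _)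

theorem addrSZ_le_addrT (n₀ m q : ℕ) : addrSZ m q ≤ addrT n₀ m q :=
  (addrSZ_le_addrX n₀ m q).trans (addrX_le_addrT n₀ m q)

/-- Load `n₀`, `m` and `r` into the registers `0`, `1`, `2`, and the constant `8` into the
register `15`. -/
def loadParams : Prog :=
  .seq (assign 0 (.load (lit 0))) <| .seq (assign 1 (.load (lit 1))) <|
  .seq (assign 2 (.load (lit 2))) (assign 15 (lit 8))

/-- Put `r / 8` into the register `3`. The machine has no division: the program counts the numbers
`i < r` with `8 * i < r`. -/
def divideByEight : Prog :=
  .seq (assign 3 (lit 0)) <| .seq (assign 5 (lit 0)) <| .loop 2 <|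
    .seq (assign 3 (var 3 + (lit 1 - (lit 1 - (var 2 - var 15 * var 5)))))
      (assign 5 (var 5 + lit 1))

/-- Put the addresses of the output, of the table and of the syndrome into the registers `10`, …,
`14`. -/
def layOut : Prog :=
  .seq (assign 12 (lit 3 + var 2 * var 1)) <| .seq (assign 13 (var 12 + var 2)) <|
  .seq (assign 10 (var 13 + var 1 * (var 0 - lit 1))) <|
  .seq (assign 14 (var 10 + var 1 * var 0)) (assign 11 (var 14 + var 1 * var 0))

/-- Initialize the registers that stay constant during the decoding. -/
def setup : Prog := .seq loadParams <| .seq divideByEight layOut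

/-- Run `body` for all values less than `m` of register `4`, in parallel or one after another. -/
def forEach (par : Bool) (body : Prog) : Prog :=
  if par then .seq (assign 4 pid) body
  else .seq (assign 4 (lit 0)) (.loop 1 (.seq body (assign 4 (var 4 + lit 1))))

/-- Put the number of the check of the variable `R₄` in the `R₇`-th group of checks into the
register `6`: the position of the only nonzero entry in the variable's column of that group. -/
def findCheck : Prog :=
  .seq (assign 6 (lit 0)) <| .seq (assign 5 (lit 0)) <| .loop 3 <|
    .seq (assign 6 (var 6 + var 5 * .load (lit 3 + (var 7 * var 3 + var 5) * var 1 + var 4)))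
      (assign 5 (var 5 + lit 1))

/-- Put the addresses of the checks of the variable `R₄` into the table. -/
def tabulate : Prog :=
  .seq (assign 7 (lit 0)) <| .loop 15 <| .seq findCheck <|
    .seq (write (var 11 + var 4 * var 15 + var 7) (var 12 + var 7 * var 3 + var 6))
      (assign 7 (var 7 + lit 1))

/-- Count the unsatisfied checks of the variable `R₄` in the register `6`. -/
def countUnsat : Prog :=
  .seq (assign 6 (lit 0)) <| .seq (assign 7 (lit 0)) <| .loop 15 <|
    .seq (assign 6 (var 6 + .load (.load (var 11 + var 4 * var 15 + var 7))))
      (assign 7 (var 7 + lit 1))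

/-- The address `1` if twice the number in the register `6` exceeds `8`, and `2` otherwise. -/
def ballot : Arith := lit 2 - (lit 1 - (lit 1 - (var 6 + var 6 - var 15)))

/-- Write the number of the variable `R₄` to the cell `1` if most of its checks are unsatisfied, and
to the cell `2` otherwise. -/
def vote : Prog := .seq countUnsat (write ballot (var 4))

/-- Complement the syndrome bits of the checks of the variable `R₉`. -/
def complementChecks : Prog :=
  .seq (assign 7 (lit 0)) <| .loop 15 <|
    .seq (write (.load (var 11 + var 9 * var 15 + var 7))
        (lit 1 - .load (.load (var 11 + var 9 * var 15 + var 7))))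
      (assign 7 (var 7 + lit 1))

/-- Flip the variable whose number is in the cell `1`. -/
def flip : Prog :=
  .seq (assign 9 (.load (lit 1))) <| .seq complementChecks <|
  write (var 10 + var 9 * var 0) (.load (var 10 + var 9 * var 0) + lit 1)

/-- One round of bit flipping. The cell `1` is initialized to `m`, the number of a dummy variable
that is flipped if no variable has voted for itself. -/
def round (par : Bool) : Prog :=
  .seq (write (lit 1) (var 1)) <| .seq (forEach par vote) flip

/-- Count the unsatisfied checks of the `R₄`-th block in the register `6`. -/
def countBlock : Prog :=
  .seq (assign 6 (lit 0)) <| .seq (assign 5 (lit 0)) <| .loop 8 <|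
    .seq (assign 6 (var 6 + .load (var 13 + var 4 * var 8 + var 5)))
      (assign 5 (var 5 + lit 1))

/-- Write the syndrome of the `R₄`-th block, shifted by `R₉`, to the output. -/
def writeBlock : Prog :=
  .seq (assign 5 (lit 0)) <| .loop 8 <|
    .seq (write (var 14 + var 4 * var 0 + var 5) (.load (var 13 + var 4 * var 8 + var 5) + var 9))
      (assign 5 (var 5 + lit 1))

/-- Majority decoding of the `Z`-errors in the `R₄`-th block. -/
def majority : Prog :=
  .seq (assign 8 (var 0 - lit 1)) <| .seq countBlock <|
  .seq (assign 9 (lit 1 - (lit 1 - (var 6 + var 6 - var 0)))) <| .seq writeBlock <|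
  write (var 14 + var 4 * var 0 + var 8) (var 9)

/-- The decoder, in its parallel and in its sequential version. -/
def decoder (par : Bool) : Prog :=
  .seq setup <| .seq (forEach par tabulate) <| .seq (.loop 2 (round par)) (forEach par majority)

/-! ### Verification of the decoder programs -/

/-- The registers contain the parameters, the addresses and the constant `8`, as after `setup`. -/
structure Env (P n₀ m q : ℕ) (σ : Config) : Prop where
  n₀_eq : ∀ p < P, σ.reg p 0 = n₀
  m_eq : ∀ p < P, σ.reg p 1 = m
  r_eq : ∀ p < P, σ.reg p 2 = 8 * q
  q_eq : ∀ p < P, σ.reg p 3 = q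
  addrX_eq : ∀ p < P, σ.reg p 10 = addrX n₀ m q
  addrT_eq : ∀ p < P, σ.reg p 11 = addrT n₀ m q
  addrSX_eq : ∀ p < P, σ.reg p 12 = addrSX m q
  addrSZ_eq : ∀ p < P, σ.reg p 13 = addrSZ m q
  addrZ_eq : ∀ p < P, σ.reg p 14 = addrZ n₀ m q
  eight_eq : ∀ p < P, σ.reg p 15 = 8

/-- Words are large enough for all addresses. -/
def Roomy (W n₀ m q : ℕ) : Prop := 100 * (addrT n₀ m q + m + n₀ + q + 100) ≤ W

/-- The number of processors. -/
def processors (par : Bool) (m : ℕ) : ℕ := if par then m else 1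

/-- The number of items that each processor deals with. -/
def repetitions (par : Bool) (m : ℕ) : ℕ := if par then 1 else m

section Verification

variable {W P n₀ m q : ℕ}

theorem Env.assign {σ : Config} (h : Env P n₀ m q σ) {d : ℕ} (h4 : 4 ≤ d) (h10 : d < 10)
    (e : Arith) : Env P n₀ m q (σ.assign d e) := by
  have h_frame : ∀ p x, (x < 4 ∨ 10 ≤ x) → (σ.assign d e).reg p x = σ.reg p x := fun p x hx => by
    rw [Config.assign_reg, if_neg (by omega)]
  constructor <;> intro p hp <;> rw [h_frame _ _ (by omega)]
  exacts [h.n₀_eq p hp, h.m_eq p hp, h.r_eq p hp, h.q_eq p hp, h.addrX_eq p hp, h.addrT_eq p hp,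
    h.addrSX_eq p hp, h.addrSZ_eq p hp, h.addrZ_eq p hp, h.eight_eq p hp]

theorem Env.write {σ : Config} (h : Env P n₀ m q σ) (a b : Arith) :
    Env P n₀ m q (σ.write P a b) :=
  ⟨h.n₀_eq, h.m_eq, h.r_eq, h.q_eq, h.addrX_eq, h.addrT_eq, h.addrSX_eq, h.addrSZ_eq, h.addrZ_eq,
    h.eight_eq⟩

theorem wp_loadParams {r : ℕ} {σ : Config} (h_n₀ : σ.mem 0 = n₀) (h_m : σ.mem 1 = m)
    (h_r : σ.mem 2 = r) (hW : n₀ < W ∧ m < W ∧ r < W ∧ 8 < W) :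
    wp W P loadParams σ fun σ' t => (∀ p, σ'.reg p 0 = n₀ ∧ σ'.reg p 1 = m ∧ σ'.reg p 2 = r ∧
      σ'.reg p 15 = 8) ∧ σ'.mem = σ.mem ∧ t ≤ 20 := by
  refine wp_seq (wp_assign (by simp) (fun p _ => by simp; omega) ?_)
  refine wp_seq (wp_assign (by simp) (fun p _ => by simp; omega) ?_)
  refine wp_seq (wp_assign (by simp) (fun p _ => by simp; omega) ?_)
  refine wp_assign (by simp) (fun p _ => by simp; omega) ⟨fun p => ?_, rfl, by simp⟩
  simp [h_n₀, h_m, h_r]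

theorem wp_divideByEight (hP : 0 < P) (hW : 64 * q + 9 < W) {σ : Config}
    (hσ : ∀ p < P, σ.reg p 0 = n₀ ∧ σ.reg p 1 = m ∧ σ.reg p 2 = 8 * q ∧ σ.reg p 15 = 8) :
    wp W P divideByEight σ fun σ' t => (∀ p < P, σ'.reg p 0 = n₀ ∧ σ'.reg p 1 = m ∧
      σ'.reg p 2 = 8 * q ∧ σ'.reg p 3 = q ∧ σ'.reg p 15 = 8) ∧ σ'.mem = σ.mem ∧
      t ≤ 7 + 8 * q * 30 := by
  refine wp_seq (wp_assign (by simp) (fun p _ => by simp; omega) ?_)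
  refine wp_seq (wp_assign (by simp) (fun p _ => by simp; omega) ?_)
  refine wp_loop (8 * q) 29 (fun i σ' => σ'.mem = σ.mem ∧ ∀ p < P, σ'.reg p 0 = n₀ ∧
    σ'.reg p 1 = m ∧ σ'.reg p 2 = 8 * q ∧ σ'.reg p 3 = min i q ∧ σ'.reg p 5 = i ∧
    σ'.reg p 15 = 8) hP (by norm_num) (by simpa using (hσ 0 hP).2.2.1)
    ⟨rfl, fun p hp => by simpa using hσ p hp⟩ ?_ ?_
  · rintro i hi σ' ⟨h_mem, h_reg⟩
    refine wp_seq (wp_assign (by simp) (fun p hp => ?_) (wp_assign (by simp) (fun p hp => ?_) ?_))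
    · obtain ⟨-, -, h_r, h_count, h_i, h_eight⟩ := h_reg p hp
      simp [h_r, h_count, h_i, h_eight]
      omega
    · obtain ⟨-, -, -, -, h_i, -⟩ := h_reg p hp
      simp [h_i]
      omega
    · refine ⟨⟨h_mem, fun p hp => ?_⟩, by simp⟩
      obtain ⟨h_n₀, h_m, h_r, h_count, h_i, h_eight⟩ := h_reg p hp
      simp [h_n₀, h_m, h_r, h_count, h_i, h_eight]
      omega
  · rintro σ' t ⟨h_mem, h_reg⟩ ht
    refine ⟨fun p hp => ?_, h_mem, by simp; omega⟩
    obtain ⟨h_n₀, h_m, h_r, h_count, -, h_eight⟩ := h_reg p hp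
    exact ⟨h_n₀, h_m, h_r, h_count.trans (by omega), h_eight⟩

theorem wp_layOut (hW : Roomy W n₀ m q) {σ : Config}
    (hσ : ∀ p < P, σ.reg p 0 = n₀ ∧ σ.reg p 1 = m ∧ σ.reg p 2 = 8 * q ∧ σ.reg p 3 = q ∧
      σ.reg p 15 = 8) :
    wp W P layOut σ fun σ' t => Env P n₀ m q σ' ∧ σ'.mem = σ.mem ∧ t ≤ 50 := by
  simp only [Roomy, addrT, addrZ, addrX, addrSZ, addrSX] at hW
  have h_n₀ := fun p hp => (hσ p hp).1
  have h_m := fun p hp => (hσ p hp).2.1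
  have h_r := fun p hp => (hσ p hp).2.2.1
  refine wp_seq (wp_assign (by simp) (fun p hp => ?_) ?_)
  · simp [h_m p hp, h_r p hp]
    omega
  refine wp_seq (wp_assign (by simp) (fun p hp => ?_) ?_)
  · simp [h_m p hp, h_r p hp]
    omega
  refine wp_seq (wp_assign (by simp) (fun p hp => ?_) ?_)
  · simp [h_n₀ p hp, h_m p hp, h_r p hp]
    omega
  refine wp_seq (wp_assign (by simp) (fun p hp => ?_) ?_)
  · simp [h_n₀ p hp, h_m p hp, h_r p hp]
    omega
  refine wp_assign (by simp) (fun p hp => ?_) ⟨?_, rfl, by simp⟩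
  · simp [h_n₀ p hp, h_m p hp, h_r p hp]
    omega
  · constructor <;> intro p hp <;>
      simp [addrT, addrZ, addrX, addrSZ, addrSX, hσ p hp]

theorem wp_setup (hP : 0 < P) (hW : Roomy W n₀ m q) {σ : Config} (h_n₀ : σ.mem 0 = n₀)
    (h_m : σ.mem 1 = m) (h_r : σ.mem 2 = 8 * q) :
    wp W P setup σ fun σ' t => Env P n₀ m q σ' ∧ σ'.mem = σ.mem ∧ t ≤ 100 + 8 * q * 30 := by
  have h_large := hW
  rw [Roomy] at h_large
  refine wp_seq (wp_mono (wp_loadParams h_n₀ h_m h_r (by omega)) ?_)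
  rintro σ₁ t₁ ⟨h_reg₁, h_mem₁, h_time₁⟩
  refine wp_seq (wp_mono (wp_divideByEight hP (by omega) fun p _ => h_reg₁ p) ?_)
  rintro σ₂ t₂ ⟨h_reg₂, h_mem₂, h_time₂⟩
  refine wp_mono (wp_layOut hW h_reg₂) ?_
  rintro σ₃ t₃ ⟨h_env, h_mem₃, h_time₃⟩
  exact ⟨h_env, h_mem₃.trans (h_mem₂.trans h_mem₁), by omega⟩

section ForEach

variable {body : Prog} {T : ℕ} {Inv : (ℕ → Prop) → (ℕ → ℕ) → Prop}

/-- On `P` processors in parallel, `body` processes the items `v p` whose numbers are in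
register `4`, in at most `T` steps. The predicate `Inv K` says that the memory is as it should be
after the items in `K` have been processed. -/
def ProcessesItems (W P n₀ m q : ℕ) (body : Prog) (T : ℕ)
    (Inv : (ℕ → Prop) → (ℕ → ℕ) → Prop) : Prop :=
  ∀ (K : ℕ → Prop) (v : ℕ → ℕ) (σ : Config), Env P n₀ m q σ →
    (∀ p < P, σ.reg p 4 = v p ∧ v p < m) → Inv K σ.mem →
    wp W P body σ fun σ' t => Env P n₀ m q σ' ∧ (∀ p < P, σ'.reg p 4 = v p) ∧
      Inv (fun k => K k ∨ ∃ p < P, v p = k) σ'.mem ∧ t ≤ T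

theorem wp_forEach_par (hW : m ≤ W) (h_body : ProcessesItems W m n₀ m q body T Inv)
    {σ : Config} (hσ : Env m n₀ m q σ) (h_inv : Inv (fun _ => False) σ.mem) :
    wp W m (forEach true body) σ fun σ' t =>
      Env m n₀ m q σ' ∧ Inv (fun k => k < m) σ'.mem ∧ t ≤ T + 10 := by
  change wp W m (.seq _ _) σ _
  refine wp_seq (wp_assign (by simp) (fun p hp => hp.trans_le hW) ?_)
  refine wp_mono (h_body (fun _ => False) (fun p => p) _ (hσ.assign (by norm_num) (by norm_num) _)
    (fun p hp => ⟨by simp, hp⟩) h_inv) ?_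
  rintro σ' t ⟨h_env, -, h_inv', h_time⟩
  refine ⟨h_env, by simpa using h_inv', ?_⟩
  simp only [Arith.cost]
  omega

theorem wp_forEach_seq (hW : m + 1 < W) (h_body : ProcessesItems W 1 n₀ m q body T Inv)
    {σ : Config} (hσ : Env 1 n₀ m q σ) (h_inv : Inv (fun _ => False) σ.mem) :
    wp W 1 (forEach false body) σ fun σ' t =>
      Env 1 n₀ m q σ' ∧ Inv (fun k => k < m) σ'.mem ∧ t ≤ 10 + m * (T + 10) := by
  change wp W 1 (.seq _ (.loop _ _)) σ _
  refine wp_seq (wp_assign (by simp) (fun p _ => by simp; omega) ?_)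
  refine wp_loop m (T + 6) (fun i σ' => Env 1 n₀ m q σ' ∧ σ'.reg 0 4 = i ∧
    Inv (fun k => k < i) σ'.mem) (by norm_num) (by norm_num)
    (by simpa using hσ.m_eq 0 (by norm_num))
    ⟨hσ.assign (by norm_num) (by norm_num) _, by simp, by simpa using h_inv⟩ ?_ ?_
  · rintro i hi σ' ⟨h_env, h_item, h_inv'⟩
    refine wp_seq (wp_mono (h_body (fun k => k < i) (fun _ => i) σ' h_env
      (fun p hp => ⟨by rwa [Nat.lt_one_iff.1 hp], hi⟩) h_inv') ?_)
    rintro σ'' t ⟨h_env', h_item', h_inv'', h_time⟩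
    have h_item₀ : σ''.reg 0 4 = i := h_item' 0 (by norm_num)
    refine wp_assign (by simp) (fun p hp => ?_)
      ⟨⟨h_env'.assign (by norm_num) (by norm_num) _, by simp [h_item₀], ?_⟩, by simp; omega⟩
    · simp [Nat.lt_one_iff.1 hp, h_item₀]
      omega
    · rw [Config.assign_mem]
      convert h_inv'' using 1
      funext k
      simp
      omega
  · rintro σ' t ⟨h_env, -, h_inv'⟩ ht
    refine ⟨h_env, h_inv', ?_⟩
    simp only [Arith.cost]
    nlinarith

theorem wp_forEach {par : Bool} (hW : m + 1 < W)
    (h_body : ProcessesItems W (processors par m) n₀ m q body T Inv) {σ : Config}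
    (hσ : Env (processors par m) n₀ m q σ) (h_inv : Inv (fun _ => False) σ.mem) :
    wp W (processors par m) (forEach par body) σ fun σ' t =>
      Env (processors par m) n₀ m q σ' ∧ Inv (fun k => k < m) σ'.mem ∧
        t ≤ 10 + repetitions par m * (T + 10) := by
  cases par with
  | true =>
    have h_le : m ≤ W := by omega
    refine wp_mono (wp_forEach_par h_le h_body hσ h_inv) ?_
    rintro σ' t ⟨h_env, h_inv', h_time⟩
    refine ⟨h_env, h_inv', ?_⟩
    simp only [repetitions, if_true]
    omega
  | false => exact wp_forEach_seq hW h_body hσ h_inv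

end ForEach

end Verification

section Arrays

variable {P base w : ℕ}

/-- The contents of a memory that holds the array `F`, with rows of length `w`, from the address
`base` on. -/
def arrayMem (base w : ℕ) (F : ℕ → ℕ → ℕ) (x : ℕ) : ℕ := F ((x - base) / w) ((x - base) % w)

/-- The cells of the rows in `K` of an array. -/
def RowCell (base w : ℕ) (K : ℕ → Prop) (x : ℕ) : Prop := ∃ k, K k ∧ ∃ j < w, x = base + k * w + j

/-- The cells of the rows in `K` of an array, and the first `j` cells of the rows `v p`. -/
def PartialRowCell (P base w : ℕ) (K : ℕ → Prop) (v : ℕ → ℕ) (j x : ℕ) : Prop :=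
  RowCell base w K x ∨ ∃ p < P, ∃ i < j, x = base + v p * w + i

theorem mul_add_lt {k m l : ℕ} (hl : l < w) (hk : k < m) : k * w + l < m * w := by
  have h_row := Nat.mul_le_mul_right w (show k + 1 ≤ m from hk)
  rw [add_one_mul] at h_row
  omega

theorem mul_add_inj {k k' l l' : ℕ} (hl : l < w) (hl' : l' < w) (h : k * w + l = k' * w + l') :
    k = k' ∧ l = l' := by
  have h_row : k = k' := by
    simpa [mul_comm _ w, Nat.mul_add_div (Nat.zero_lt_of_lt hl), Nat.div_eq_of_lt hl,
      Nat.div_eq_of_lt hl'] using congrArg (· / w) h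
  exact ⟨h_row, by rw [h_row] at h; omega⟩

theorem arrayMem_apply (F : ℕ → ℕ → ℕ) (k : ℕ) {j : ℕ} (hj : j < w) :
    arrayMem base w F (base + k * w + j) = F k j := by
  rw [arrayMem, add_assoc, Nat.add_sub_cancel_left, mul_comm,
    Nat.mul_add_div (Nat.zero_lt_of_lt hj), Nat.div_eq_of_lt hj, add_zero, Nat.mul_add_mod,
    Nat.mod_eq_of_lt hj]

theorem base_le_of_rowCell {K : ℕ → Prop} {x : ℕ} (hx : RowCell base w K x) : base ≤ x := by
  obtain ⟨k, -, j, -, rfl⟩ := hx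
  omega

theorem base_le_of_partialRowCell {K : ℕ → Prop} {v : ℕ → ℕ} {j x : ℕ}
    (hx : PartialRowCell P base w K v j x) : base ≤ x := by
  rcases hx with hx | ⟨p, -, i, -, rfl⟩
  · exact base_le_of_rowCell hx
  · omega

theorem rowCell_false : RowCell base w (fun _ => False) = fun _ => False := by
  funext x
  simp [RowCell]

theorem partialRowCell_zero (K : ℕ → Prop) (v : ℕ → ℕ) :
    PartialRowCell P base w K v 0 = RowCell base w K := by
  funext x
  simp [PartialRowCell]

theorem partialRowCell_succ {K : ℕ → Prop} {v : ℕ → ℕ} {j x : ℕ} :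
    PartialRowCell P base w K v (j + 1) x ↔
      PartialRowCell P base w K v j x ∨ ∃ p < P, base + v p * w + j = x := by
  rw [PartialRowCell, PartialRowCell, or_assoc]
  refine or_congr_right ⟨?_, ?_⟩
  · rintro ⟨p, hp, i, hi, rfl⟩
    rcases Nat.lt_succ_iff_lt_or_eq.1 hi with h | rfl
    · exact Or.inl ⟨p, hp, i, h, rfl⟩
    · exact Or.inr ⟨p, hp, rfl⟩
  · rintro (⟨p, hp, i, hi, rfl⟩ | ⟨p, hp, rfl⟩)
    · exact ⟨p, hp, i, by omega, rfl⟩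
    · exact ⟨p, hp, j, by omega, rfl⟩

theorem partialRowCell_width (K : ℕ → Prop) (v : ℕ → ℕ) :
    PartialRowCell P base w K v w = RowCell base w fun k => K k ∨ ∃ p < P, v p = k := by
  funext x
  refine propext ⟨?_, ?_⟩
  · rintro (⟨k, hk, h⟩ | ⟨p, hp, i, hi, h⟩)
    · exact ⟨k, Or.inl hk, h⟩
    · exact ⟨v p, Or.inr ⟨p, hp, rfl⟩, i, hi, h⟩
  · rintro ⟨k, hk | ⟨p, hp, rfl⟩, h⟩
    · exact Or.inl ⟨k, hk, h⟩
    · exact Or.inr ⟨p, hp, h⟩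

end Arrays

section Table

variable {W P n₀ m q : ℕ}

/-- The entry for the `j`-th check of the variable `k` in the table. -/
def tableEntry (m q : ℕ) (f : ℕ → ℕ → ℕ) (k j : ℕ) : ℕ :=
  addrSX m q + j * q + if f k j < q then f k j else 0

theorem matrixEntry_lt_addrSX {j t v : ℕ} (hj : j < 8) (ht : t < q) (hv : v < m) :
    3 + (j * q + t) * m + v < addrSX m q := by
  rw [add_assoc]
  exact Nat.add_lt_add_left (mul_add_lt hv (mul_add_lt ht hj)) 3

theorem wp_findCheck (hP : 0 < P) (hW : Roomy W n₀ m q) {c v : ℕ → ℕ} {j : ℕ} (hj : j < 8)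
    {σ : Config} (hσ : Env P n₀ m q σ)
    (h_reg : ∀ p < P, σ.reg p 4 = v p ∧ v p < m ∧ σ.reg p 7 = j)
    (h_mem : ∀ p < P, ∀ t < q,
      σ.mem (3 + (j * q + t) * m + v p) = if c p = t then 1 else 0) :
    wp W P findCheck σ fun σ' t => Env P n₀ m q σ' ∧
      (∀ p < P, σ'.reg p 4 = v p ∧ σ'.reg p 7 = j ∧ σ'.reg p 6 = if c p < q then c p else 0) ∧
      σ'.mem = σ.mem ∧ t ≤ 7 + q * 49 := by
  rw [Roomy] at hW
  have h_SZ := addrSZ_le_addrT n₀ m q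
  have h_SX := addrSX_le_addrSZ m q
  refine wp_seq (wp_assign (by simp) (fun p _ => by simp; omega) ?_)
  refine wp_seq (wp_assign (by simp) (fun p _ => by simp; omega) ?_)
  refine wp_loop q 48 (fun t σ' => Env P n₀ m q σ' ∧ (∀ p < P, σ'.reg p 4 = v p ∧
    σ'.reg p 7 = j ∧ σ'.reg p 5 = t ∧ σ'.reg p 6 = if c p < t then c p else 0) ∧
    σ'.mem = σ.mem) hP (by norm_num) (by simpa using hσ.q_eq 0 hP)
    ⟨(hσ.assign (by norm_num) (by norm_num) _).assign (by norm_num) (by norm_num) _,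
      fun p hp => by simp [h_reg p hp], rfl⟩ ?_ ?_
  · rintro t ht σ' ⟨hσ', h_reg', h_mem'⟩
    refine wp_seq (wp_assign (by simp) (fun p hp => ?_)
      (wp_assign (by simp) (fun p hp => ?_) ?_))
    · obtain ⟨h_item, h_group, h_t, h_check⟩ := h_reg' p hp
      have h_lt := matrixEntry_lt_addrSX hj ht (h_reg p hp).2.1
      have h_group_le : j * q ≤ 8 * q := Nat.mul_le_mul_right q hj.le
      have h_entry : (if c p = t then 1 else 0) ≤ 1 := by split_ifs <;> omega
      have h_term : t * (if c p = t then 1 else 0) ≤ q := by split_ifs <;> omega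
      have h_sum : (if c p < t then c p else 0) ≤ q := by split_ifs <;> omega
      simp only [Arith.Fits, Arith.eval, h_item, h_group, h_t, h_check, hσ'.q_eq p hp,
        hσ'.m_eq p hp, h_mem', h_mem p hp t ht]
      omega
    · simp [(h_reg' p hp).2.2.1]
      omega
    · refine ⟨⟨(hσ'.assign (by norm_num) (by norm_num) _).assign (by norm_num) (by norm_num) _,
        fun p hp => ?_, h_mem'⟩, by simp⟩
      obtain ⟨h_item, h_group, h_t, h_check⟩ := h_reg' p hp
      simp [h_item, h_group, h_t, h_check, hσ'.q_eq p hp, hσ'.m_eq p hp, h_mem', h_mem p hp t ht]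
      split_ifs <;> omega
  · rintro σ' t ⟨hσ', h_reg', h_mem'⟩ ht
    exact ⟨hσ', fun p hp => ⟨(h_reg' p hp).1, (h_reg' p hp).2.1, (h_reg' p hp).2.2.2⟩, h_mem',
      by simp; omega⟩

theorem wp_writeTableEntry (hW : Roomy W n₀ m q) {f : ℕ → ℕ → ℕ} {M : ℕ → ℕ} {K : ℕ → Prop}
    {v : ℕ → ℕ} {j : ℕ} (hj : j < 8) {σ : Config} (hσ : Env P n₀ m q σ)
    (h_reg : ∀ p < P, σ.reg p 4 = v p ∧ v p < m ∧ σ.reg p 7 = j ∧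
      σ.reg p 6 = if f (v p) j < q then f (v p) j else 0)
    (h_mem : σ.mem = overlay (PartialRowCell P (addrT n₀ m q) 8 K v j)
      (arrayMem (addrT n₀ m q) 8 (tableEntry m q f)) M) :
    wp W P (write (var 11 + var 4 * var 15 + var 7) (var 12 + var 7 * var 3 + var 6)) σ
      fun σ' t => Env P n₀ m q σ' ∧ σ'.reg = σ.reg ∧
        σ'.mem = overlay (PartialRowCell P (addrT n₀ m q) 8 K v (j + 1))
          (arrayMem (addrT n₀ m q) 8 (tableEntry m q f)) M ∧
        t ≤ 25 := by
  rw [Roomy] at hW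
  have h_SZ := addrSZ_le_addrT n₀ m q
  have h_SX := addrSX_le_addrSZ m q
  have h_addr : ∀ p < P, (var 11 + var 4 * var 15 + var 7).eval p (σ.reg p) σ.mem =
      addrT n₀ m q + v p * 8 + j := fun p hp => by
    simp [h_reg p hp, hσ.addrT_eq p hp, hσ.eight_eq p hp]
  refine wp_write (by simp) (by simp) (fun p hp => ?_) (fun p hp => ?_)
    ⟨hσ.write _ _, rfl, ?_, by simp⟩
  · obtain ⟨h_item, h_lt, h_group, -⟩ := h_reg p hp
    simp [h_item, h_group, hσ.addrT_eq p hp, hσ.eight_eq p hp]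
    omega
  · obtain ⟨-, -, h_group, h_check⟩ := h_reg p hp
    have h_group_le : j * q ≤ 8 * q := Nat.mul_le_mul_right q hj.le
    have h_check_le : (if f (v p) j < q then f (v p) j else 0) ≤ q := by split_ifs <;> omega
    simp only [Arith.Fits, Arith.eval, h_group, h_check, hσ.addrSX_eq p hp, hσ.q_eq p hp]
    omega
  · change parWrite P _ _ σ.mem = _
    rw [parWrite_congr _ h_addr fun p _ => rfl, h_mem]
    refine parWrite_overlay (fun p hp => ?_) fun x => partialRowCell_succ
    obtain ⟨-, -, h_group, h_check⟩ := h_reg p hp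
    rw [arrayMem_apply _ _ hj]
    simp [h_group, h_check, hσ.addrSX_eq p hp, hσ.q_eq p hp, tableEntry]

theorem processesItems_tabulate (hP : 0 < P) (hW : Roomy W n₀ m q) {f : ℕ → ℕ → ℕ} {M : ℕ → ℕ}
    (hM : ∀ j < 8, ∀ t < q, ∀ v < m,
      M (3 + (j * q + t) * m + v) = if f v j = t then 1 else 0) :
    ProcessesItems W P n₀ m q tabulate (8 * (q * 50 + 60) + 20) fun K M' =>
      M' = overlay (RowCell (addrT n₀ m q) 8 K)
        (arrayMem (addrT n₀ m q) 8 (tableEntry m q f)) M := by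
  intro K v σ hσ hv h_mem
  have h_large := hW
  rw [Roomy] at h_large
  refine wp_seq (wp_assign (by simp) (fun p _ => by simp; omega) ?_)
  refine wp_loop 8 (q * 50 + 58) (fun j σ' => Env P n₀ m q σ' ∧
    (∀ p < P, σ'.reg p 4 = v p ∧ σ'.reg p 7 = j) ∧
    σ'.mem = overlay (PartialRowCell P (addrT n₀ m q) 8 K v j)
      (arrayMem (addrT n₀ m q) 8 (tableEntry m q f)) M)
    hP (by norm_num) (by simpa using hσ.eight_eq 0 hP)
    ⟨hσ.assign (by norm_num) (by norm_num) _, fun p hp => by simp [(hv p hp).1],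
      by rw [partialRowCell_zero]; exact h_mem⟩ ?_ ?_
  · rintro j hj σ₁ ⟨hσ₁, h_reg₁, h_mem₁⟩
    have h_column : ∀ p < P, ∀ t < q,
        σ₁.mem (3 + (j * q + t) * m + v p) = if f (v p) j = t then 1 else 0 := fun p hp t ht => by
      rw [h_mem₁, overlay_neg, hM j hj t ht _ (hv p hp).2]
      refine fun h => (base_le_of_partialRowCell h).not_gt ?_
      exact (matrixEntry_lt_addrSX hj ht (hv p hp).2).trans_le
        ((addrSX_le_addrSZ m q).trans (addrSZ_le_addrT n₀ m q))
    refine wp_seq (wp_mono (wp_findCheck hP hW hj hσ₁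
      (fun p hp => ⟨(h_reg₁ p hp).1, (hv p hp).2, (h_reg₁ p hp).2⟩) h_column) ?_)
    rintro σ₂ t₂ ⟨hσ₂, h_reg₂, h_mem₂, h_time₂⟩
    refine wp_seq (wp_mono (wp_writeTableEntry hW hj hσ₂ (fun p hp =>
      ⟨(h_reg₂ p hp).1, (hv p hp).2, (h_reg₂ p hp).2⟩) (h_mem₂.trans h_mem₁)) ?_)
    rintro σ₃ t₃ ⟨hσ₃, h_reg₃, h_mem₃, h_time₃⟩
    refine wp_assign (by simp) (fun p hp => ?_)
      ⟨⟨hσ₃.assign (by norm_num) (by norm_num) _, fun p hp => ?_, h_mem₃⟩, by simp; omega⟩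
    · simp [h_reg₃, h_reg₂ p hp]
      omega
    · simp [h_reg₃, h_reg₂ p hp]
  · rintro σ' t ⟨hσ', h_reg', h_mem'⟩ ht
    rw [partialRowCell_width] at h_mem'
    exact ⟨hσ', fun p hp => (h_reg' p hp).1, h_mem', by simp; omega⟩

end Table

section Rounds

variable {W P n₀ m q : ℕ}

/-- The syndrome and the estimate of the error during bit flipping. -/
abbrev FlipState (m q : ℕ) : Type := (Fin 8 × Fin q → ZMod 2) × (Fin m → ZMod 2)

/-- The memory after `i` rounds of bit flipping in the state `a`, if it was `M₀` at the beginning.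
The estimate of the error is stored modulo `2`, at the first qubit of each block. The number `m` is
that of a dummy variable, all of whose checks are at the address `0`. -/
structure RoundMem (n₀ : ℕ) (f : Fin m → Fin 8 → Fin q) (M₀ : ℕ → ℕ) (i : ℕ) (a : FlipState m q)
    (M : ℕ → ℕ) : Prop where
  table : ∀ (k : Fin m) (j : Fin 8), M (addrT n₀ m q + k * 8 + j) = addrSX m q + j * q + f k j
  dummy : ∀ j : Fin 8, M (addrT n₀ m q + m * 8 + j) = 0
  dummy_check_le : M 0 ≤ n₀ + 1
  syndX : ∀ (j : Fin 8) (t : Fin q), M (addrSX m q + j * q + t) = (a.1 (j, t)).val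
  syndZ : ∀ x, addrSZ m q ≤ x → x < addrX n₀ m q → M x = M₀ x
  estimate : ∀ k : Fin m, (M (addrX n₀ m q + k * n₀) : ZMod 2) = a.2 k
  estimate_le : ∀ k ≤ m, M (addrX n₀ m q + k * n₀) ≤ i
  padding : ∀ k < m, ∀ l, 0 < l → l < n₀ → M (addrX n₀ m q + k * n₀ + l) = 0

theorem RoundMem.congr {f : Fin m → Fin 8 → Fin q} {M₀ M M' : ℕ → ℕ} {i : ℕ} {a : FlipState m q}
    (h : RoundMem n₀ f M₀ i a M) (hM : ∀ x, x ≠ 1 → x ≠ 2 → M' x = M x) :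
    RoundMem n₀ f M₀ i a M' := by
  have h_SX := three_le_addrSX m q
  have h_SZ := addrSX_le_addrSZ m q
  have h_X := addrSZ_le_addrX n₀ m q
  have h_T := addrX_le_addrT n₀ m q
  constructor
  · exact fun k j => (hM _ (by omega) (by omega)).trans (h.table k j)
  · exact fun j => (hM _ (by omega) (by omega)).trans (h.dummy j)
  · exact (hM 0 (by omega) (by omega)).trans_le h.dummy_check_le
  · exact fun j t => (hM _ (by omega) (by omega)).trans (h.syndX j t)
  · exact fun x hx hx' => (hM x (by omega) (by omega)).trans (h.syndZ x hx hx')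
  · exact fun k => (congrArg _ (hM _ (by omega) (by omega))).trans (h.estimate k)
  · exact fun k hk => (hM _ (by omega) (by omega)).trans_le (h.estimate_le k hk)
  · exact fun k hk l hl hl_lt => (hM _ (by omega) (by omega)).trans (h.padding k hk l hl hl_lt)

/-- The number of unsatisfied checks among the first `j` checks of the variable `k`. -/
def unsatBelow (f : Fin m → Fin 8 → Fin q) (s : Fin 8 × Fin q → ZMod 2) (k : Fin m) (j : ℕ) : ℕ :=
  (Finset.univ.filter fun i : Fin 8 => i.val < j ∧ s (i, f k i) ≠ 0).card

section Unsat

variable (f : Fin m → Fin 8 → Fin q) (s : Fin 8 × Fin q → ZMod 2) (k : Fin m)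

theorem unsatBelow_zero : unsatBelow f s k 0 = 0 := by simp [unsatBelow]

theorem unsatBelow_succ (j : Fin 8) :
    unsatBelow f s k (j + 1) = unsatBelow f s k j + (s (j, f k j)).val := by
  have h_term : ∀ i : Fin 8, (if i.val < j.val + 1 ∧ s (i, f k i) ≠ 0 then 1 else 0) =
      (if i.val < j.val ∧ s (i, f k i) ≠ 0 then 1 else 0) +
        if i = j then (s (j, f k j)).val else 0 := fun i => by
    by_cases hij : i = j
    · subst hij
      rcases zmod_two_eq_zero_or_one (s (i, f k i)) with h | h <;> simp [h, ZMod.val_one]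
    · have h_lt : i.val < j.val + 1 ↔ i.val < j.val := by
        have := Fin.val_ne_of_ne hij
        omega
      simp [h_lt, hij]
  simp only [unsatBelow, Finset.card_filter, h_term, Finset.sum_add_distrib]
  simp

theorem unsatBelow_eight : unsatBelow f s k 8 = unsat f s k := by simp [unsatBelow, unsat]

theorem unsatBelow_le (j : ℕ) : unsatBelow f s k j ≤ 8 :=
  (Finset.card_le_univ _).trans (by simp)

theorem unsat_le : unsat f s k ≤ 8 := unsatBelow_eight f s k ▸ unsatBelow_le f s k 8

end Unsat

theorem wp_countUnsat (hP : 0 < P) (hW : Roomy W n₀ m q) {f : Fin m → Fin 8 → Fin q}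
    {M₀ : ℕ → ℕ} {i : ℕ} {a : FlipState m q} {σ : Config} (hσ : Env P n₀ m q σ)
    (h_mem : RoundMem n₀ f M₀ i a σ.mem) {k : ℕ → Fin m} (h_item : ∀ p < P, σ.reg p 4 = k p) :
    wp W P countUnsat σ fun σ' t => Env P n₀ m q σ' ∧
      (∀ p < P, σ'.reg p 4 = k p ∧ σ'.reg p 6 = unsat f a.1 (k p)) ∧ σ'.mem = σ.mem ∧
      t ≤ 400 := by
  rw [Roomy] at hW
  have h_SZ : addrSZ m q = addrSX m q + 8 * q := rfl
  have h_T := addrSZ_le_addrT n₀ m q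
  refine wp_seq (wp_assign (by simp) (fun p _ => by simp; omega) ?_)
  refine wp_seq (wp_assign (by simp) (fun p _ => by simp; omega) ?_)
  refine wp_loop 8 40 (fun j σ' => Env P n₀ m q σ' ∧ (∀ p < P, σ'.reg p 4 = k p ∧
    σ'.reg p 7 = j ∧ σ'.reg p 6 = unsatBelow f a.1 (k p) j) ∧ σ'.mem = σ.mem)
    hP (by norm_num) (by simpa using hσ.eight_eq 0 hP)
    ⟨(hσ.assign (by norm_num) (by norm_num) _).assign (by norm_num) (by norm_num) _,
      fun p hp => by simp [h_item p hp, unsatBelow_zero], rfl⟩ ?_ ?_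
  · rintro j hj σ' ⟨hσ', h_reg', h_mem'⟩
    have h_table : ∀ p, σ.mem (addrT n₀ m q + k p * 8 + j) = addrSX m q + j * q + f (k p) ⟨j, hj⟩ :=
      fun p => h_mem.table (k p) ⟨j, hj⟩
    have h_bit : ∀ p, σ.mem (addrSX m q + j * q + f (k p) ⟨j, hj⟩) =
      (a.1 (⟨j, hj⟩, f (k p) ⟨j, hj⟩)).val := fun p => h_mem.syndX ⟨j, hj⟩ _
    refine wp_seq (wp_assign (by simp) (fun p hp => ?_)
      (wp_assign (by simp) (fun p hp => ?_) ?_))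
    · obtain ⟨h_item', h_j, h_count⟩ := h_reg' p hp
      have h_group_le : j * q ≤ 8 * q := Nat.mul_le_mul_right q hj.le
      have h_check := (f (k p) ⟨j, hj⟩).isLt
      have h_bit_lt := ZMod.val_lt (a.1 (⟨j, hj⟩, f (k p) ⟨j, hj⟩))
      have h_count_le := unsatBelow_le f a.1 (k p) j
      simp only [Arith.Fits, Arith.eval, h_item', h_j, h_count, hσ'.addrT_eq p hp,
        hσ'.eight_eq p hp, h_mem', h_table p, h_bit p]
      omega
    · simp [(h_reg' p hp).2.1]
      omega
    · refine ⟨⟨(hσ'.assign (by norm_num) (by norm_num) _).assign (by norm_num) (by norm_num) _,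
        fun p hp => ?_, h_mem'⟩, by simp⟩
      obtain ⟨h_item', h_j, h_count⟩ := h_reg' p hp
      simp [h_item', h_j, h_count, hσ'.addrT_eq p hp, hσ'.eight_eq p hp, h_mem', h_table p,
        h_bit p, unsatBelow_succ f a.1 (k p) ⟨j, hj⟩]
  · rintro σ' t ⟨hσ', h_reg', h_mem'⟩ ht
    refine ⟨hσ', fun p hp => ⟨(h_reg' p hp).1, ?_⟩, h_mem', by simp; omega⟩
    rw [(h_reg' p hp).2.2, unsatBelow_eight]

/-- The memory after the votes of the variables in `K`, if it was `M₁` before the votes and the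
cell `1` was initialized to `m`. -/
def VoteMem (f : Fin m → Fin 8 → Fin q) (s : Fin 8 × Fin q → ZMod 2) (M₁ : ℕ → ℕ) (K : ℕ → Prop)
    (M : ℕ → ℕ) : Prop :=
  (∀ x, x ≠ 1 → x ≠ 2 → M x = M₁ x) ∧
    ((M 1 = m ∧ ∀ k : Fin m, K k → ¬ 8 < 2 * unsat f s k) ∨
      ∃ k : Fin m, M 1 = k ∧ 8 < 2 * unsat f s k)

theorem VoteMem.parWrite {f : Fin m → Fin 8 → Fin q} {s : Fin 8 × Fin q → ZMod 2}
    {M₁ M addr val : ℕ → ℕ} {K : ℕ → Prop} {k : ℕ → Fin m} (h : VoteMem f s M₁ K M)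
    (h_addr : ∀ p < P, addr p = if 8 < 2 * unsat f s (k p) then 1 else 2)
    (h_val : ∀ p < P, val p = k p) :
    VoteMem f s M₁ (fun j => K j ∨ ∃ p < P, (k p : ℕ) = j) (parWrite P addr val M) := by
  obtain ⟨h_frame, h_votes⟩ := h
  constructor
  · intro x hx₁ hx₂
    rcases parWrite_cases P addr val M x with ⟨p, hp, h_eq, -⟩ | ⟨-, h_old⟩
    · rw [h_addr p hp] at h_eq
      split_ifs at h_eq <;> omega
    · rw [h_old, h_frame x hx₁ hx₂]
  · rcases parWrite_cases P addr val M 1 with ⟨p, hp, h_eq, h_new⟩ | ⟨h_ne, h_old⟩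
    · refine Or.inr ⟨k p, h_new.trans (h_val p hp), ?_⟩
      by_contra h_few
      rw [h_addr p hp, if_neg h_few] at h_eq
      omega
    · rw [h_old]
      refine h_votes.imp_left fun ⟨h_none, h_few⟩ => ⟨h_none, ?_⟩
      rintro j (hj | ⟨p, hp, h_item⟩)
      · exact h_few j hj
      · rw [← Fin.ext h_item]
        exact fun h_most => h_ne p hp ((h_addr p hp).trans (if_pos h_most))

theorem processesItems_vote (hP : 0 < P) (hW : Roomy W n₀ m q) {f : Fin m → Fin 8 → Fin q}
    {M₀ M₁ : ℕ → ℕ} {i : ℕ} {a : FlipState m q} (hM₁ : RoundMem n₀ f M₀ i a M₁) :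
    ProcessesItems W P n₀ m q vote 500 (VoteMem f a.1 M₁) := by
  intro K v σ hσ hv h_votes
  have h_large := hW
  rw [Roomy] at h_large
  have h_exists : ∀ p, ∃ k : Fin m, p < P → v p = k := fun p => by
    by_cases hp : p < P
    · exact ⟨⟨v p, (hv p hp).2⟩, fun _ => rfl⟩
    · exact ⟨⟨v 0, (hv 0 hP).2⟩, fun h => absurd h hp⟩
  choose k hk using h_exists
  refine wp_seq (wp_mono (wp_countUnsat hP hW hσ (hM₁.congr h_votes.1)
    fun p hp => (hv p hp).1.trans (hk p hp)) ?_)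
  rintro σ' t ⟨hσ', h_reg, h_mem, h_time⟩
  refine wp_write (by simp [ballot]) (by simp) (fun p hp => ?_) (fun p hp => ?_)
    ⟨hσ'.write _ _, fun p hp => (h_reg p hp).1.trans (hk p hp).symm, ?_, by simp [ballot]; omega⟩
  · have h_le := unsat_le f a.1 (k p)
    simp [ballot, h_reg p hp, hσ'.eight_eq p hp]
    omega
  · simp [(h_reg p hp).1]
    omega
  · have h_items : ∀ j, (∃ p < P, v p = j) ↔ ∃ p < P, (k p : ℕ) = j := fun j =>
      exists_congr fun p => and_congr_right fun hp => by rw [hk p hp]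
    simp only [h_items]
    refine VoteMem.parWrite (h_mem ▸ h_votes) (fun p hp => ?_) fun p hp => (h_reg p hp).1
    simp only [ballot, Arith.eval_sub, Arith.eval, (h_reg p hp).2, hσ'.eight_eq p hp]
    split_ifs <;> omega

/-- Replace the bits in the cells `c 0`, …, `c (j - 1)` one after another by their complements. -/
def complementCells (c M : ℕ → ℕ) : ℕ → ℕ → ℕ
  | 0 => M
  | j + 1 => Function.update (complementCells c M j) (c j) (1 - complementCells c M j (c j))

section ComplementCells

variable {c M : ℕ → ℕ}

theorem complementCells_of_ne {x : ℕ} (j : ℕ) (h : ∀ i < j, c i ≠ x) :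
    complementCells c M j x = M x := by
  induction j with
  | zero => rfl
  | succ j ih =>
    rw [complementCells, Function.update_of_ne (h j (by omega)).symm,
      ih fun i hi => h i (by omega)]

theorem complementCells_le (j x : ℕ) : complementCells c M j x ≤ max (M x) 1 := by
  induction j with
  | zero => exact le_max_left _ _
  | succ j ih =>
    rw [complementCells, Function.update_apply]
    split_ifs
    · exact (Nat.sub_le _ _).trans (le_max_right _ _)
    · exact ih

theorem complementCells_of_injOn (n : ℕ) (h_inj : Set.InjOn c (Set.Iio n)) {i : ℕ} (hi : i < n) :
    complementCells c M n (c i) = 1 - M (c i) := by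
  induction n with
  | zero => omega
  | succ n ih =>
    rw [complementCells, Function.update_apply]
    rcases Nat.lt_succ_iff_lt_or_eq.1 hi with h_lt | rfl
    · rw [if_neg fun h => h_lt.ne (h_inj hi (Nat.lt_succ_self n) h)]
      exact ih (h_inj.mono (Set.Iio_subset_Iio n.le_succ)) h_lt
    · rw [if_pos rfl, complementCells_of_ne]
      exact fun j hj h => hj.ne (h_inj (hj.trans hi) hi h)

end ComplementCells

theorem wp_complementChecks (hP : 0 < P) (hW : Roomy W n₀ m q) {σ : Config}
    (hσ : Env P n₀ m q σ) {w : ℕ} (hw : w ≤ m) (h_reg : ∀ p < P, σ.reg p 9 = w)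
    (h_addr : ∀ j < 8, σ.mem (addrT n₀ m q + w * 8 + j) < addrT n₀ m q)
    (h_val : ∀ j < 8, σ.mem (σ.mem (addrT n₀ m q + w * 8 + j)) ≤ n₀ + 1) :
    wp W P complementChecks σ fun σ' t => Env P n₀ m q σ' ∧ (∀ p < P, σ'.reg p 9 = w) ∧
      σ'.mem = complementCells (fun j => σ.mem (addrT n₀ m q + w * 8 + j)) σ.mem 8 ∧
      t ≤ 450 := by
  rw [Roomy] at hW
  refine wp_seq (wp_assign (by simp) (fun p _ => by simp; omega) ?_)
  refine wp_loop 8 50 (fun j σ' => Env P n₀ m q σ' ∧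
    (∀ p < P, σ'.reg p 9 = w ∧ σ'.reg p 7 = j) ∧
    σ'.mem = complementCells (fun j => σ.mem (addrT n₀ m q + w * 8 + j)) σ.mem j)
    hP (by norm_num) (by simpa using hσ.eight_eq 0 hP)
    ⟨hσ.assign (by norm_num) (by norm_num) _, fun p hp => by simp [h_reg p hp], rfl⟩ ?_ ?_
  · rintro j hj σ' ⟨hσ', h_reg', h_mem'⟩
    have h_addr_lt := h_addr j hj
    have h_table : σ'.mem (addrT n₀ m q + w * 8 + j) = σ.mem (addrT n₀ m q + w * 8 + j) := by
      rw [h_mem']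
      refine complementCells_of_ne _ fun i hi h => ?_
      have := h_addr i (by omega)
      omega
    have h_val_le : σ'.mem (σ.mem (addrT n₀ m q + w * 8 + j)) ≤ n₀ + 1 := by
      rw [h_mem']
      exact (complementCells_le _ _).trans (max_le (h_val j hj) (by omega))
    refine wp_seq (wp_write (by simp) (by simp) (fun p hp => ?_) (fun p hp => ?_)
      (wp_assign (by simp) (fun p hp => ?_) ⟨⟨(hσ'.write _ _).assign (by norm_num) (by norm_num) _,
        fun p hp => by simp [h_reg' p hp], ?_⟩, by simp⟩))
    · simp only [Arith.Fits, Arith.eval, h_reg' p hp, hσ'.addrT_eq p hp, hσ'.eight_eq p hp, h_table]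
      omega
    · simp only [Arith.fits_sub, Arith.Fits, Arith.eval, h_reg' p hp, hσ'.addrT_eq p hp,
        hσ'.eight_eq p hp, h_table]
      omega
    · simp [h_reg' p hp]
      omega
    · rw [complementCells, ← h_mem']
      refine parWrite_same hP (fun p hp => ?_) fun p hp => ?_ <;>
        simp [h_reg' p hp, hσ'.addrT_eq p hp, hσ'.eight_eq p hp, h_table]
  · rintro σ' t ⟨hσ', h_reg', h_mem'⟩ ht
    exact ⟨hσ', fun p hp => (h_reg' p hp).1, h_mem', by simp; omega⟩

/-- The memory after flipping the variable `w`. -/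
def flippedMem (n₀ m q w : ℕ) (M : ℕ → ℕ) : ℕ → ℕ :=
  let M' := complementCells (fun j => M (addrT n₀ m q + w * 8 + j)) M 8
  Function.update M' (addrX n₀ m q + w * n₀) (M' (addrX n₀ m q + w * n₀) + 1)

theorem wp_flip (hP : 0 < P) (hW : Roomy W n₀ m q) {σ : Config} (hσ : Env P n₀ m q σ) {w : ℕ}
    (h_item : σ.mem 1 = w) (hw : w ≤ m)
    (h_addr : ∀ j < 8, σ.mem (addrT n₀ m q + w * 8 + j) < addrT n₀ m q)
    (h_val : ∀ j < 8, σ.mem (σ.mem (addrT n₀ m q + w * 8 + j)) ≤ n₀ + 1)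
    (h_bit : σ.mem (addrX n₀ m q + w * n₀) ≤ 8 * q) :
    wp W P flip σ fun σ' t => Env P n₀ m q σ' ∧ σ'.mem = flippedMem n₀ m q w σ.mem ∧ t ≤ 500 := by
  have h_large := hW
  rw [Roomy] at h_large
  have h_T : addrT n₀ m q = addrX n₀ m q + m * n₀ + m * n₀ := rfl
  have h_SX := addrSX_le_addrSZ m q
  have h_X := addrSZ_le_addrX n₀ m q
  have h_SZ : addrSZ m q = addrSX m q + 8 * q := rfl
  have h_block : w * n₀ ≤ m * n₀ := Nat.mul_le_mul_right n₀ hw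
  refine wp_seq (wp_assign (by simp) (fun p _ => by simp; omega) ?_)
  refine wp_seq (wp_mono (wp_complementChecks hP hW (hσ.assign (by norm_num) (by norm_num) _) hw
    (fun p _ => by simp [h_item]) h_addr h_val) ?_)
  rintro σ' t ⟨hσ', h_reg', h_mem', h_time⟩
  have h_bit' : σ'.mem (addrX n₀ m q + w * n₀) ≤ 8 * q + 1 := by
    rw [h_mem']
    exact (complementCells_le _ _).trans (max_le (h_bit.trans (by omega)) (by omega))
  refine wp_write (by simp) (by simp) (fun p hp => ?_) (fun p hp => ?_)
    ⟨hσ'.write _ _, ?_, by simp; omega⟩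
  · simp [h_reg' p hp, hσ'.n₀_eq p hp, hσ'.addrX_eq p hp]
    omega
  · simp [h_reg' p hp, hσ'.n₀_eq p hp, hσ'.addrX_eq p hp]
    omega
  · rw [Config.assign_mem] at h_mem'
    rw [flippedMem, ← h_mem']
    refine parWrite_same hP (fun p hp => ?_) fun p hp => ?_ <;>
      simp [h_reg' p hp, hσ'.n₀_eq p hp, hσ'.addrX_eq p hp]

end Rounds

section Flip

variable {W n₀ m q : ℕ} {f : Fin m → Fin 8 → Fin q} {M₀ M : ℕ → ℕ} {i : ℕ} {a : FlipState m q}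

theorem flippedMem_of_ne {w x : ℕ} (h_bit : x ≠ addrX n₀ m q + w * n₀)
    (h_checks : ∀ j < 8, M (addrT n₀ m q + w * 8 + j) ≠ x) : flippedMem n₀ m q w M x = M x := by
  rw [flippedMem, Function.update_of_ne h_bit, complementCells_of_ne 8 h_checks]

theorem flippedMem_estimate {w : ℕ}
    (h_checks : ∀ j < 8, M (addrT n₀ m q + w * 8 + j) ≠ addrX n₀ m q + w * n₀) :
    flippedMem n₀ m q w M (addrX n₀ m q + w * n₀) = M (addrX n₀ m q + w * n₀) + 1 := by
  rw [flippedMem, Function.update_self, complementCells_of_ne 8 h_checks]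

theorem check_lt_addrSZ (j : Fin 8) (t : Fin q) : addrSX m q + j * q + t < addrSZ m q := by
  rw [add_assoc]
  exact Nat.add_lt_add_left (mul_add_lt t.isLt j.isLt) _

theorem check_inj {j j' : Fin 8} {t t' : Fin q}
    (h : addrSX m q + j * q + t = addrSX m q + j' * q + t') : j = j' ∧ t = t' := by
  rw [add_assoc, add_assoc] at h
  exact (mul_add_inj t.isLt t'.isLt (Nat.add_left_cancel h)).imp Fin.ext Fin.ext

theorem RoundMem.table_ne (h : RoundMem n₀ f M₀ i a M) (k : Fin m) {x : ℕ}
    (hx : x < addrSX m q ∨ addrSZ m q ≤ x) : ∀ j < 8, M (addrT n₀ m q + k * 8 + j) ≠ x := by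
  intro j hj
  have h_lt : addrSX m q + j * q + f k ⟨j, hj⟩ < addrSZ m q :=
    check_lt_addrSZ ⟨j, hj⟩ (f k ⟨j, hj⟩)
  have h_table : M (addrT n₀ m q + k * 8 + j) = addrSX m q + j * q + f k ⟨j, hj⟩ :=
    h.table k ⟨j, hj⟩
  omega

theorem RoundMem.flippedMem_syndX (h : RoundMem n₀ f M₀ i a M) (k : Fin m) (j : Fin 8)
    (t : Fin q) : flippedMem n₀ m q k M (addrSX m q + j * q + t) =
      ((a.1 + (tannerMatrix f).col k) (j, t)).val := by
  have h_X := addrSZ_le_addrX n₀ m q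
  have h_lt := check_lt_addrSZ (m := m) j t
  have h_table : ∀ (i : ℕ) (hi : i < 8),
      M (addrT n₀ m q + k * 8 + i) = addrSX m q + i * q + f k ⟨i, hi⟩ := fun i hi =>
    h.table k ⟨i, hi⟩
  have h_col : (a.1 + (tannerMatrix f).col k) (j, t) = a.1 (j, t) + if f k j = t then 1 else 0 :=
    rfl
  rw [h_col]
  split_ifs with h_check
  · have h_inj : Set.InjOn (fun i => M (addrT n₀ m q + k * 8 + i)) (Set.Iio 8) :=
      fun i hi i' hi' h_eq => by
        simp only [h_table i hi, h_table i' hi'] at h_eq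
        exact congrArg Fin.val (check_inj (j := ⟨i, hi⟩) (j' := ⟨i', hi'⟩) h_eq).1
    have h_flip := complementCells_of_injOn (M := M) 8 h_inj j.isLt
    have h_complement : ∀ z : ZMod 2, 1 - z.val = (z + 1).val := by decide
    simp only [h_table j j.isLt, h_check, h.syndX] at h_flip
    rw [flippedMem, Function.update_of_ne (by omega), h_flip, h_complement]
  · rw [flippedMem_of_ne (by omega), h.syndX, add_zero]
    intro i hi h_eq
    rw [h_table i hi] at h_eq
    obtain ⟨rfl, h_t⟩ := check_inj (j := ⟨i, hi⟩) h_eq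
    exact h_check h_t

theorem RoundMem.flip (hn₀ : 0 < n₀) (h : RoundMem n₀ f M₀ i a M) (k : Fin m) :
    RoundMem n₀ f M₀ (i + 1) (a.1 + (tannerMatrix f).col k, a.2 + Pi.single k 1)
      (flippedMem n₀ m q k M) := by
  have h_SX := three_le_addrSX m q
  have h_SZ := addrSX_le_addrSZ m q
  have h_X := addrSZ_le_addrX n₀ m q
  have h_T : addrT n₀ m q = addrX n₀ m q + m * n₀ + m * n₀ := rfl
  have h_block : k * n₀ + 0 < m * n₀ := mul_add_lt hn₀ k.isLt
  have h_frame : ∀ x, x < addrSX m q ∨ addrSZ m q ≤ x → x ≠ addrX n₀ m q + k * n₀ →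
      flippedMem n₀ m q k M x = M x := fun x hx h_bit => flippedMem_of_ne h_bit (h.table_ne k hx)
  have h_estimate := flippedMem_estimate (h.table_ne k (Or.inr (h_X.trans (Nat.le_add_right _ _))))
  constructor
  · exact fun k' j => (h_frame _ (by omega) (by omega)).trans (h.table k' j)
  · exact fun j => (h_frame _ (by omega) (by omega)).trans (h.dummy j)
  · exact (h_frame 0 (by omega) (by omega)).trans_le h.dummy_check_le
  · exact h.flippedMem_syndX k
  · exact fun x hx hx' => (h_frame x (by omega) (by omega)).trans (h.syndZ x hx hx')
  · intro k'
    by_cases hk : k' = k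
    · rw [hk, h_estimate, Nat.cast_add, h.estimate]
      simp
    · rw [h_frame _ (by omega) fun h_eq => hk (Fin.ext (Nat.eq_of_mul_eq_mul_right hn₀
        (Nat.add_left_cancel h_eq))), h.estimate]
      simp [hk]
  · intro k' hk'
    by_cases h_eq : addrX n₀ m q + k' * n₀ = addrX n₀ m q + k * n₀
    · rw [h_eq, h_estimate]
      exact Nat.succ_le_succ (h.estimate_le k k.isLt.le)
    · rw [h_frame _ (by omega) h_eq]
      exact (h.estimate_le k' hk').trans i.le_succ
  · intro k' hk' l hl hl'
    rw [h_frame _ (by omega), h.padding k' hk' l hl hl']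
    intro h_eq
    have h_l := (mul_add_inj hl' hn₀ (k := k') (k' := k) (by omega)).2
    omega

theorem RoundMem.idle (hn₀ : 0 < n₀) (hm : 0 < m) (h : RoundMem n₀ f M₀ i a M) :
    RoundMem n₀ f M₀ (i + 1) a (flippedMem n₀ m q m M) := by
  have h_SX := three_le_addrSX m q
  have h_SZ := addrSX_le_addrSZ m q
  have h_X := addrSZ_le_addrX n₀ m q
  have h_T : addrT n₀ m q = addrX n₀ m q + m * n₀ + m * n₀ := rfl
  have h_blocks := mul_add_lt hn₀ hm
  have h_checks : ∀ x, 0 < x → ∀ j < 8, M (addrT n₀ m q + m * 8 + j) ≠ x := fun x hx j hj => by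
    rw [h.dummy ⟨j, hj⟩]
    exact hx.ne
  have h_frame : ∀ x, 0 < x → x ≠ addrX n₀ m q + m * n₀ → flippedMem n₀ m q m M x = M x :=
    fun x hx h_bit => flippedMem_of_ne h_bit (h_checks x hx)
  constructor
  · exact fun k j => (h_frame _ (by omega) (by omega)).trans (h.table k j)
  · exact fun j => (h_frame _ (by omega) (by omega)).trans (h.dummy j)
  · rw [flippedMem, Function.update_of_ne (by omega)]
    exact (complementCells_le _ _).trans (max_le h.dummy_check_le (by omega))
  · intro j t
    have h_lt := check_lt_addrSZ (m := m) j t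
    exact (h_frame _ (by omega) (by omega)).trans (h.syndX j t)
  · exact fun x hx hx' => (h_frame x (by omega) (by omega)).trans (h.syndZ x hx hx')
  · intro k
    have h_block := mul_add_lt hn₀ k.isLt
    exact (congrArg _ (h_frame _ (by omega) (by omega))).trans (h.estimate k)
  · intro k hk
    by_cases h_eq : addrX n₀ m q + k * n₀ = addrX n₀ m q + m * n₀
    · rw [h_eq, flippedMem_estimate (h_checks _ (by omega))]
      exact Nat.succ_le_succ (h.estimate_le m le_rfl)
    · rw [h_frame _ (by omega) h_eq]
      exact (h.estimate_le k hk).trans i.le_succ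
  · intro k hk l hl hl'
    have h_block := mul_add_lt hl' hk
    exact (h_frame _ (by omega) (by omega)).trans (h.padding k hk l hl hl')

theorem processors_pos (par : Bool) (hm : 0 < m) : 0 < processors par m := by
  rw [processors]
  split_ifs <;> omega

theorem wp_flip_item {P : ℕ} (hP : 0 < P) (hn₀ : 0 < n₀) (hW : Roomy W n₀ m q) (hi : i < 8 * q)
    {σ : Config} (hσ : Env P n₀ m q σ) (h : RoundMem n₀ f M₀ i a σ.mem) {k : Fin m}
    (h_item : σ.mem 1 = k) :
    wp W P flip σ fun σ' t => Env P n₀ m q σ' ∧ RoundMem n₀ f M₀ (i + 1)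
      (a.1 + (tannerMatrix f).col k, a.2 + Pi.single k 1) σ'.mem ∧ t ≤ 500 := by
  have h_table : ∀ (j : ℕ) (hj : j < 8),
      σ.mem (addrT n₀ m q + k * 8 + j) = addrSX m q + j * q + f k ⟨j, hj⟩ := fun j hj =>
    h.table k ⟨j, hj⟩
  refine wp_mono (wp_flip hP hW hσ h_item k.isLt.le (fun j hj => ?_) (fun j hj => ?_)
    ((h.estimate_le k k.isLt.le).trans hi.le)) ?_
  · rw [h_table j hj]
    exact (check_lt_addrSZ ⟨j, hj⟩ _).trans_le (addrSZ_le_addrT n₀ m q)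
  · rw [h_table j hj, h.syndX ⟨j, hj⟩]
    exact (Nat.lt_succ_iff.1 (ZMod.val_lt _)).trans (Nat.le_add_left 1 n₀)
  · rintro σ' t ⟨hσ', h_mem', h_time⟩
    exact ⟨hσ', h_mem' ▸ h.flip hn₀ k, h_time⟩

theorem wp_flip_dummy {P : ℕ} (hP : 0 < P) (hn₀ : 0 < n₀) (hm : 0 < m) (hW : Roomy W n₀ m q)
    (hi : i < 8 * q) {σ : Config} (hσ : Env P n₀ m q σ) (h : RoundMem n₀ f M₀ i a σ.mem)
    (h_item : σ.mem 1 = m) :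
    wp W P flip σ fun σ' t =>
      Env P n₀ m q σ' ∧ RoundMem n₀ f M₀ (i + 1) a σ'.mem ∧ t ≤ 500 := by
  have h_dummy : ∀ j < 8, σ.mem (addrT n₀ m q + m * 8 + j) = 0 := fun j hj => h.dummy ⟨j, hj⟩
  refine wp_mono (wp_flip hP hW hσ h_item le_rfl (fun j hj => ?_) (fun j hj => ?_)
    ((h.estimate_le m le_rfl).trans hi.le)) ?_
  · rw [h_dummy j hj]
    exact lt_of_lt_of_le (by norm_num) ((three_le_addrSX m q).trans
      ((addrSX_le_addrSZ m q).trans (addrSZ_le_addrT n₀ m q)))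
  · rw [h_dummy j hj]
    exact h.dummy_check_le
  · rintro σ' t ⟨hσ', h_mem', h_time⟩
    exact ⟨hσ', h_mem' ▸ h.idle hn₀ hm, h_time⟩

theorem wp_round {par : Bool} (hn₀ : 0 < n₀) (hm : 0 < m) (hW : Roomy W n₀ m q) (hi : i < 8 * q)
    {σ : Config} (hσ : Env (processors par m) n₀ m q σ) (h : RoundMem n₀ f M₀ i a σ.mem) :
    wp W (processors par m) (round par) σ fun σ' t => (Env (processors par m) n₀ m q σ' ∧
      ∃ a', FlipStep f a a' ∧ RoundMem n₀ f M₀ (i + 1) a' σ'.mem) ∧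
      t ≤ 600 + repetitions par m * 510 := by
  have hP := processors_pos par hm
  have h_large := hW
  rw [Roomy] at h_large
  refine wp_seq (wp_write (by simp) (by simp) (fun p _ => by simp; omega) (fun p hp => ?_) ?_)
  · simp [hσ.m_eq p hp]
    omega
  have h_init : (σ.write (processors par m) (lit 1) (var 1)).mem = Function.update σ.mem 1 m :=
    parWrite_same hP (fun p _ => by simp) fun p hp => by simp [hσ.m_eq p hp]
  refine wp_seq (wp_mono (wp_forEach (by omega) (processesItems_vote hP hW h) (hσ.write _ _) ?_) ?_)
  · rw [h_init]
    exact ⟨fun x hx _ => Function.update_of_ne hx _ _, Or.inl ⟨by simp, by simp⟩⟩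
  rintro σ' t ⟨hσ', ⟨h_frame, h_votes⟩, h_time⟩
  have h_mem' := h.congr h_frame
  rcases h_votes with ⟨h_none, h_few⟩ | ⟨k, h_item, h_most⟩
  · refine wp_mono (wp_flip_dummy hP hn₀ hm hW hi hσ' h_mem' h_none) ?_
    rintro σ'' t' ⟨hσ'', h_mem'', h_time'⟩
    exact ⟨⟨hσ'', a, Or.inr ⟨fun w => by simpa using h_few w w.isLt, rfl⟩, h_mem''⟩,
      by simp; omega⟩
  · refine wp_mono (wp_flip_item hP hn₀ hW hi hσ' h_mem' h_item) ?_
    rintro σ'' t' ⟨hσ'', h_mem'', h_time'⟩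
    exact ⟨⟨hσ'', _, Or.inl ⟨k, by simpa using h_most, rfl⟩, h_mem''⟩, by simp; omega⟩

end Flip

section MajorityProgram

variable {W P n₀ m q : ℕ}

/-- The number of ones in the syndrome `z k` of the block `k`. -/
def blockCount (n₀ : ℕ) (z : ℕ → ℕ → ℕ) (k : ℕ) : ℕ := ∑ l ∈ Finset.range (n₀ - 1), z k l

/-- Whether the last qubit of the block `k` suffers a `Z`-error, by majority decoding. -/
def blockFlip (n₀ : ℕ) (z : ℕ → ℕ → ℕ) (k : ℕ) : ℕ := if n₀ < 2 * blockCount n₀ z k then 1 else 0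

/-- The estimate, by majority decoding, of the `Z`-error on the qubit `l` of the block `k`,
modulo `2`. -/
def majorityEntry (n₀ : ℕ) (z : ℕ → ℕ → ℕ) (k l : ℕ) : ℕ :=
  if l < n₀ - 1 then z k l + blockFlip n₀ z k else blockFlip n₀ z k

theorem blockFlip_le (n₀ : ℕ) (z : ℕ → ℕ → ℕ) (k : ℕ) : blockFlip n₀ z k ≤ 1 := by
  rw [blockFlip]
  split_ifs <;> omega

theorem syndZ_lt_addrX {k l : ℕ} (hk : k < m) (hl : l < n₀ - 1) :
    addrSZ m q + k * (n₀ - 1) + l < addrX n₀ m q := by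
  rw [add_assoc]
  exact Nat.add_lt_add_left (mul_add_lt hl hk) _

/-- The processor `p` deals with the block `v p`, whose syndrome is `z (v p)`. -/
structure BlockEnv (P n₀ m q : ℕ) (z : ℕ → ℕ → ℕ) (v : ℕ → ℕ) (σ : Config) : Prop where
  env : Env P n₀ m q σ
  item : ∀ p < P, σ.reg p 4 = v p
  item_lt : ∀ p < P, v p < m
  width : ∀ p < P, σ.reg p 8 = n₀ - 1
  synd : ∀ p < P, ∀ l < n₀ - 1, σ.mem (addrSZ m q + v p * (n₀ - 1) + l) = z (v p) l
  synd_le : ∀ p < P, ∀ l < n₀ - 1, z (v p) l ≤ 1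

theorem BlockEnv.assign {z : ℕ → ℕ → ℕ} {v : ℕ → ℕ} {σ : Config} (h : BlockEnv P n₀ m q z v σ)
    {d : ℕ} (hd : d ∈ ({5, 6, 9} : Set ℕ)) (e : Arith) :
    BlockEnv P n₀ m q z v (σ.assign d e) := by
  have h_range : 4 < d ∧ d ≠ 8 ∧ d < 10 := by
    rcases hd with rfl | rfl | rfl <;> norm_num
  exact ⟨h.env.assign h_range.1.le h_range.2.2 e,
    fun p hp => by simp [h_range.1.ne, h.item p hp], h.item_lt,
    fun p hp => by simp [h_range.2.1.symm, h.width p hp], h.synd, h.synd_le⟩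

theorem BlockEnv.write {z : ℕ → ℕ → ℕ} {v : ℕ → ℕ} {σ : Config} (h : BlockEnv P n₀ m q z v σ)
    {b c : Arith} (hb : ∀ p < P, addrX n₀ m q ≤ b.eval p (σ.reg p) σ.mem) :
    BlockEnv P n₀ m q z v (σ.write P b c) := by
  refine ⟨h.env.write _ _, h.item, h.item_lt, h.width, fun p hp l hl => ?_, h.synd_le⟩
  have h_lt := syndZ_lt_addrX (q := q) (h.item_lt p hp) hl
  rw [← h.synd p hp l hl]
  change parWrite P _ _ σ.mem _ = _
  rcases parWrite_cases P (fun p => b.eval p (σ.reg p) σ.mem) (fun p => c.eval p (σ.reg p) σ.mem)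
    σ.mem (addrSZ m q + v p * (n₀ - 1) + l) with ⟨p', hp', h_eq, -⟩ | ⟨-, h_old⟩
  · have h_le := hb p' hp'
    omega
  · exact h_old

theorem wp_countBlock (hP : 0 < P) (hW : Roomy W n₀ m q) {z : ℕ → ℕ → ℕ} {v : ℕ → ℕ} {σ : Config}
    (hσ : BlockEnv P n₀ m q z v σ) :
    wp W P countBlock σ fun σ' t => BlockEnv P n₀ m q z v σ' ∧
      (∀ p < P, σ'.reg p 6 = blockCount n₀ z (v p)) ∧ σ'.mem = σ.mem ∧ t ≤ 10 + n₀ * 42 := by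
  rw [Roomy] at hW
  have h_T := addrX_le_addrT n₀ m q
  refine wp_seq (wp_assign (by simp) (fun p _ => by simp; omega) ?_)
  refine wp_seq (wp_assign (by simp) (fun p _ => by simp; omega) ?_)
  refine wp_loop (n₀ - 1) 40 (fun i σ' => BlockEnv P n₀ m q z v σ' ∧ (∀ p < P, σ'.reg p 5 = i ∧
    σ'.reg p 6 = ∑ l ∈ Finset.range i, z (v p) l) ∧ σ'.mem = σ.mem)
    hP (by norm_num) (by simpa using hσ.width 0 hP)
    ⟨(hσ.assign (by simp) _).assign (by simp) _, fun p _ => by simp, rfl⟩ ?_ ?_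
  · rintro i hi σ' ⟨hσ', h_reg, h_mem⟩
    refine wp_seq (wp_assign (by simp) (fun p hp => ?_) (wp_assign (by simp) (fun p hp => ?_)
      ⟨⟨(hσ'.assign (by simp) _).assign (by simp) _, fun p hp => ?_, h_mem⟩, by simp⟩))
    · have h_lt := syndZ_lt_addrX (q := q) (hσ'.item_lt p hp) hi
      have h_synd_le := hσ'.synd_le p hp i hi
      have h_count_le : ∑ l ∈ Finset.range i, z (v p) l ≤ i :=
        (Finset.sum_le_card_nsmul _ _ 1 fun l hl =>
          hσ'.synd_le p hp l ((Finset.mem_range.1 hl).trans hi)).trans (by simp)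
      have h_item_lt := hσ'.item_lt p hp
      simp only [Arith.Fits, Arith.eval, hσ'.item p hp, hσ'.width p hp, h_reg p hp,
        hσ'.env.addrSZ_eq p hp, hσ'.synd p hp i hi]
      omega
    · simp [(h_reg p hp).1]
      omega
    · simp [h_reg p hp, hσ'.item p hp, hσ'.width p hp, hσ'.env.addrSZ_eq p hp,
        hσ'.synd p hp i hi, Finset.sum_range_succ]
  · rintro σ' t ⟨hσ', h_reg, h_mem⟩ ht
    exact ⟨hσ', fun p hp => (h_reg p hp).2, h_mem, by simp; omega⟩

/-- The memory after the blocks in `K` and the first `i` qubits of the blocks `v p` have been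
decoded, if it was `M` at the beginning. -/
noncomputable def majorityMem (P n₀ m q : ℕ) (z : ℕ → ℕ → ℕ) (K : ℕ → Prop) (v : ℕ → ℕ) (i : ℕ)
    (M : ℕ → ℕ) : ℕ → ℕ :=
  overlay (PartialRowCell P (addrZ n₀ m q) n₀ K v i)
    (arrayMem (addrZ n₀ m q) n₀ (majorityEntry n₀ z)) M

theorem write_mem_eq_majorityMem {z : ℕ → ℕ → ℕ} {K : ℕ → Prop} {v : ℕ → ℕ} {i : ℕ} (hi : i < n₀)
    {M : ℕ → ℕ} {σ : Config} {b c : Arith} (h_mem : σ.mem = majorityMem P n₀ m q z K v i M)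
    (hb : ∀ p < P, b.eval p (σ.reg p) σ.mem = addrZ n₀ m q + v p * n₀ + i)
    (hc : ∀ p < P, c.eval p (σ.reg p) σ.mem = majorityEntry n₀ z (v p) i) :
    (σ.write P b c).mem = majorityMem P n₀ m q z K v (i + 1) M := by
  change parWrite P _ _ σ.mem = _
  rw [parWrite_congr _ hb hc, h_mem]
  exact parWrite_overlay (fun p _ => (arrayMem_apply _ _ hi).symm) fun x => partialRowCell_succ

theorem wp_writeBlock (hP : 0 < P) (hW : Roomy W n₀ m q) {z : ℕ → ℕ → ℕ} {K : ℕ → Prop}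
    {v : ℕ → ℕ} {M : ℕ → ℕ} {σ : Config} (hσ : BlockEnv P n₀ m q z v σ)
    (h_flip : ∀ p < P, σ.reg p 9 = blockFlip n₀ z (v p))
    (h_mem : σ.mem = majorityMem P n₀ m q z K v 0 M) :
    wp W P writeBlock σ fun σ' t => BlockEnv P n₀ m q z v σ' ∧
      (∀ p < P, σ'.reg p 9 = blockFlip n₀ z (v p)) ∧
      σ'.mem = majorityMem P n₀ m q z K v (n₀ - 1) M ∧ t ≤ 10 + n₀ * 52 := by
  rw [Roomy] at hW
  have h_T : addrT n₀ m q = addrZ n₀ m q + m * n₀ := rfl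
  have h_Z : addrZ n₀ m q = addrX n₀ m q + m * n₀ := rfl
  refine wp_seq (wp_assign (by simp) (fun p _ => by simp; omega) ?_)
  refine wp_loop (n₀ - 1) 50 (fun i σ' => BlockEnv P n₀ m q z v σ' ∧ (∀ p < P, σ'.reg p 5 = i ∧
    σ'.reg p 9 = blockFlip n₀ z (v p)) ∧ σ'.mem = majorityMem P n₀ m q z K v i M)
    hP (by norm_num) (by simpa using hσ.width 0 hP)
    ⟨hσ.assign (by simp) _, fun p hp => by simp [h_flip p hp], h_mem⟩ ?_ ?_
  · rintro i hi σ' ⟨hσ', h_reg, h_mem'⟩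
    have h_addr : ∀ p < P, (var 14 + var 4 * var 0 + var 5).eval p (σ'.reg p) σ'.mem =
        addrZ n₀ m q + v p * n₀ + i := fun p hp => by
      simp [h_reg p hp, hσ'.item p hp, hσ'.env.addrZ_eq p hp, hσ'.env.n₀_eq p hp]
    refine wp_seq (wp_write (by simp) (by simp) (fun p hp => ?_) (fun p hp => ?_)
      (wp_assign (by simp) (fun p hp => ?_) ⟨⟨(hσ'.write fun p hp => ?_).assign (by simp) _,
        fun p hp => by simp [h_reg p hp], write_mem_eq_majorityMem (by omega) h_mem' h_addr
          fun p hp => ?_⟩, by simp⟩))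
    · have h_lt : v p * n₀ + i < m * n₀ := mul_add_lt (by omega) (hσ'.item_lt p hp)
      have h_item_lt := hσ'.item_lt p hp
      simp only [Arith.Fits, Arith.eval, h_reg p hp, hσ'.item p hp, hσ'.env.addrZ_eq p hp,
        hσ'.env.n₀_eq p hp]
      omega
    · have h_lt := syndZ_lt_addrX (q := q) (hσ'.item_lt p hp) hi
      have h_synd_le := hσ'.synd_le p hp i hi
      have h_flip_le := blockFlip_le n₀ z (v p)
      have h_item_lt := hσ'.item_lt p hp
      simp only [Arith.Fits, Arith.eval, h_reg p hp, hσ'.item p hp, hσ'.width p hp,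
        hσ'.env.addrSZ_eq p hp, hσ'.synd p hp i hi]
      omega
    · simp [(h_reg p hp).1]
      omega
    · rw [h_addr p hp]
      omega
    · rw [majorityEntry, if_pos hi]
      simp [h_reg p hp, hσ'.item p hp, hσ'.width p hp, hσ'.env.addrSZ_eq p hp,
        hσ'.synd p hp i hi]
  · rintro σ' t ⟨hσ', h_reg, h_mem'⟩ ht
    exact ⟨hσ', fun p hp => (h_reg p hp).2, h_mem', by simp; omega⟩

theorem wp_writeLast (hn₀ : 0 < n₀) (hW : Roomy W n₀ m q) {z : ℕ → ℕ → ℕ} {K : ℕ → Prop}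
    {v : ℕ → ℕ} {M : ℕ → ℕ} {σ : Config} (hσ : BlockEnv P n₀ m q z v σ)
    (h_flip : ∀ p < P, σ.reg p 9 = blockFlip n₀ z (v p))
    (h_mem : σ.mem = majorityMem P n₀ m q z K v (n₀ - 1) M) :
    wp W P (write (var 14 + var 4 * var 0 + var 8) (var 9)) σ fun σ' t => Env P n₀ m q σ' ∧
      σ'.reg = σ.reg ∧ σ'.mem = majorityMem P n₀ m q z K v n₀ M ∧ t ≤ 20 := by
  rw [Roomy] at hW
  have h_T : addrT n₀ m q = addrZ n₀ m q + m * n₀ := rfl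
  have h_last : n₀ - 1 < n₀ := Nat.sub_lt hn₀ one_pos
  refine wp_write (by simp) (by simp) (fun p hp => ?_) (fun p hp => ?_)
    ⟨hσ.env.write _ _, rfl, ?_, by simp⟩
  · have h_lt := mul_add_lt h_last (hσ.item_lt p hp)
    have h_item_lt := hσ.item_lt p hp
    simp only [Arith.Fits, Arith.eval, hσ.item p hp, hσ.width p hp, hσ.env.addrZ_eq p hp,
      hσ.env.n₀_eq p hp]
    omega
  · have h_flip_le := blockFlip_le n₀ z (v p)
    simp [h_flip p hp]
    omega
  · refine (write_mem_eq_majorityMem h_last h_mem (fun p hp => ?_) fun p hp => ?_).trans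
      (by rw [Nat.sub_add_cancel hn₀])
    · simp [hσ.item p hp, hσ.width p hp, hσ.env.addrZ_eq p hp, hσ.env.n₀_eq p hp]
    · simp [h_flip p hp, majorityEntry]

theorem wp_majority (hP : 0 < P) (hn₀ : 0 < n₀) (hW : Roomy W n₀ m q) {z : ℕ → ℕ → ℕ}
    {K : ℕ → Prop} {v : ℕ → ℕ} {M : ℕ → ℕ} {σ : Config} (hσ : Env P n₀ m q σ)
    (hv : ∀ p < P, σ.reg p 4 = v p ∧ v p < m)
    (h_synd : ∀ p < P, ∀ l < n₀ - 1, σ.mem (addrSZ m q + v p * (n₀ - 1) + l) = z (v p) l)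
    (h_synd_le : ∀ p < P, ∀ l < n₀ - 1, z (v p) l ≤ 1)
    (h_mem : σ.mem = majorityMem P n₀ m q z K v 0 M) :
    wp W P majority σ fun σ' t => Env P n₀ m q σ' ∧ (∀ p < P, σ'.reg p 4 = v p) ∧
      σ'.mem = majorityMem P n₀ m q z K v n₀ M ∧ t ≤ 100 + n₀ * 100 := by
  have h_large := hW
  rw [Roomy] at h_large
  refine wp_seq (wp_assign (by simp) (fun p hp => ?_) ?_)
  · simp [hσ.n₀_eq p hp]
    omega
  have hσ₁ : BlockEnv P n₀ m q z v (σ.assign 8 (var 0 - lit 1)) :=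
    ⟨hσ.assign (by norm_num) (by norm_num) _, fun p hp => by simp [(hv p hp).1],
      fun p hp => (hv p hp).2, fun p hp => by simp [hσ.n₀_eq p hp], h_synd, h_synd_le⟩
  refine wp_seq (wp_mono (wp_countBlock hP hW hσ₁) ?_)
  rintro σ₂ t₂ ⟨hσ₂, h_count, h_mem₂, h_time₂⟩
  refine wp_seq (wp_assign (by simp) (fun p hp => ?_) ?_)
  · have h_count_le : blockCount n₀ z (v p) ≤ n₀ - 1 :=
      (Finset.sum_le_card_nsmul _ _ 1 fun l hl =>
        h_synd_le p hp l (Finset.mem_range.1 hl)).trans (by simp)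
    simp [h_count p hp, hσ₂.env.n₀_eq p hp]
    omega
  refine wp_seq (wp_mono (wp_writeBlock hP hW (hσ₂.assign (by simp) _) (fun p hp => ?_)
    (h_mem₂.trans h_mem)) ?_)
  · simp only [Config.assign_reg, if_pos, Arith.eval_sub, Arith.eval, h_count p hp,
      hσ₂.env.n₀_eq p hp, blockFlip]
    split_ifs <;> omega
  rintro σ₃ t₃ ⟨hσ₃, h_flip, h_mem₃, h_time₃⟩
  refine wp_mono (wp_writeLast hn₀ hW hσ₃ h_flip h_mem₃) ?_
  rintro σ₄ t₄ ⟨hσ₄, h_reg₄, h_mem₄, h_time₄⟩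
  exact ⟨hσ₄, fun p hp => h_reg₄ ▸ hσ₃.item p hp, h_mem₄, by simp; omega⟩

theorem processesItems_majority (hP : 0 < P) (hn₀ : 0 < n₀) (hW : Roomy W n₀ m q)
    {z : ℕ → ℕ → ℕ} {M : ℕ → ℕ} (hz : ∀ k < m, ∀ l < n₀ - 1, z k l ≤ 1)
    (hM : ∀ k < m, ∀ l < n₀ - 1, M (addrSZ m q + k * (n₀ - 1) + l) = z k l) :
    ProcessesItems W P n₀ m q majority (100 + n₀ * 100) fun K M' =>
      M' = overlay (RowCell (addrZ n₀ m q) n₀ K)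
        (arrayMem (addrZ n₀ m q) n₀ (majorityEntry n₀ z)) M := by
  intro K v σ hσ hv h_mem
  have h_Z : addrX n₀ m q ≤ addrZ n₀ m q := Nat.le_add_right _ _
  refine wp_mono (wp_majority (K := K) (M := M) hP hn₀ hW hσ hv (fun p hp l hl => ?_)
    (fun p hp => hz _ (hv p hp).2) ?_) ?_
  · rw [h_mem, overlay_neg, hM _ (hv p hp).2 l hl]
    exact fun h => (base_le_of_rowCell h).not_gt
      ((syndZ_lt_addrX (hv p hp).2 hl).trans_le h_Z)
  · rw [majorityMem, partialRowCell_zero]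
    exact h_mem
  · rintro σ' t ⟨hσ', h_item, h_mem', h_time⟩
    rw [majorityMem, partialRowCell_width] at h_mem'
    exact ⟨hσ', h_item, h_mem', h_time⟩

end MajorityProgram

section DecoderProgram

variable {W n₀ m q : ℕ} {f : ℕ → ℕ → ℕ} {s : Fin 8 × Fin q → ZMod 2} {z : ℕ → ℕ → ℕ} {M₀ : ℕ → ℕ}

/-- The vector `x` is a possible result of bit flipping on the graph `f` with syndrome `s`. There is
no graph with `q = 0` checks in each group; bit flipping then leaves the estimate at `0`. -/
def FlipResult (m q : ℕ) (f : ℕ → ℕ → ℕ) (s : Fin 8 × Fin q → ZMod 2) (x : Fin m → ZMod 2) :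
    Prop :=
  (q = 0 → x = 0) ∧ ∀ g : Fin m → Fin 8 → Fin q, (∀ k j, (g k j : ℕ) = f k j) →
    ∃ a : ℕ → FlipState m q, a 0 = (s, 0) ∧
      (∀ i < 8 * q, FlipStep g (a i) (a (i + 1))) ∧ (a (8 * q)).2 = x

/-- The memory contains the input of the decoder for the graph `f` and the syndrome `s`, `z`, and
nothing else. -/
structure InputMem (n₀ m q : ℕ) (f : ℕ → ℕ → ℕ) (s : Fin 8 × Fin q → ZMod 2) (z : ℕ → ℕ → ℕ)
    (M : ℕ → ℕ) : Prop where
  zero : M 0 = n₀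
  one : M 1 = m
  two : M 2 = 8 * q
  matrix : ∀ j < 8, ∀ t < q, ∀ v < m, M (3 + (j * q + t) * m + v) = if f v j = t then 1 else 0
  syndX : ∀ (j : Fin 8) (t : Fin q), M (addrSX m q + j * q + t) = (s (j, t)).val
  syndZ : ∀ k < m, ∀ l < n₀ - 1, M (addrSZ m q + k * (n₀ - 1) + l) = z k l
  syndZ_le : ∀ k < m, ∀ l < n₀ - 1, z k l ≤ 1
  blank : ∀ x, addrX n₀ m q ≤ x → M x = 0

/-- The `X`-part of the output holds the estimate `x`, at the first qubit of each block and
modulo `2`. -/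
structure EstimateMem (n₀ m q : ℕ) (x : Fin m → ZMod 2) (M : ℕ → ℕ) : Prop where
  estimate : ∀ k : Fin m, (M (addrX n₀ m q + k * n₀) : ZMod 2) = x k
  padding : ∀ k < m, ∀ l, 0 < l → l < n₀ → M (addrX n₀ m q + k * n₀ + l) = 0

/-- The memory after tabulation of the checks of the graph `f`, if it was `M` at the beginning. -/
noncomputable def tabulatedMem (n₀ m q : ℕ) (f : ℕ → ℕ → ℕ) (M : ℕ → ℕ) : ℕ → ℕ :=
  overlay (RowCell (addrT n₀ m q) 8 fun k => k < m)
    (arrayMem (addrT n₀ m q) 8 (tableEntry m q f)) M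

theorem overlay_rowCell_of_lt {base w x : ℕ} (hx : x < base) (K : ℕ → Prop) (F M : ℕ → ℕ) :
    overlay (RowCell base w K) F M x = M x :=
  overlay_neg fun h => (base_le_of_rowCell h).not_gt hx

theorem addrZ_le_addrT (n₀ m q : ℕ) : addrZ n₀ m q ≤ addrT n₀ m q := Nat.le_add_right _ _

theorem outputX_lt_addrZ {k l : ℕ} (hk : k < m) (hl : l < n₀) :
    addrX n₀ m q + k * n₀ + l < addrZ n₀ m q := by
  rw [add_assoc]
  exact Nat.add_lt_add_left (mul_add_lt hl hk) _

theorem EstimateMem.congr {x : Fin m → ZMod 2} {M M' : ℕ → ℕ} (hn₀ : 0 < n₀)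
    (h : EstimateMem n₀ m q x M) (hM : ∀ x < addrZ n₀ m q, M' x = M x) :
    EstimateMem n₀ m q x M' where
  estimate k := (congrArg _ (hM _ (outputX_lt_addrZ k.isLt hn₀))).trans (h.estimate k)
  padding k hk l hl hl_lt := (hM _ (outputX_lt_addrZ hk hl_lt)).trans (h.padding k hk l hl hl_lt)

theorem InputMem.tabulatedMem_eq_zero (h : InputMem n₀ m q f s z M₀) {x : ℕ}
    (hx : addrX n₀ m q ≤ x) (hx' : x < addrT n₀ m q) : tabulatedMem n₀ m q f M₀ x = 0 :=
  (overlay_rowCell_of_lt hx' _ _ _).trans (h.blank x hx)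

theorem InputMem.tabulatedMem_outputX (h : InputMem n₀ m q f s z M₀) {k l : ℕ} (hk : k < m)
    (hl : l < n₀) : tabulatedMem n₀ m q f M₀ (addrX n₀ m q + k * n₀ + l) = 0 :=
  h.tabulatedMem_eq_zero (by omega) ((outputX_lt_addrZ hk hl).trans_le (addrZ_le_addrT n₀ m q))

theorem InputMem.estimateMem_tabulatedMem (hn₀ : 0 < n₀) (h : InputMem n₀ m q f s z M₀) :
    EstimateMem n₀ m q 0 (tabulatedMem n₀ m q f M₀) where
  estimate k := congrArg Nat.cast (h.tabulatedMem_outputX k.isLt hn₀)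
  padding _ hk _ _ hl := h.tabulatedMem_outputX hk hl

theorem InputMem.roundMem_tabulatedMem (hn₀ : 0 < n₀) (hm : 0 < m)
    (h : InputMem n₀ m q f s z M₀) {g : Fin m → Fin 8 → Fin q} (hg : ∀ k j, (g k j : ℕ) = f k j) :
    RoundMem n₀ g M₀ 0 (s, 0) (tabulatedMem n₀ m q f M₀) where
  table k j := by
    rw [tabulatedMem, overlay_pos ⟨k, k.isLt, j, j.isLt, rfl⟩, arrayMem_apply _ _ j.isLt,
      tableEntry, ← hg, if_pos (g k j).isLt]
  dummy j := by
    have h_T := addrX_le_addrT n₀ m q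
    rw [tabulatedMem, overlay_neg, h.blank _ (by omega)]
    rintro ⟨k, hk, i, hi, h_eq⟩
    omega
  dummy_check_le := by
    have h_SX := three_le_addrSX m q
    have h_SZ := addrSX_le_addrSZ m q
    have h_T := addrSZ_le_addrT n₀ m q
    rw [tabulatedMem, overlay_rowCell_of_lt (by omega), h.zero]
    exact Nat.le_succ n₀
  syndX j t := by
    rw [tabulatedMem, overlay_rowCell_of_lt, h.syndX]
    exact (check_lt_addrSZ j t).trans_le (addrSZ_le_addrT n₀ m q)
  syndZ x _ hx := overlay_rowCell_of_lt (hx.trans_le (addrX_le_addrT n₀ m q)) _ _ _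
  estimate := (h.estimateMem_tabulatedMem hn₀).estimate
  estimate_le k hk := by
    have h_row : k * n₀ ≤ m * n₀ := Nat.mul_le_mul_right n₀ hk
    have h_pos : 0 < m * n₀ := Nat.mul_pos hm hn₀
    refine (h.tabulatedMem_eq_zero (by omega) ?_).le
    simp only [addrT, addrZ]
    omega
  padding := (h.estimateMem_tabulatedMem hn₀).padding

theorem wp_rounds {par : Bool} (hn₀ : 0 < n₀) (hm : 0 < m) (hW : Roomy W n₀ m q)
    {g : Fin m → Fin 8 → Fin q} {a₀ : FlipState m q} {σ : Config}
    (hσ : Env (processors par m) n₀ m q σ) (h : RoundMem n₀ g M₀ 0 a₀ σ.mem) :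
    wp W (processors par m) (.loop 2 (round par)) σ fun σ' t =>
      Env (processors par m) n₀ m q σ' ∧
      (∃ a : ℕ → FlipState m q, a 0 = a₀ ∧ (∀ i < 8 * q, FlipStep g (a i) (a (i + 1))) ∧
        RoundMem n₀ g M₀ (8 * q) (a (8 * q)) σ'.mem) ∧
      t ≤ 1 + 8 * q * (600 + repetitions par m * 510 + 1) := by
  have hP := processors_pos par hm
  refine wp_loop (8 * q) (600 + repetitions par m * 510)
    (fun i σ' => Env (processors par m) n₀ m q σ' ∧ ∃ a : ℕ → FlipState m q, a 0 = a₀ ∧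
      (∀ i' < i, FlipStep g (a i') (a (i' + 1))) ∧ RoundMem n₀ g M₀ i (a i) σ'.mem) hP
    (by norm_num) (hσ.r_eq 0 hP) ⟨hσ, fun _ => a₀, rfl, by simp, h⟩ ?_
    fun σ' t h_inv ht => ⟨h_inv.1, h_inv.2, ht⟩
  rintro i hi σ' ⟨hσ', a, h_zero, h_step, h_mem⟩
  refine wp_mono (wp_round hn₀ hm hW hi hσ' h_mem) ?_
  rintro σ'' t ⟨⟨hσ'', a', h_flip, h_mem'⟩, h_time⟩
  refine ⟨⟨hσ'', Function.update a (i + 1) a', ?_, fun i' hi' => ?_, ?_⟩, h_time⟩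
  · rw [Function.update_of_ne (by omega), h_zero]
  · rw [Function.update_of_ne (by omega)]
    rcases Nat.lt_succ_iff_lt_or_eq.1 hi' with h_lt | rfl
    · rw [Function.update_of_ne (by omega)]
      exact h_step i' h_lt
    · rwa [Function.update_self]
  · rwa [Function.update_self]

theorem wp_bitFlipping {par : Bool} (hn₀ : 0 < n₀) (hm : 0 < m) (hW : Roomy W n₀ m q)
    (hM₀ : InputMem n₀ m q f s z M₀) (hf : 0 < q → ∀ v < m, ∀ j < 8, f v j < q) {σ : Config}
    (hσ : Env (processors par m) n₀ m q σ) (h_mem : σ.mem = tabulatedMem n₀ m q f M₀) :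
    wp W (processors par m) (.loop 2 (round par)) σ fun σ' t =>
      Env (processors par m) n₀ m q σ' ∧
      (∃ x, FlipResult m q f s x ∧ EstimateMem n₀ m q x σ'.mem) ∧
      (∀ x, addrSZ m q ≤ x → x < addrX n₀ m q → σ'.mem x = M₀ x) ∧
      t ≤ 1 + 8 * q * (600 + repetitions par m * 510 + 1) := by
  have hP := processors_pos par hm
  rcases Nat.eq_zero_or_pos q with rfl | hq
  · refine wp_loop 0 0 (fun _ σ' => Env (processors par m) n₀ m 0 σ' ∧ σ'.mem = σ.mem) hP
      (by norm_num) (hσ.r_eq 0 hP) ⟨hσ, rfl⟩ (fun i hi => absurd hi i.not_lt_zero) ?_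
    rintro σ' t ⟨hσ', h_mem'⟩ ht
    rw [h_mem', h_mem]
    exact ⟨hσ', ⟨0, ⟨fun _ => rfl, fun g _ => (g ⟨0, hm⟩ 0).elim0⟩,
      hM₀.estimateMem_tabulatedMem hn₀⟩,
      fun x _ hx => overlay_rowCell_of_lt (hx.trans_le (addrX_le_addrT n₀ m 0)) _ _ _, by omega⟩
  · let g : Fin m → Fin 8 → Fin q := fun k j => ⟨f k j, hf hq k k.isLt j j.isLt⟩
    refine wp_mono (wp_rounds hn₀ hm hW hσ
      (h_mem ▸ hM₀.roundMem_tabulatedMem hn₀ hm (g := g) fun _ _ => rfl)) ?_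
    rintro σ' t ⟨hσ', ⟨a, h_zero, h_step, h_round⟩, h_time⟩
    refine ⟨hσ', ⟨(a (8 * q)).2, ⟨fun h => absurd h hq.ne', fun g' hg' => ?_⟩,
      h_round.estimate, h_round.padding⟩, h_round.syndZ, h_time⟩
    obtain rfl : g' = g := funext fun k => funext fun j => Fin.ext (hg' k j)
    exact ⟨a, h_zero, h_step, rfl⟩

theorem wp_majorityPhase {par : Bool} (hn₀ : 0 < n₀) (hm : 0 < m) (hW : Roomy W n₀ m q)
    (hz : ∀ k < m, ∀ l < n₀ - 1, z k l ≤ 1) {x : Fin m → ZMod 2} {σ : Config}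
    (hσ : Env (processors par m) n₀ m q σ) (h_est : EstimateMem n₀ m q x σ.mem)
    (h_synd : ∀ k < m, ∀ l < n₀ - 1, σ.mem (addrSZ m q + k * (n₀ - 1) + l) = z k l) :
    wp W (processors par m) (forEach par majority) σ fun σ' t =>
      EstimateMem n₀ m q x σ'.mem ∧
      (∀ k < m, ∀ l < n₀, σ'.mem (addrZ n₀ m q + k * n₀ + l) = majorityEntry n₀ z k l) ∧
      t ≤ 10 + repetitions par m * (100 + n₀ * 100 + 10) := by
  have h_large := hW
  rw [Roomy] at h_large
  refine wp_mono (wp_forEach (by omega) (processesItems_majority (processors_pos par hm) hn₀ hW hz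
    h_synd) hσ (by rw [rowCell_false, overlay_false])) ?_
  rintro σ' t ⟨-, h_mem, h_time⟩
  refine ⟨h_est.congr hn₀ fun y hy => ?_, fun k hk l hl => ?_, h_time⟩
  · rw [h_mem, overlay_rowCell_of_lt hy]
  · rw [h_mem, overlay_pos ⟨k, hk, l, hl, rfl⟩, arrayMem_apply _ _ hl]

theorem repetitions_pos (par : Bool) (hm : 0 < m) : 0 < repetitions par m := by
  rw [repetitions]
  split_ifs <;> omega

theorem phaseTimes_le {R : ℕ} (hR : 0 < R) (hm : 0 < m) (hqm : q ≤ m) :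
    (100 + 8 * q * 30) + ((10 + R * (8 * (q * 50 + 60) + 20 + 10)) +
      ((1 + 8 * q * (600 + R * 510 + 1)) + (10 + R * (100 + n₀ * 100 + 10)))) ≤
      20000 * (R * (m + n₀)) := by
  have h_Rq : R * q ≤ R * m := Nat.mul_le_mul_left R hqm
  have h_q : q ≤ R * q := Nat.le_mul_of_pos_left q hR
  have h_R : R ≤ R * m := Nat.le_mul_of_pos_right R hm
  ring_nf at h_Rq h_q h_R ⊢
  omega

theorem wp_decoder {par : Bool} (hn₀ : 0 < n₀) (hm : 0 < m) (hqm : q ≤ m) (hW : Roomy W n₀ m q)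
    {σ : Config} (h_input : InputMem n₀ m q f s z σ.mem)
    (hf : 0 < q → ∀ v < m, ∀ j < 8, f v j < q) :
    wp W (processors par m) (decoder par) σ fun σ' t =>
      (∃ x, FlipResult m q f s x ∧ EstimateMem n₀ m q x σ'.mem) ∧
      (∀ k < m, ∀ l < n₀, σ'.mem (addrZ n₀ m q + k * n₀ + l) = majorityEntry n₀ z k l) ∧
      t ≤ 20000 * (repetitions par m * (m + n₀)) := by
  have hP := processors_pos par hm
  have h_large := hW
  rw [Roomy] at h_large
  refine wp_seq (wp_mono (wp_setup hP hW h_input.zero h_input.one h_input.two) ?_)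
  rintro σ₁ t₁ ⟨hσ₁, h_mem₁, h_time₁⟩
  refine wp_seq (wp_mono (wp_forEach (by omega)
    (processesItems_tabulate hP hW h_input.matrix) hσ₁
    (by rw [rowCell_false, overlay_false, h_mem₁])) ?_)
  rintro σ₂ t₂ ⟨hσ₂, h_mem₂, h_time₂⟩
  refine wp_seq (wp_mono (wp_bitFlipping hn₀ hm hW h_input hf hσ₂ h_mem₂) ?_)
  rintro σ₃ t₃ ⟨hσ₃, ⟨x, h_flip, h_est⟩, h_synd, h_time₃⟩
  refine wp_mono (wp_majorityPhase hn₀ hm hW h_input.syndZ_le hσ₃ h_est fun k hk l hl => ?_) ?_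
  · rw [h_synd _ (by omega) (syndZ_lt_addrX hk hl), h_input.syndZ k hk l hl]
  · rintro σ₄ t₄ ⟨h_est', h_majority, h_time₄⟩
    refine ⟨⟨x, h_flip, h_est'⟩, h_majority, ?_⟩
    exact (by omega : _ ≤ _).trans (phaseTimes_le (n₀ := n₀) (repetitions_pos par hm) hm hqm)

end DecoderProgram

section Input

variable {n₀ m r q : ℕ}

theorem finProdFinEquiv_val {k l : ℕ} (i : Fin k) (j : Fin l) :
    (finProdFinEquiv (i, j) : ℕ) = i * l + j := by
  rw [finProdFinEquiv_apply_val, add_comm, mul_comm]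

theorem getD_append_add (l l' : List ℕ) (i : ℕ) :
    (l ++ l').getD (l.length + i) 0 = l'.getD i 0 := by
  rw [List.getD_append_right _ _ _ _ (Nat.le_add_right _ _), Nat.add_sub_cancel_left]

theorem getD_ofFn {k : ℕ} (g : Fin k → ℕ) (i : Fin k) : (List.ofFn g).getD i 0 = g i := by
  rw [List.getD_eq_getElem _ _ (by simp), List.getElem_ofFn]

section InitConfig

variable (H₂ : Matrix (Fin r) (Fin m) (ZMod 2)) (sX : Fin r → ZMod 2)
  (sZ : Fin m × Fin (n₀ - 1) → ZMod 2)

theorem length_decoderInput :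
    (decoderInput n₀ H₂ sX sZ).length = 3 + r * m + r + m * (n₀ - 1) := by
  simp only [decoderInput, List.length_append, List.length_ofFn, List.length_cons, List.length_nil]

theorem initConfig_matrix (c : Fin r) (v : Fin m) :
    (initConfig (decoderInput n₀ H₂ sX sZ)).mem (3 + c * m + v) = (H₂ c v).val := by
  change (decoderInput n₀ H₂ sX sZ).getD _ 0 = _
  rw [decoderInput, List.append_assoc, List.append_assoc, add_assoc, ← finProdFinEquiv_val]
  refine (getD_append_add [n₀, m, r] _ _).trans ?_
  rw [List.getD_append _ _ _ _ (by rw [List.length_ofFn]; exact Fin.isLt _), getD_ofFn,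
    Equiv.symm_apply_apply]

theorem initConfig_syndX (c : Fin r) :
    (initConfig (decoderInput n₀ H₂ sX sZ)).mem (3 + r * m + c) = (sX c).val := by
  have h_length : 3 + r * m = ([n₀, m, r] ++ List.ofFn fun i : Fin (r * m) =>
      (H₂ (finProdFinEquiv.symm i).1 (finProdFinEquiv.symm i).2).val).length := by
    rw [List.length_append, List.length_ofFn]
    rfl
  change (decoderInput n₀ H₂ sX sZ).getD _ 0 = _
  rw [decoderInput, List.append_assoc, h_length, getD_append_add,
    List.getD_append _ _ _ _ (by rw [List.length_ofFn]; exact c.isLt), getD_ofFn]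

theorem initConfig_syndZ (k : Fin m) (l : Fin (n₀ - 1)) :
    (initConfig (decoderInput n₀ H₂ sX sZ)).mem (3 + r * m + r + k * (n₀ - 1) + l) =
      (sZ (k, l)).val := by
  have h_length : 3 + r * m + r = ([n₀, m, r] ++ (List.ofFn fun i : Fin (r * m) =>
      (H₂ (finProdFinEquiv.symm i).1 (finProdFinEquiv.symm i).2).val) ++
      List.ofFn fun i : Fin r => (sX i).val).length := by
    rw [List.length_append, List.length_append, List.length_ofFn, List.length_ofFn]
    rfl
  change (decoderInput n₀ H₂ sX sZ).getD _ 0 = _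
  rw [decoderInput, add_assoc, ← finProdFinEquiv_val, h_length, getD_append_add, getD_ofFn,
    Equiv.symm_apply_apply]

end InitConfig

/-- The parity check matrix of the code given by the bipartite graph `f`: the check
`finProdFinEquiv (j, t)` contains the variables whose `j`-th neighbour is `t`. -/
def graphMatrix (m q : ℕ) (f : ℕ → ℕ → ℕ) : Matrix (Fin (8 * q)) (Fin m) (ZMod 2) := fun c v =>
  if f v (finProdFinEquiv.symm c).1 = (finProdFinEquiv.symm c).2 then 1 else 0

/-- The `Z`-part of the syndrome as an array of numbers, extended by `0`. -/
def syndromeArray (sZ : Fin m × Fin (n₀ - 1) → ZMod 2) (k l : ℕ) : ℕ :=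
  if h : k < m ∧ l < n₀ - 1 then (sZ (⟨k, h.1⟩, ⟨l, h.2⟩)).val else 0

theorem inputMem_initConfig (f : ℕ → ℕ → ℕ) (sX : Fin (8 * q) → ZMod 2)
    (sZ : Fin m × Fin (n₀ - 1) → ZMod 2) :
    InputMem n₀ m q f (fun c => sX (finProdFinEquiv c)) (syndromeArray sZ)
      (initConfig (decoderInput n₀ (graphMatrix m q f) sX sZ)).mem where
  zero := rfl
  one := rfl
  two := rfl
  matrix j hj t ht v hv := by
    have h_entry := initConfig_matrix (graphMatrix m q f) sX sZ
      (finProdFinEquiv (⟨j, hj⟩, ⟨t, ht⟩)) ⟨v, hv⟩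
    rw [finProdFinEquiv_val] at h_entry
    refine h_entry.trans ?_
    rw [graphMatrix, Equiv.symm_apply_apply]
    split_ifs <;> rfl
  syndX j t := by
    rw [add_assoc, ← finProdFinEquiv_val]
    exact initConfig_syndX _ sX sZ _
  syndZ k hk l hl := by
    rw [syndromeArray, dif_pos ⟨hk, hl⟩]
    exact initConfig_syndZ _ sX sZ ⟨k, hk⟩ ⟨l, hl⟩
  syndZ_le k hk l hl := by
    rw [syndromeArray, dif_pos ⟨hk, hl⟩]
    exact Nat.lt_succ_iff.1 (ZMod.val_lt _)
  blank x hx := List.getD_eq_default _ _ ((length_decoderInput _ sX sZ).trans_le hx)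

theorem roomy_wordCount (hn₀ : 0 < n₀) (hm : 0 < m) (hN : 1 < n₀ * m) (hq : 8 * q ≤ m) :
    Roomy (wordCount 8 (n₀ * m)) n₀ m q := by
  obtain ⟨Y, hY⟩ : ∃ Y, Y = 2 ^ (Nat.log 2 (n₀ * m) + 1) := ⟨_, rfl⟩
  have h_words : wordCount 8 (n₀ * m) = Y ^ 8 := by
    rw [wordCount, hY, ← pow_mul, mul_comm]
  have h_N : n₀ * m < Y := hY ▸ Nat.lt_pow_succ_log_self (by norm_num) _
  have h_four : 4 ≤ Y := by
    have h_log : 1 ≤ Nat.log 2 (n₀ * m) := Nat.log_pos (by norm_num) hN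
    calc 4 = 2 ^ (1 + 1) := by norm_num
      _ ≤ Y := hY ▸ Nat.pow_le_pow_right (by norm_num) (by omega)
  have h_m : m ≤ Y := (Nat.le_mul_of_pos_left m hn₀).trans h_N.le
  have h_n₀ : n₀ ≤ Y := (Nat.le_mul_of_pos_right n₀ hm).trans h_N.le
  have h_matrix : 8 * q * m ≤ Y * Y := Nat.mul_le_mul (hq.trans h_m) h_m
  have h_output : m * n₀ ≤ Y := mul_comm n₀ m ▸ h_N.le
  have h_synd : m * (n₀ - 1) ≤ m * n₀ := Nat.mul_le_mul_left m (Nat.sub_le _ _)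
  have h_sq : 4 * Y ≤ Y * Y := Nat.mul_le_mul_right Y h_four
  have h_pow : 4 ^ 6 * (Y * Y) ≤ Y ^ 8 := by
    rw [show Y ^ 8 = Y ^ 6 * (Y * Y) by ring]
    exact Nat.mul_le_mul_right _ (Nat.pow_le_pow_left h_four 6)
  rw [Roomy, h_words]
  simp only [addrT, addrZ, addrX, addrSZ, addrSX]
  omega

theorem decoder_spec [NeZero n₀] [NeZero m] (par : Bool) (hN : 1 < n₀ * m) (hq : 8 * q ≤ m)
    {f : ℕ → ℕ → ℕ} (hf : 0 < q → ∀ v < m, ∀ j < 8, f v j < q) (sX : Fin (8 * q) → ZMod 2)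
    (sZ : Fin m × Fin (n₀ - 1) → ZMod 2) :
    decoderTime (decoder par) 8 (processors par m) n₀ (graphMatrix m q f) sX sZ ≤
      20000 * (repetitions par m * (m + n₀)) ∧
    (∃ x, FlipResult m q f (fun c => sX (finProdFinEquiv c)) x ∧
      (decoderOutput (decoder par) 8 (processors par m) n₀ (graphMatrix m q f) sX sZ).1 =
        firstQubits x) ∧
    (decoderOutput (decoder par) 8 (processors par m) n₀ (graphMatrix m q f) sX sZ).2 =
      fun i => (majorityEntry n₀ (syndromeArray sZ) i.1 i.2 : ZMod 2) := by
  have hn₀ := NeZero.pos n₀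
  have hm := NeZero.pos m
  obtain ⟨σ', h_sim, ⟨x, h_flip, h_est⟩, h_majority, h_time⟩ :=
    wp_decoder (par := par) hn₀ hm (by omega) (roomy_wordCount hn₀ hm hN hq)
      (inputMem_initConfig f sX sZ) hf _ ⟨rfl, fun _ _ _ _ => rfl⟩
  have h_length : (decoderInput n₀ (graphMatrix m q f) sX sZ).length = addrX n₀ m q :=
    length_decoderInput _ _ _
  refine ⟨h_time, ⟨x, h_flip, funext fun ⟨k, l⟩ => ?_⟩, funext fun ⟨k, l⟩ => ?_⟩
  · simp only [decoderOutput, decoderRun]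
    rw [h_length, finProdFinEquiv_val, h_sim.1, ← add_assoc, firstQubits]
    by_cases hl : l = 0
    · rw [if_pos hl, ← h_est.estimate k, hl, Fin.val_zero, add_zero]
    · rw [if_neg hl, h_est.padding k k.isLt l (Fin.pos_iff_ne_zero.2 hl) l.isLt, Nat.cast_zero]
  · simp only [decoderOutput, decoderRun]
    rw [h_length, finProdFinEquiv_val, h_sim.1, ← h_majority k k.isLt l l.isLt, ← add_assoc,
      ← add_assoc]
    rfl

end Input

/-! ### The outer code -/

section OuterCode

variable {m q : ℕ}

theorem graphMatrix_mulVec {f : ℕ → ℕ → ℕ} {g : Fin m → Fin 8 → Fin q}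
    (hg : ∀ k j, (g k j : ℕ) = f k j) (y : Fin m → ZMod 2) (c : Fin 8 × Fin q) :
    (graphMatrix m q f *ᵥ y) (finProdFinEquiv c) = (tannerMatrix g *ᵥ y) c := by
  rw [Matrix.mulVec, Matrix.mulVec, dotProduct, dotProduct]
  refine Finset.sum_congr rfl fun v _ => ?_
  rw [graphMatrix, Equiv.symm_apply_apply, ← hg]
  simp [tannerMatrix, Fin.ext_iff]

theorem exists_outerGraph (m : ℕ) : ∃ f : ℕ → ℕ → ℕ,
    (0 < m / 16 → ∀ v < m, ∀ j < 8, f v j < m / 16) ∧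
    ∀ g : Fin m → Fin 8 → Fin (m / 16), (∀ k j, (g k j : ℕ) = f k j) →
      IsLosslessExpander g (m / 2 ^ 23) := by
  rcases Nat.eq_zero_or_pos (m / 16) with hq | hq
  · refine ⟨fun _ _ => 0, fun hq' => absurd hq hq'.ne', fun g _ S ⟨v, _⟩ _ => ?_⟩
    exact absurd (g v 0).isLt (by omega)
  · have : Nonempty (Fin (m / 16)) := ⟨⟨0, hq⟩⟩
    obtain ⟨g, hg⟩ := exists_isLosslessExpander (V := Fin m) (B := Fin (m / 16)) (T := m / 2 ^ 23)
      (by simp only [Fintype.card_fin]; omega) (by simp only [Fintype.card_fin]; omega)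
    refine ⟨fun v j => if h : v < m ∧ j < 8 then g ⟨v, h.1⟩ ⟨j, h.2⟩ else 0,
      fun _ v hv j hj => ?_, fun g' hg' => ?_⟩
    · simp only [hv, hj, and_self, dif_pos, Fin.is_lt]
    · have h_eq : g' = g := funext fun k => funext fun j => Fin.ext (by simpa using hg' k j)
      exact h_eq ▸ hg

/-- A bipartite lossless expander with `m` variables of degree `8` and `8 * (m / 16)` checks: the
`j`-th neighbour of the variable `v` is the check `outerGraph m v j` of the group `j`. Numbers are
used in place of `Fin (m / 16)`, which is empty for `m < 16`. -/
noncomputable def outerGraph (m : ℕ) : ℕ → ℕ → ℕ := (exists_outerGraph m).choose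

/-- The parity check matrix `H₂` of the outer code, an expander code. -/
noncomputable def outerMatrix (m : ℕ) : Matrix (Fin (8 * (m / 16))) (Fin m) (ZMod 2) :=
  graphMatrix m (m / 16) (outerGraph m)

theorem outerGraph_lt (m : ℕ) (hq : 0 < m / 16) :
    ∀ v < m, ∀ j < 8, outerGraph m v j < m / 16 :=
  (exists_outerGraph m).choose_spec.1 hq

theorem exists_isLosslessExpander_eq_outerGraph (hq : 0 < m / 16) :
    ∃ g : Fin m → Fin 8 → Fin (m / 16), (∀ k j, (g k j : ℕ) = outerGraph m k j) ∧
      IsLosslessExpander g (m / 2 ^ 23) :=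
  ⟨fun k j => ⟨outerGraph m k j, outerGraph_lt m hq k k.isLt j j.isLt⟩, fun _ _ => rfl,
    (exists_outerGraph m).choose_spec.2 _ fun _ _ => rfl⟩

theorem lt_hammingNorm_of_outerMatrix_mulVec_eq_zero {y : Fin m → ZMod 2}
    (hy : outerMatrix m *ᵥ y = 0) (hy₀ : y ≠ 0) : m / 2 ^ 23 < hammingNorm y := by
  rcases Nat.eq_zero_or_pos (m / 16) with hq | hq
  · have h_pos := hammingNorm_pos_iff.2 hy₀
    omega
  · obtain ⟨g, hg, h_expander⟩ := exists_isLosslessExpander_eq_outerGraph hq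
    by_contra! h_small
    have h_synd := h_expander.card_mul_hammingNorm_lt hy₀ h_small
    have h_zero : tannerMatrix g *ᵥ y = 0 := funext fun c => by
      rw [← graphMatrix_mulVec hg]
      exact congrFun hy _
    rw [h_zero, hammingNorm_zero] at h_synd
    omega

theorem exists_outerMatrix_mulVec_eq_zero [NeZero m] : ∃ y, outerMatrix m *ᵥ y = 0 ∧ y ≠ 0 := by
  have hm := NeZero.pos m
  have h_ker := LinearMap.ker_ne_bot_of_finrank_lt (f := (outerMatrix m).mulVecLin) (by
    rw [Module.finrank_fin_fun, Module.finrank_fin_fun]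
    omega)
  exact Submodule.exists_mem_ne_zero_of_ne_bot h_ker

theorem eq_of_flipResult_outerGraph {e x : Fin m → ZMod 2}
    (hx : FlipResult m (m / 16) (outerGraph m)
      (fun c => (outerMatrix m *ᵥ e) (finProdFinEquiv c)) x)
    (he : 2 * hammingNorm e ≤ m / 2 ^ 23) : x = e := by
  rcases Nat.eq_zero_or_pos (m / 16) with hq | hq
  · rw [hx.1 hq, hammingNorm_eq_zero.1 (by omega : hammingNorm e = 0)]
  · obtain ⟨g, hg, h_expander⟩ := exists_isLosslessExpander_eq_outerGraph hq
    obtain ⟨a, h_zero, h_step, rfl⟩ := hx.2 g hg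
    refine eq_error_of_flipSteps h_expander he (h_zero.trans ?_) (by simp) h_step
    exact congrArg (·, 0) (funext fun c => graphMatrix_mulVec hg e c)

theorem le_minDist_stab_outerMatrix {n₀ : ℕ} [NeZero n₀] [NeZero m] {w : ℝ}
    (hm : w * 2 ^ 23 ≤ m) (hn₀ : w ≤ n₀) : w ≤ minDist (stab n₀ (outerMatrix m)) := by
  have h_dist := le_minDist_stab (d := min (m / 2 ^ 23 + 1) n₀) (min_le_right _ _)
    (fun y hy hy₀ => (min_le_left _ _).trans (lt_hammingNorm_of_outerMatrix_mulVec_eq_zero hy hy₀))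
    exists_outerMatrix_mulVec_eq_zero
  refine le_trans ?_ (Nat.cast_le.2 h_dist)
  have h_div : m ≤ (m / 2 ^ 23 + 1) * 2 ^ 23 := by omega
  rw [Nat.cast_min]
  refine le_min (le_of_mul_le_mul_right (hm.trans ?_) (by positivity)) hn₀
  exact_mod_cast h_div

end OuterCode

/-! ### Majority decoding of the inner code -/

section Majority

theorem hammingNorm_eq_sum_val {ι : Type} [Fintype ι] (y : Bits ι) :
    hammingNorm y = ∑ i, (y i).val := by
  rw [hammingNorm, Finset.card_filter]
  refine Finset.sum_congr rfl fun i _ => ?_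
  rcases zmod_two_eq_zero_or_one (y i) with h | h <;> simp [h, ZMod.val_one]

theorem val_add_one_add_val : ∀ a : ZMod 2, (a + 1).val + a.val = 1 := by decide

variable {n m : ℕ} {b : Bits (Qubit (n + 1) m)}

theorem syndromeArray_checkZ_mulVec (k : Fin m) (i : Fin n) :
    syndromeArray (checkZ (n + 1) m *ᵥ b) k i = (b (k, i.castSucc) + b (k, Fin.last n)).val := by
  rw [syndromeArray, dif_pos ⟨k.isLt, i.isLt⟩]
  exact congrArg ZMod.val (checkZ_succ_mulVec b k i)

theorem blockCount_checkZ_mulVec (k : Fin m) :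
    blockCount (n + 1) (syndromeArray (checkZ (n + 1) m *ᵥ b)) k =
      ∑ i : Fin n, (b (k, i.castSucc) + b (k, Fin.last n)).val := by
  rw [blockCount, Finset.sum_range]
  exact Finset.sum_congr rfl fun i _ => syndromeArray_checkZ_mulVec k i

theorem blockFlip_checkZ_mulVec (k : Fin m) (hb : 2 * hammingNorm (fun i => b (k, i)) < n + 1) :
    (blockFlip (n + 1) (syndromeArray (checkZ (n + 1) m *ᵥ b)) k : ZMod 2) = b (k, Fin.last n) := by
  rw [hammingNorm_eq_sum_val, Fin.sum_univ_castSucc] at hb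
  rw [blockFlip, blockCount_checkZ_mulVec]
  rcases zmod_two_eq_zero_or_one (b (k, Fin.last n)) with h_last | h_last
  · rw [h_last] at hb ⊢
    simp only [add_zero, ZMod.val_zero] at hb ⊢
    rw [if_neg (by omega), Nat.cast_zero]
  · rw [h_last, ZMod.val_one] at hb
    rw [h_last]
    have h_compl : ∑ i : Fin n, (b (k, i.castSucc) + 1).val +
        ∑ i : Fin n, (b (k, i.castSucc)).val = n := by
      simp [← Finset.sum_add_distrib, val_add_one_add_val]
    rw [if_pos (by omega), Nat.cast_one]

theorem majorityEntry_checkZ_mulVec {n₀ : ℕ} [NeZero n₀] {b : Bits (Qubit n₀ m)} (k : Fin m)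
    (hb : 2 * hammingNorm (fun i => b (k, i)) < n₀) (l : Fin n₀) :
    (majorityEntry n₀ (syndromeArray (checkZ n₀ m *ᵥ b)) k l : ZMod 2) = b (k, l) := by
  obtain ⟨n, rfl⟩ := Nat.exists_eq_succ_of_ne_zero (NeZero.ne n₀)
  rw [majorityEntry]
  induction l using Fin.lastCases with
  | last => rw [if_neg (by simp), blockFlip_checkZ_mulVec k hb]
  | cast i =>
    rw [if_pos (by simp), Nat.cast_add, blockFlip_checkZ_mulVec k hb, Fin.val_castSucc,
      syndromeArray_checkZ_mulVec, ZMod.natCast_zmod_val, add_assoc, CharTwo.add_self_eq_zero,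
      add_zero]

end Majority

/-! ### Correctness of the decoder -/

section Decoding

variable {n₀ m : ℕ} [NeZero n₀] [NeZero m]

theorem decoderTime_outerMatrix_le (par : Bool) (hN : 1 < n₀ * m)
    (sX : Fin (8 * (m / 16)) → ZMod 2) (sZ : Fin m × Fin (n₀ - 1) → ZMod 2) :
    decoderTime (decoder par) 8 (processors par m) n₀ (outerMatrix m) sX sZ ≤
      20000 * (repetitions par m * (m + n₀)) :=
  (decoder_spec par hN (by omega) (outerGraph_lt m) sX sZ).1

theorem decoder_corrects (par : Bool) (hN : 1 < n₀ * m) {a b : Bits (Qubit n₀ m)}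
    (ha : 2 * hammingNorm (blockParity a) ≤ m / 2 ^ 23)
    (hb : ∀ k, 2 * hammingNorm (fun i => b (k, i)) < n₀) :
    DecoderCorrects (decoder par) 8 (processors par m) n₀ (outerMatrix m) a b := by
  obtain ⟨-, ⟨x, h_flip, h_fst⟩, h_snd⟩ := decoder_spec par hN (by omega) (outerGraph_lt m)
    (checkX n₀ (outerMatrix m) *ᵥ a) (checkZ n₀ m *ᵥ b)
  rw [checkX_mulVec] at h_flip
  refine code_corrects ?_ (h_snd.trans ?_)
  · refine (congrArg blockParity h_fst).trans ?_
    rw [blockParity_firstQubits, eq_of_flipResult_outerGraph h_flip ha]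
  · exact funext fun i => majorityEntry_checkZ_mulVec i.1 (hb i.1) i.2

theorem decoder_corrects_of_pauliWeight_lt (par : Bool) {w : ℝ} (hN : 1 < n₀ * m)
    (hm : w * 2 ^ 23 ≤ m) (hn₀ : w ≤ n₀) {a b : Bits (Qubit n₀ m)}
    (hw : 2 * (pauliWeight a b : ℝ) < w) :
    DecoderCorrects (decoder par) 8 (processors par m) n₀ (outerMatrix m) a b := by
  have h_outer : 2 * pauliWeight a b * 2 ^ 23 ≤ m := by
    have h_real : 2 * (pauliWeight a b : ℝ) * 2 ^ 23 ≤ m := by linarith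
    exact_mod_cast h_real
  have h_inner : 2 * pauliWeight a b < n₀ := by exact_mod_cast hw.trans_le hn₀
  refine decoder_corrects par hN ?_ fun k => ?_
  · have ha := (hammingNorm_blockParity_le a).trans (hammingNorm_le_pauliWeight_left a b)
    omega
  · have hb := (hammingNorm_block_le b k).trans (hammingNorm_le_pauliWeight_right a b)
    omega

end Decoding

/-! ### Random errors -/

section RandomErrors

/-- The probability of the error `b` if every position suffers an error independently with
probability `p`. -/
def errorProb {ι : Type} [Fintype ι] (p : ℝ) (b : Bits ι) : ℝ := ∏ i, if b i = 1 then p else 1 - p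

theorem errorProb_nonneg {ι : Type} [Fintype ι] {p : ℝ} (hp : 0 ≤ p) (hp' : p ≤ 1) (b : Bits ι) :
    0 ≤ errorProb p b :=
  Finset.prod_nonneg fun i _ => by split_ifs <;> linarith

theorem sum_errorProb_mul_pow_card {ι : Type} [Fintype ι] [DecidableEq ι] (p t : ℝ)
    (S : Finset ι) :
    ∑ b : Bits ι, errorProb p b * t ^ (S.filter fun i => b i ≠ 0).card =
      (1 + (t - 1) * p) ^ S.card := by
  have h_prod (b : Bits ι) : errorProb p b * t ^ (S.filter fun i => b i ≠ 0).card =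
      ∏ i, (if b i = 1 then p else 1 - p) * if i ∈ S ∧ b i ≠ 0 then t else 1 := by
    rw [Finset.prod_mul_distrib, errorProb, ← Finset.prod_filter, Finset.prod_const,
      ← Finset.filter_filter, Finset.filter_mem_eq_inter, Finset.univ_inter]
  have h_factor (i : ι) : ∑ x : ZMod 2, (if x = 1 then p else 1 - p) *
      (if i ∈ S ∧ x ≠ 0 then t else 1) = if i ∈ S then 1 + (t - 1) * p else 1 := by
    rw [sum_zmod_two]
    by_cases hi : i ∈ S
    · simp only [hi, ne_eq, not_true_eq_false, and_false, one_ne_zero, not_false_eq_true, and_self,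
        zero_ne_one, if_true, if_false]
      ring
    · simp [hi]
  simp_rw [h_prod]
  rw [← Fintype.prod_sum fun i (x : ZMod 2) => (if x = 1 then p else 1 - p) *
    if i ∈ S ∧ x ≠ 0 then t else 1]
  simp_rw [h_factor]
  rw [← Finset.prod_filter, Finset.prod_const, Finset.filter_mem_eq_inter, Finset.univ_inter]

theorem sum_errorProb_mul_pow_hammingNorm {V B : Type} [Fintype V] [Fintype B] [DecidableEq V]
    [DecidableEq B] (p t : ℝ) (v : V) :
    ∑ b : Bits (V × B), errorProb p b * t ^ hammingNorm (fun i => b (v, i)) =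
      (1 + (t - 1) * p) ^ Fintype.card B := by
  rw [← Finset.card_univ, ← Finset.card_map (Function.Embedding.sectR v B),
    ← sum_errorProb_mul_pow_card]
  refine Finset.sum_congr rfl fun b _ => ?_
  rw [Finset.filter_map, Finset.card_map]
  rfl

variable {n₀ m : ℕ} [NeZero n₀] [NeZero m] {p : ℝ}

theorem exists_le_two_mul_hammingNorm_of_not_decoderCorrects (par : Bool) (hN : 1 < n₀ * m)
    {b : Bits (Qubit n₀ m)}
    (hb : ¬ DecoderCorrects (decoder par) 8 (processors par m) n₀ (outerMatrix m) 0 b) :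
    ∃ k, n₀ ≤ 2 * hammingNorm (fun i => b (k, i)) := by
  by_contra! h_blocks
  exact hb (decoder_corrects par hN (by simp) h_blocks)

theorem indicator_not_decoderCorrects_le (par : Bool) (hN : 1 < n₀ * m) (hp : 0 ≤ p) (hp' : p ≤ 1)
    {u : ℝ} (hu : 1 ≤ u) (b : Bits (Qubit n₀ m)) :
    {b | ¬ DecoderCorrects (decoder par) 8 (processors par m) n₀ (outerMatrix m) 0 b}.indicator
        (errorProb p) b ≤
      ∑ k, errorProb p b * (u ^ 2) ^ hammingNorm (fun i => b (k, i)) / u ^ n₀ := by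
  have h_prob := errorProb_nonneg hp hp' b
  have h_nonneg : ∀ k ∈ Finset.univ,
      0 ≤ errorProb p b * (u ^ 2) ^ hammingNorm (fun i => b (k, i)) / u ^ n₀ :=
    fun k _ => by positivity
  refine Set.indicator_apply_le' (fun hb => ?_) fun _ => Finset.sum_nonneg h_nonneg
  obtain ⟨k, hk⟩ := exists_le_two_mul_hammingNorm_of_not_decoderCorrects par hN hb
  refine le_trans ?_ (Finset.single_le_sum h_nonneg (Finset.mem_univ k))
  rw [le_div_iff₀ (by positivity), ← pow_mul]
  gcongr

/-- A Chernoff bound with parameter `u ^ 2` in each block, and a union bound over the blocks. -/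
theorem failProb_le (par : Bool) (hN : 1 < n₀ * m) (hp : 0 ≤ p) (hp' : p ≤ 1) {u : ℝ}
    (hu : 1 ≤ u) :
    failProb (decoder par) 8 (processors par m) n₀ (outerMatrix m) p ≤
      m * ((1 + (u ^ 2 - 1) * p) / u) ^ n₀ := by
  calc failProb (decoder par) 8 (processors par m) n₀ (outerMatrix m) p
      ≤ ∑ b : Bits (Qubit n₀ m), ∑ k,
          errorProb p b * (u ^ 2) ^ hammingNorm (fun i => b (k, i)) / u ^ n₀ :=
        Finset.sum_le_sum fun b _ => indicator_not_decoderCorrects_le par hN hp hp' hu b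
    _ = ∑ _k : Fin m, (1 + (u ^ 2 - 1) * p) ^ n₀ / u ^ n₀ := by
        rw [Finset.sum_comm]
        simp_rw [← Finset.sum_div, sum_errorProb_mul_pow_hammingNorm, Fintype.card_fin]
    _ = m * ((1 + (u ^ 2 - 1) * p) / u) ^ n₀ := by
        rw [Finset.sum_const, Finset.card_univ, Fintype.card_fin, nsmul_eq_mul, ← div_pow]

theorem exists_forall_pow_mul_pow_le {α ρ : ℝ} (hα : 0 < α) (hρ : 0 ≤ ρ) (hρ' : ρ < 1) (e : ℕ)
    {ε : ℝ} (hε : 0 < ε) :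
    ∃ N₀ : ℕ, ∀ n N : ℕ, N₀ ≤ N → α * √(N : ℝ) ≤ n → (N : ℝ) ^ e * ρ ^ n ≤ ε := by
  have h_tendsto := tendsto_pow_const_mul_const_pow_of_lt_one (2 * e) hρ hρ'
  obtain ⟨K, hK⟩ := Filter.eventually_atTop.1
    (h_tendsto.eventually_le_const (show (0 : ℝ) < ε * α ^ (2 * e) by positivity))
  refine ⟨⌈(K / α) ^ 2⌉₊, fun n N hN hn => ?_⟩
  have hKn : (K : ℝ) ≤ n := by
    refine le_trans ?_ hn
    rw [← div_le_iff₀' hα]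
    exact Real.le_sqrt_of_sq_le ((Nat.le_ceil _).trans (by exact_mod_cast hN))
  have h_pow : α ^ (2 * e) * (N : ℝ) ^ e ≤ (n : ℝ) ^ (2 * e) := by
    have h_sqrt := pow_le_pow_left₀ (by positivity) hn (2 * e)
    rwa [mul_pow, pow_mul √(N : ℝ), Real.sq_sqrt (Nat.cast_nonneg N)] at h_sqrt
  refine le_of_mul_le_mul_left ?_ (show 0 < α ^ (2 * e) by positivity)
  calc α ^ (2 * e) * ((N : ℝ) ^ e * ρ ^ n)
      = α ^ (2 * e) * (N : ℝ) ^ e * ρ ^ n := (mul_assoc _ _ _).symm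
    _ ≤ (n : ℝ) ^ (2 * e) * ρ ^ n := by gcongr
    _ ≤ ε * α ^ (2 * e) := hK n (by exact_mod_cast hKn)
    _ = α ^ (2 * e) * ε := mul_comm _ _

end RandomErrors

theorem exists_chernoff_base_lt_one {p : ℝ} (hp : 0 ≤ p) (hp' : p < 1 / 2) :
    ∃ u : ℝ, 1 ≤ u ∧ 0 ≤ (1 + (u ^ 2 - 1) * p) / u ∧ (1 + (u ^ 2 - 1) * p) / u < 1 := by
  have hu : 1 ≤ 2 - 2 * p := by linarith
  refine ⟨2 - 2 * p, hu, ?_, ?_⟩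
  · have h_sq : 0 ≤ (2 - 2 * p) ^ 2 - 1 := sub_nonneg.2 (one_le_pow₀ hu)
    positivity
  · rw [div_lt_one (by linarith)]
    have h_pos : 0 < (1 - 2 * p) ^ 2 * (1 - p) := by
      have : 0 < 1 - 2 * p := by linarith
      have : 0 < 1 - p := by linarith
      positivity
    linarith

theorem exists_forall_pow_mul_failProb_le {α p ε : ℝ} (hα : 0 < α) (hp : 0 ≤ p) (hp' : p < 1 / 2)
    (e : ℕ) (hε : 0 < ε) :
    ∃ N₀ : ℕ, ∀ n₀ m : ℕ, N₀ ≤ n₀ * m → α * √((n₀ * m : ℕ) : ℝ) ≤ n₀ → ∀ par : Bool,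
      ((n₀ * m : ℕ) : ℝ) ^ e *
        failProb (decoder par) 8 (processors par m) n₀ (outerMatrix m) p ≤ ε := by
  obtain ⟨u, hu, h_nonneg, h_lt⟩ := exists_chernoff_base_lt_one hp hp'
  obtain ⟨N₀, hN₀⟩ := exists_forall_pow_mul_pow_le hα h_nonneg h_lt (e + 1) hε
  refine ⟨max N₀ 2, fun n₀ m hN h_block par => ?_⟩
  have h_two : 1 < n₀ * m := (le_max_right N₀ 2).trans hN
  have : NeZero n₀ := ⟨left_ne_zero_of_mul (zero_lt_one.trans h_two).ne'⟩
  have : NeZero m := ⟨right_ne_zero_of_mul (zero_lt_one.trans h_two).ne'⟩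
  have h_blocks : (m : ℝ) ≤ ((n₀ * m : ℕ) : ℝ) :=
    Nat.cast_le.2 (Nat.le_mul_of_pos_left m (NeZero.pos n₀))
  refine le_trans ?_ (hN₀ n₀ _ ((le_max_left N₀ 2).trans hN) h_block)
  rw [pow_succ, mul_assoc]
  gcongr
  exact (failProb_le par h_two hp (by linarith) hu).trans (by gcongr)

/-! ### Constants -/

section Constants

/-- The constant `c` in the bounds `k ≥ c√N` and `d ≥ c√N` if `α√N ≤ n₀ ≤ β√N`. The distance of
the outer code contributes the factor `2⁻²³`. -/
noncomputable def rateConstant (α β : ℝ) : ℝ := min α (1 / (2 ^ 23 * β))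

/-- The constant `C` in the bounds on time, processors and circuits if `α√N ≤ n₀ ≤ β√N`. -/
noncomputable def costConstant (α β : ℝ) : ℝ := 20000 * (1 + 1 / α + β + 1 / α ^ 2)

variable {α β : ℝ} {n₀ m : ℕ}

theorem rateConstant_pos (hα : 0 < α) (hβ : 0 < β) : 0 < rateConstant α β :=
  lt_min hα (by positivity)

theorem costConstant_pos (hα : 0 < α) (hβ : 0 < β) : 0 < costConstant α β := by
  rw [costConstant]
  positivity

theorem sqrt_mul_self_eq_cast_mul (n₀ m : ℕ) :
    √((n₀ * m : ℕ) : ℝ) * √((n₀ * m : ℕ) : ℝ) = n₀ * m := by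
  rw [Real.mul_self_sqrt (Nat.cast_nonneg _), Nat.cast_mul]

theorem mul_blocks_le_sqrt (hN : 0 < n₀ * m) (hα : α * √((n₀ * m : ℕ) : ℝ) ≤ n₀) :
    α * m ≤ √((n₀ * m : ℕ) : ℝ) := by
  refine le_of_mul_le_mul_right ?_ (Real.sqrt_pos.2 (Nat.cast_pos.2 hN))
  rw [sqrt_mul_self_eq_cast_mul, mul_right_comm]
  gcongr

theorem sqrt_le_mul_blocks (hN : 0 < n₀ * m) (hβ : (n₀ : ℝ) ≤ β * √((n₀ * m : ℕ) : ℝ)) :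
    √((n₀ * m : ℕ) : ℝ) ≤ β * m := by
  refine le_of_mul_le_mul_right ?_ (Real.sqrt_pos.2 (Nat.cast_pos.2 hN))
  rw [sqrt_mul_self_eq_cast_mul, mul_right_comm]
  gcongr

theorem rateConstant_mul_sqrt_le (β : ℝ) (hα : α * √((n₀ * m : ℕ) : ℝ) ≤ n₀) :
    rateConstant α β * √((n₀ * m : ℕ) : ℝ) ≤ n₀ :=
  (mul_le_mul_of_nonneg_right (min_le_left _ _) (Real.sqrt_nonneg _)).trans hα

theorem rateConstant_mul_sqrt_mul_le (α : ℝ) (hβ₀ : 0 < β) (hN : 0 < n₀ * m)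
    (hβ : (n₀ : ℝ) ≤ β * √((n₀ * m : ℕ) : ℝ)) :
    rateConstant α β * √((n₀ * m : ℕ) : ℝ) * 2 ^ 23 ≤ m := by
  calc rateConstant α β * √((n₀ * m : ℕ) : ℝ) * 2 ^ 23
      ≤ 1 / (2 ^ 23 * β) * (β * m) * 2 ^ 23 := by
        gcongr
        · exact min_le_right _ _
        · exact sqrt_le_mul_blocks hN hβ
    _ = (m : ℝ) := by field_simp

theorem le_costConstant_mul_sqrt {t : ℕ} (hα₀ : 0 < α) (hN : 0 < n₀ * m)
    (hα : α * √((n₀ * m : ℕ) : ℝ) ≤ n₀) (hβ : (n₀ : ℝ) ≤ β * √((n₀ * m : ℕ) : ℝ))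
    (ht : t ≤ 20000 * (m + n₀)) : (t : ℝ) ≤ costConstant α β * √((n₀ * m : ℕ) : ℝ) := by
  have h_blocks := (le_div_iff₀' hα₀).2 (mul_blocks_le_sqrt hN hα)
  have h_rest : 0 ≤ (1 + 1 / α ^ 2) * √((n₀ * m : ℕ) : ℝ) := by positivity
  calc (t : ℝ) ≤ 20000 * (m + n₀) := by exact_mod_cast ht
    _ ≤ 20000 * (√((n₀ * m : ℕ) : ℝ) / α + β * √((n₀ * m : ℕ) : ℝ)) := by gcongr
    _ ≤ 20000 * (√((n₀ * m : ℕ) : ℝ) / α + β * √((n₀ * m : ℕ) : ℝ)) +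
        20000 * ((1 + 1 / α ^ 2) * √((n₀ * m : ℕ) : ℝ)) := by linarith
    _ = costConstant α β * √((n₀ * m : ℕ) : ℝ) := by rw [costConstant]; ring

theorem le_costConstant_mul {t : ℕ} (hα₀ : 0 < α) (hβ₀ : 0 < β) (hN : 0 < n₀ * m)
    (hα : α * √((n₀ * m : ℕ) : ℝ) ≤ n₀) (ht : t ≤ 20000 * (m * (m + n₀))) :
    (t : ℝ) ≤ costConstant α β * (n₀ * m : ℕ) := by
  have h_blocks := (le_div_iff₀' hα₀).2 (mul_blocks_le_sqrt hN hα)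
  have h_sq : (m : ℝ) * m ≤ 1 / α ^ 2 * (n₀ * m : ℕ) := by
    calc (m : ℝ) * m ≤ √((n₀ * m : ℕ) : ℝ) / α * (√((n₀ * m : ℕ) : ℝ) / α) := by gcongr
      _ = 1 / α ^ 2 * (n₀ * m : ℕ) := by
        rw [div_mul_div_comm, sqrt_mul_self_eq_cast_mul, Nat.cast_mul]
        ring
  have h_rest : 0 ≤ (1 / α + β) * (n₀ * m : ℕ) := by positivity
  calc (t : ℝ) ≤ 20000 * (m * (m + n₀)) := by exact_mod_cast ht
    _ = 20000 * (m * m + (n₀ * m : ℕ)) := by push_cast; ring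
    _ ≤ 20000 * (1 / α ^ 2 * (n₀ * m : ℕ) + (n₀ * m : ℕ)) +
        20000 * ((1 / α + β) * (n₀ * m : ℕ)) := by linarith
    _ = costConstant α β * (n₀ * m : ℕ) := by rw [costConstant]; ring

end Constants

end PCCSS

theorem corollary2_general :
    ∃ (r : ℕ → ℕ) (H₂ : ∀ m : ℕ, Matrix (Fin (r m)) (Fin m) (ZMod 2))
      (seqDec parDec : PCCSS.Prog) (κ : ℕ) (procs : ℕ → ℕ → ℕ),
      (∀ m, r m ≤ m) ∧
      ∀ α β : ℝ, 0 < α → 0 < β →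
        (∃ c C : ℝ, 0 < c ∧ 0 < C ∧
          ∀ n₀ m N : ℕ, 1 < N → N = n₀ * m →
            α * √(N : ℝ) ≤ n₀ → (n₀ : ℝ) ≤ β * √(N : ℝ) →
            (∃ k : ℕ, Module.finrank ℂ (PCCSS.code n₀ (H₂ m)) = 2 ^ k ∧ c * √(N : ℝ) ≤ k) ∧
            c * √(N : ℝ) ≤ PCCSS.minDist (PCCSS.stab n₀ (H₂ m)) ∧
            (∀ sX sZ, (PCCSS.decoderTime seqDec κ 1 n₀ (H₂ m) sX sZ : ℝ) ≤ C * N) ∧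
            (∀ a b, 2 * (PCCSS.pauliWeight a b : ℝ) < c * √(N : ℝ) →
              PCCSS.DecoderCorrects seqDec κ 1 n₀ (H₂ m) a b) ∧
            0 < procs n₀ m ∧ (procs n₀ m : ℝ) ≤ C * √(N : ℝ) ∧
            (∀ sX sZ, (PCCSS.decoderTime parDec κ (procs n₀ m) n₀ (H₂ m) sX sZ : ℝ) ≤
              C * √(N : ℝ)) ∧
            (∀ a b, 2 * (PCCSS.pauliWeight a b : ℝ) < c * √(N : ℝ) →
              PCCSS.DecoderCorrects parDec κ (procs n₀ m) n₀ (H₂ m) a b) ∧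
            (∃ circ : PCCSS.Circuit (PCCSS.Qubit n₀ m), circ.Encodes (PCCSS.code n₀ (H₂ m)) ∧
              (circ.size : ℝ) ≤ C * N ∧ (circ.depth : ℝ) ≤ C * √(N : ℝ))) ∧
        (∀ p : ℝ, 0 ≤ p → p < 1 / 2 → ∀ e : ℕ, ∀ ε : ℝ, 0 < ε → ∃ N₀ : ℕ,
          ∀ n₀ m N : ℕ, N₀ ≤ N → N = n₀ * m → α * √(N : ℝ) ≤ n₀ →
            (N : ℝ) ^ e * PCCSS.failProb seqDec κ 1 n₀ (H₂ m) p ≤ ε ∧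
            (N : ℝ) ^ e * PCCSS.failProb parDec κ (procs n₀ m) n₀ (H₂ m) p ≤ ε) := by
  refine ⟨fun m => 8 * (m / 16), PCCSS.outerMatrix, PCCSS.decoder false, PCCSS.decoder true, 8,
    fun _ m => m, fun m => (by omega : 8 * (m / 16) ≤ m), fun α β hα₀ hβ₀ =>
    ⟨⟨PCCSS.rateConstant α β, PCCSS.costConstant α β, PCCSS.rateConstant_pos hα₀ hβ₀,
      PCCSS.costConstant_pos hα₀ hβ₀, ?_⟩, fun p hp hp' e ε hε => ?_⟩⟩
  · rintro n₀ m _ hN rfl hα hβ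
    have hN₀ : 0 < n₀ * m := zero_lt_one.trans hN
    have : NeZero n₀ := ⟨left_ne_zero_of_mul hN₀.ne'⟩
    have : NeZero m := ⟨right_ne_zero_of_mul hN₀.ne'⟩
    have hm := NeZero.pos m
    have h_block := PCCSS.rateConstant_mul_sqrt_le β hα
    have h_blocks := PCCSS.rateConstant_mul_sqrt_mul_le α hβ₀ hN₀ hβ
    have h_linear {t : ℕ} := PCCSS.le_costConstant_mul_sqrt (t := t) hα₀ hN₀ hα hβ
    have h_quadratic {t : ℕ} := PCCSS.le_costConstant_mul (t := t) hα₀ hβ₀ hN₀ hα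
    obtain ⟨⟨k, hk, hmk⟩, circ, h_encodes, h_size, h_depth⟩ :=
      PCCSS.exists_encoder (n₀ := n₀) (PCCSS.outerMatrix m)
    have h_time (par : Bool) := PCCSS.decoderTime_outerMatrix_le (n₀ := n₀) (m := m) par hN
    have h_corrects (par : Bool) a b :=
      PCCSS.decoder_corrects_of_pauliWeight_lt (a := a) (b := b) par hN h_blocks h_block
    have h_dim : (m : ℝ) ≤ 2 * k := by exact_mod_cast (by omega : m ≤ 2 * k)
    exact ⟨⟨k, hk, by linarith⟩, PCCSS.le_minDist_stab_outerMatrix h_blocks h_block,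
      fun sX sZ => h_quadratic (h_time false sX sZ), h_corrects false, hm,
      h_linear (show m ≤ _ by omega),
      fun sX sZ => h_linear ((h_time true sX sZ).trans (by simp [PCCSS.repetitions])),
      h_corrects true, circ, h_encodes, h_quadratic (h_size.trans (by nlinarith)),
      h_linear (by omega)⟩
  · obtain ⟨N₀, hN₀⟩ := PCCSS.exists_forall_pow_mul_failProb_le hα₀ hp hp' e hε
    refine ⟨N₀, ?_⟩
    rintro n₀ m _ hN rfl hα
    exact ⟨hN₀ n₀ m hN hα false, hN₀ n₀ m hN hα true⟩

theorem corollary2 :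
    ∃ (r : ℕ → ℕ) (H₂ : ∀ m : ℕ, Matrix (Fin (r m)) (Fin m) (ZMod 2))
      (seqDec parDec : PCCSS.Prog) (κ : ℕ) (procs : ℕ → ℕ → ℕ),
      (∀ m, r m ≤ m) ∧
      ∀ α β : ℝ, 0 < α → 0 < β →
        (∃ c C : ℝ, 0 < c ∧ 0 < C ∧
          ∀ n₀ m N : ℕ, 1 < n₀ → 1 < N → N = n₀ * m →
            α * √(N : ℝ) ≤ n₀ → (n₀ : ℝ) ≤ β * √(N : ℝ) →
            -- parameters
            (∃ k : ℕ, Module.finrank ℂ (PCCSS.code n₀ (H₂ m)) = 2 ^ k ∧ c * √(N : ℝ) ≤ k) ∧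
            c * √(N : ℝ) ≤ PCCSS.minDist (PCCSS.stab n₀ (H₂ m)) ∧
            -- sequential decoding
            (∀ sX sZ, (PCCSS.decoderTime seqDec κ 1 n₀ (H₂ m) sX sZ : ℝ) ≤ C * N) ∧
            (∀ a b, 2 * (PCCSS.pauliWeight a b : ℝ) < c * √(N : ℝ) →
              PCCSS.DecoderCorrects seqDec κ 1 n₀ (H₂ m) a b) ∧
            -- parallel decoding
            0 < procs n₀ m ∧ (procs n₀ m : ℝ) ≤ C * √(N : ℝ) ∧
            (∀ sX sZ, (PCCSS.decoderTime parDec κ (procs n₀ m) n₀ (H₂ m) sX sZ : ℝ) ≤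
              C * √(N : ℝ)) ∧
            (∀ a b, 2 * (PCCSS.pauliWeight a b : ℝ) < c * √(N : ℝ) →
              PCCSS.DecoderCorrects parDec κ (procs n₀ m) n₀ (H₂ m) a b) ∧
            -- encoding
            (∃ circ : PCCSS.Circuit (PCCSS.Qubit n₀ m), circ.Encodes (PCCSS.code n₀ (H₂ m)) ∧
              (circ.size : ℝ) ≤ C * N ∧ (circ.depth : ℝ) ≤ C * √(N : ℝ))) ∧
        -- random `Z`-errors
        (∀ p : ℝ, 0 ≤ p → p < 1 / 4 → ∀ e : ℕ, ∀ ε : ℝ, 0 < ε → ∃ N₀ : ℕ,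
          ∀ n₀ m N : ℕ, 1 < n₀ → N₀ ≤ N → N = n₀ * m →
            α * √(N : ℝ) ≤ n₀ → (n₀ : ℝ) ≤ β * √(N : ℝ) →
            (N : ℝ) ^ e * PCCSS.failProb seqDec κ 1 n₀ (H₂ m) p ≤ ε ∧
            (N : ℝ) ^ e * PCCSS.failProb parDec κ (procs n₀ m) n₀ (H₂ m) p ≤ ε) := by
  obtain ⟨r, H₂, seqDec, parDec, κ, procs, hr, h⟩ := corollary2_general
  exact ⟨r, H₂, seqDec, parDec, κ, procs, hr, fun α β hα hβ =>
    (h α β hα hβ).imp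
      (fun ⟨c, C, hc, hC, hcC⟩ => ⟨c, C, hc, hC, fun n₀ m N _ => hcC n₀ m N⟩)
      fun h_rand p hp hp' e ε hε => (h_rand p hp (by linarith) e ε hε).imp
        fun _ hN₀ n₀ m N _ hN hNm hα' _ => hN₀ n₀ m N hN hNm hα'⟩
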